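/- **Conventions.** Let $M$ be a smooth manifold of dimension $n\ge 2$. For a Riemannian metric $g$ let $\nabla$ be its Levi-Civita connection, $\mathrm{Ric}(X,Y)=\mathrm{tr}(R^g(\cdot,X)Y)$ its Ricci tensor, $R$ its scalar curvature, $\Delta$ its Laplace–Beltrami operator, and (for $n\ge3$) $\mathsf P=\frac1{n-2}\bigl(\mathrm{Ric}-\frac{R}{2(n-1)}g\bigr)$ its Schouten tensor. Indices are raised with $g$, repeated indices are summed, and $|T|^2=T^{i_1\cdots i_r}T_{i_1\cdots i_r}$. $\Pi_{(ij)\circ}$ and $\Pi_{(ijk)\circ}$ denote the projectors onto the totally symmetric and $g$-trace-free part in the indicated indices, and $\Pi_\circ$ the ($g$-orthogonal) projector onto the totally trace-free part. The metric $g$ is conformally flat if $\Omega^2g$ is flat for some smooth nowhere vanishing function $\Omega$ on $M$. A *Weylian metric* $\Phi$ on $M$ is an equivalence class of pairs $(g,\varphi)$ of a Riemannian metric $g$ and a smooth $1$-form $\varphi$, under $(g,\varphi)\sim(\Omega^2g,\ \varphi-d\ln|\Omega|)$ for smooth nowhere vanishing functions $\Omega$; $(M,\Phi)$ is then a *Weylian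 structure*. It is *exact* if $\varphi$ is exact for some (and then for every) $(g,\varphi)\in\Phi$. A *potential* of $\varphi$ is a smooth function $\phi$ with $\varphi=d\phi$. An *abundant structure* on $(M,g)$, where $g$ is conformally flat, is a pair $(S,t)$ of a smooth, totally symmetric, trace-free $(0,3)$-tensor field $S$ and a smooth function $t$ such that, with $t_i=\nabla_it$: * if $n\ge3$, $$\nabla^2_{ij}t=3\mathsf P_{ij}+\tfrac1{3(n-2)}\Bigl(S_i{}^{ab}S_{jab}+\tfrac{n-6}{2(n-1)(n+2)}|S|^2g_{ij}\Bigr)+\tfrac13\Bigl(t_it_j-\tfrac12|\mathrm{grad}_g\,t|^2g_{ij}\Bigr),$$ $$\nabla_lS_{ijk}=\tfrac13\Pi_{(ijk)\circ}\Bigl(S_{il}{}^aS_{jka}+3S_{ijl}t_k+S_{ijk}t_l+\bigl(\tfrac4{n-2}S_j{}^{ab}S_{kab}-3S_{jka}t^a\bigr)g_{il}\Bigr),$$ $$0=\Pi_\circ\bigl(g^{ab}S_{aik}S_{bjl}-g^{ab}S_{ail}S_{bjk}\bigr);$$ * if $n=2$, $$\nabla_lS_{ijk}=\Pi_{(ijk)\circ}\bigl[-\tfrac23S_{ijk}t_l+2t_iS_{jkl}+\Xi_{ij}g_{kl}\bigr],$$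 $$\nabla_k\Xi_{ij}=\tfrac13S_{ijk}|S|^2+\tfrac43\Pi_{(ijk)\circ}\Xi_{jk}t_i+\tfrac43\Pi_{(ij)\circ}g_{jk}\beta_i,$$ $$\nabla^a\tau_{ak}=-S_{kab}\tau^{ab}+\beta_k-\tfrac23\Xi_{ka}t^a-\tfrac49S_{kab}t^at^b-\tfrac59|S|^2t_k+\tfrac12\nabla_kR-Rt_k,$$ $$\nabla^2_{ij}t=\tfrac32\bigl[\tau_{ij}+\tfrac23S_{ija}t^a+\tfrac89\Pi_{(ij)\circ}t_it_j-\tfrac13\Xi_{ij}\bigr]+\tfrac12g_{ij}\bigl[\tfrac13|S|^2+\tfrac32R\bigr],$$ where $\Xi_{ij}=\nabla^aS_{aij}+\frac23S_{ija}t^a$, $\ \beta_k=S_{kab}\Xi^{ab}$ and $\tau_{ij}=\frac23(\nabla^2_{ij}t-\frac1n\Delta t\,g_{ij})-\frac23S_{ija}t^a+\frac13\Xi_{ij}-\frac89(t_it_j-\frac1nt^at_a\,g_{ij})$. **Lemma.** Let $(M,\Phi)$ be an exact Weylian structure, let $(g,\varphi)\in\Phi$ with potential $\phi$, $\varphi=d\phi$,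 and let $(S,t)$ be an abundant structure on $(M,g)$. Let $(g',\varphi')\in\Phi$ be another representative, with potential $\phi'$, $\varphi'=d\phi'$. Let $S'=g'g^{-1}S$ be the tensor field obtained from $S$ by first raising an index with $g$ and then lowering it with $g'$, and let $t'=t-3(\phi-\phi')$. Then $(S',t')$ is an abundant structure on $(M,g')$. -/

import Mathlib

open scoped Manifold ContDiff Bundle

noncomputable section

set_option linter.unusedSectionVars false

namespace WeylAbundant

/-! ## Riemannian metrics, covariant tensors and one-forms on a smooth manifold

Manifolds are modelled on `ℝⁿ` (without boundary). -/

/-- The model space `ℝⁿ`. -/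
abbrev Model (n : ℕ) : Type := EuclideanSpace ℝ (Fin n)

/-- The tangent space of the `n`-dimensional manifold `M` at `x`. -/
abbrev Tan (n : ℕ) {M : Type*} [TopologicalSpace M] [ChartedSpace (Model n) M] (x : M) : Type :=
  TangentSpace 𝓘(ℝ, Model n) x

/-- Smooth real-valued functions. -/
abbrev SmoothFun (n : ℕ) {M : Type*} [TopologicalSpace M] [ChartedSpace (Model n) M]
    (f : M → ℝ) : Prop :=
  ContMDiff 𝓘(ℝ, Model n) 𝓘(ℝ, ℝ) ∞ f

/-- The differential of a real-valued function. -/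
abbrev differential (n : ℕ) {M : Type*} [TopologicalSpace M] [ChartedSpace (Model n) M]
    (f : M → ℝ) (x : M) : Tan n x →L[ℝ] ℝ :=
  mvfderiv 𝓘(ℝ, Model n) f x

/-- Smooth Riemannian metrics on `M`. -/
abbrev Metric (n : ℕ) (M : Type*) [TopologicalSpace M] [ChartedSpace (Model n) M]
    [IsManifold 𝓘(ℝ, Model n) ∞ M] : Type _ :=
  Bundle.ContMDiffRiemannianMetric 𝓘(ℝ, Model n) ∞ (Model n) (fun x : M => Tan n x)

/-- (Not necessarily smooth) covariant tensor fields of rank three on `M`. -/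
abbrev Tensor3 (n : ℕ) (M : Type*) [TopologicalSpace M] [ChartedSpace (Model n) M] : Type _ :=
  (x : M) → Tan n x →L[ℝ] Tan n x →L[ℝ] Tan n x →L[ℝ] ℝ

/-- `h = Ω² g` for the smooth, nowhere vanishing function `Ω`. -/
structure IsRescaling {n : ℕ} {M : Type*} [TopologicalSpace M] [ChartedSpace (Model n) M]
    [IsManifold 𝓘(ℝ, Model n) ∞ M] (Ω : M → ℝ) (g h : Metric n M) : Prop where
  smooth : SmoothFun n Ω
  ne_zero : ∀ x, Ω x ≠ 0
  eq : ∀ (x : M) (v w : Tan n x), h.inner x v w = Ω x ^ 2 * g.inner x v w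

/-! ## Weylian metrics -/

/-- A pair `(g, φ)` of a Riemannian metric and a smooth one-form. -/
structure WeylPair (n : ℕ) (M : Type*) [TopologicalSpace M] [ChartedSpace (Model n) M]
    [IsManifold 𝓘(ℝ, Model n) ∞ M] where
  metric : Metric n M
  form : (x : M) → Tan n x →L[ℝ] ℝ
  form_smooth : ContMDiff 𝓘(ℝ, Model n) (𝓘(ℝ, Model n).prod 𝓘(ℝ, Model n →L[ℝ] ℝ)) ∞
    (fun x : M => Bundle.TotalSpace.mk' (Model n →L[ℝ] ℝ)
      (E := fun x : M => Tan n x →L[ℝ] ℝ) x (form x))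

section Weylian

variable {n : ℕ} {M : Type*} [TopologicalSpace M] [ChartedSpace (Model n) M]
  [IsManifold 𝓘(ℝ, Model n) ∞ M]

/-- `(g, φ) ∼ (Ω² g, φ - d ln|Ω|)`. -/
def WeylPair.Rel (p q : WeylPair n M) : Prop :=
  ∃ Ω : M → ℝ, IsRescaling Ω p.metric q.metric ∧
    ∀ x, q.form x = p.form x - differential n (fun y => Real.log |Ω y|) x

lemma smoothFun_log_abs {Ω : M → ℝ} (h : SmoothFun n Ω) (h0 : ∀ x, Ω x ≠ 0) :
    SmoothFun n (fun x => Real.log |Ω x|) := by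
  intro x
  have h1 : ContMDiffAt 𝓘(ℝ, ℝ) 𝓘(ℝ, ℝ) ∞ Real.log (Ω x) :=
    (Real.contDiffAt_log.2 (h0 x)).contMDiffAt
  have h2 := h1.comp x (h x)
  refine h2.congr_of_eventuallyEq (Filter.Eventually.of_forall fun y => ?_)
  simp [Real.log_abs]

lemma WeylPair.rel_equivalence : Equivalence (WeylPair.Rel (n := n) (M := M)) where
  refl p := by
    refine ⟨fun _ => 1, ⟨contMDiff_const, fun _ => one_ne_zero, fun x v w => by simp⟩, fun x => ?_⟩
    simp [differential, mvfderiv_const]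
  symm := by
    rintro p q ⟨Ω, h, hf⟩
    refine ⟨fun x => (Ω x)⁻¹, ⟨?_, fun x => inv_ne_zero (h.ne_zero x), fun x v w => ?_⟩,
      fun x => ?_⟩
    · exact h.smooth.inv₀ h.ne_zero
    · rw [h.eq]
      have := h.ne_zero x
      field_simp
    · have e : (fun y => Real.log |(Ω y)⁻¹|) = -(fun y => Real.log |Ω y|) := by
        funext y; simp [Real.log_inv]
      rw [hf x, e]
      simp only [differential]
      rw [mvfderiv_neg]
      abel
  trans := by
    rintro p q r ⟨Ω, h, hf⟩ ⟨Λ, k, kf⟩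
    refine ⟨fun x => Ω x * Λ x, ⟨h.smooth.mul k.smooth,
      fun x => mul_ne_zero (h.ne_zero x) (k.ne_zero x), fun x v w => ?_⟩, fun x => ?_⟩
    · rw [k.eq, h.eq]; ring
    · have e : (fun y => Real.log |Ω y * Λ y|) =
          (fun y => Real.log |Ω y|) + (fun y => Real.log |Λ y|) := by
        funext y
        simp only [Real.log_abs, Pi.add_apply]
        exact Real.log_mul (h.ne_zero y) (k.ne_zero y)
      have d1 := ((smoothFun_log_abs h.smooth h.ne_zero) x).mdifferentiableAt (by simp)
      have d2 := ((smoothFun_log_abs k.smooth k.ne_zero) x).mdifferentiableAt (by simp)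
      rw [kf x, hf x, e]
      simp only [differential]
      rw [mvfderiv_add d1 d2]
      abel

variable (n M) in
/-- The equivalence relation on pairs `(g, φ)` that defines Weylian metrics. -/
def weylSetoid : Setoid (WeylPair n M) := ⟨WeylPair.Rel, WeylPair.rel_equivalence⟩

variable (n M) in
/-- A Weylian metric `Φ` on `M`; the pair `(M, Φ)` is a Weylian structure. -/
def WeylianMetric : Type _ := Quotient (weylSetoid n M)

/-- `p ∈ Φ`: the pair `p = (g, φ)` is a representative of `Φ`. -/
def WeylPair.Represents (p : WeylPair n M) (Φ : WeylianMetric n M) : Prop :=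
  Quotient.mk (weylSetoid n M) p = Φ

/-- `f` is a potential for the one-form `α`, i.e. `f` is smooth and `α = df`. -/
structure IsPotential (f : M → ℝ) (α : (x : M) → Tan n x →L[ℝ] ℝ) : Prop where
  smooth : SmoothFun n f
  eq : ∀ x, α x = differential n f x

/-- A Weylian structure is exact if the one-form of some representative is exact (the one-form of
every representative is then exact). -/
def WeylianMetric.IsExact (Φ : WeylianMetric n M) : Prop :=
  ∃ p : WeylPair n M, p.Represents Φ ∧ ∃ f : M → ℝ, IsPotential f p.form

/-! ## Raising and lowering an index -/

lemma metric_isInvertible (g : Metric n M) (x : M) : (g.inner x).IsInvertible := by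
  have key : ∀ B : Model n →L[ℝ] Model n →L[ℝ] ℝ, (∀ v, v ≠ 0 → 0 < B v v) → B.IsInvertible := by
    intro B hB
    have inj : Function.Injective B.toLinearMap := by
      refine (injective_iff_map_eq_zero _).2 fun v hv => ?_
      by_contra h
      have h1 := hB v h
      have h2 : B v = 0 := hv
      simp [h2] at h1
    have hd : Module.finrank ℝ (Model n) = Module.finrank ℝ (Model n →L[ℝ] ℝ) := by
      rw [← (LinearMap.toContinuousLinearMap (𝕜 := ℝ) (E := Model n) (F' := ℝ)).finrank_eq]
      exact (Subspace.dual_finrank_eq (K := ℝ) (V := Model n)).symm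
    let e : Model n ≃ₗ[ℝ] (Model n →L[ℝ] ℝ) := LinearEquiv.ofInjectiveOfFinrankEq B.toLinearMap inj hd
    exact ⟨e.toContinuousLinearEquiv, by ext v w; rfl⟩
  exact key (g.inner x) (g.pos x)

/-- The musical isomorphism `T*ₓM → TₓM` of `g`. -/
def sharp (g : Metric n M) (x : M) : (Tan n x →L[ℝ] ℝ) →L[ℝ] Tan n x := (g.inner x).inverse

lemma inner_sharp (g : Metric n M) (x : M) (α : Tan n x →L[ℝ] ℝ) :
    g.inner x (sharp g x α) = α := by
  obtain ⟨e, he⟩ := metric_isInvertible g x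
  unfold sharp
  rw [← he]
  simp

/-- `g' g⁻¹ S`: raise the last index of `S` with `g`, then lower it with `g'`. -/
def raiseLower (g g' : Metric n M) (S : Tensor3 n M) : Tensor3 n M := fun x =>
  (ContinuousLinearMap.postcomp (Tan n x) ((g'.inner x).comp (sharp g x))).comp (S x)

lemma raiseLower_apply (g g' : Metric n M) (S : Tensor3 n M) (x : M) (u v w : Tan n x) :
    raiseLower g g' S x u v w = g'.inner x (sharp g x (S x u v)) w := rfl

/-! ## Components in a chart -/

/-- The coordinate vector field `∂ᵢ` of the chart `e`, at the point with coordinates `y`. -/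
def coordVec (e : OpenPartialHomeomorph M (Model n)) (i : Fin n) (y : Model n) :
    Tan n (e.symm y) :=
  mfderiv 𝓘(ℝ, Model n) 𝓘(ℝ, Model n) e.symm y (EuclideanSpace.single i (1 : ℝ) : Model n)

/-- The components `gᵢⱼ` as functions of the coordinates. -/
def metricComp (g : Metric n M) (e : OpenPartialHomeomorph M (Model n)) :
    Fin n → Fin n → Model n → ℝ :=
  fun i j y => g.inner (e.symm y) (coordVec e i y) (coordVec e j y)

/-- The components `Sᵢⱼₖ` as functions of the coordinates. -/
def tensorComp (S : Tensor3 n M) (e : OpenPartialHomeomorph M (Model n)) :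
    Fin n → Fin n → Fin n → Model n → ℝ :=
  fun i j k y => S (e.symm y) (coordVec e i y) (coordVec e j y) (coordVec e k y)

/-- A tensor field is smooth if its components in every chart are smooth. -/
def Tensor3.Smooth (S : Tensor3 n M) : Prop :=
  ∀ e ∈ IsManifold.maximalAtlas 𝓘(ℝ, Model n) ∞ M, ∀ i j k,
    ContDiffOn ℝ ∞ (tensorComp S e i j k) e.target

end Weylian

/-! ## Tensor calculus in coordinates

`G i j`, `S i j k`, `t` are the components of a metric, of a tensor field and of a function; all are
functions of the coordinates. The index `l` of a covariant derivative comes first. -/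

section Coordinates

variable {n : ℕ}

/-- Partial derivative `∂ₖ f`. -/
def pd (k : Fin n) (f : Model n → ℝ) (y : Model n) : ℝ :=
  fderiv ℝ f y (EuclideanSpace.single k (1 : ℝ))

/-- The components `gⁱʲ` of the inverse metric. -/
def gInv (G : Fin n → Fin n → Model n → ℝ) (i j : Fin n) (y : Model n) : ℝ :=
  (Matrix.of fun a b => G a b y)⁻¹ i j

/-- Christoffel symbols `Γᵏᵢⱼ` of the Levi-Civita connection. -/
def christoffel (G : Fin n → Fin n → Model n → ℝ) (k i j : Fin n) (y : Model n) : ℝ :=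
  (1 / 2) * ∑ l, gInv G k l y * (pd i (G j l) y + pd j (G i l) y - pd l (G i j) y)

/-- Curvature: `R(∂ᵢ, ∂ⱼ)∂ₖ = ∑ₗ (curvature G l k i j) ∂ₗ`. -/
def curvature (G : Fin n → Fin n → Model n → ℝ) (l k i j : Fin n) (y : Model n) : ℝ :=
  pd i (christoffel G l j k) y - pd j (christoffel G l i k) y
    + ∑ m, (christoffel G l i m y * christoffel G m j k y
      - christoffel G l j m y * christoffel G m i k y)

/-- `Ric(X, Y) = tr (R(·, X) Y)`. -/
def ricci (G : Fin n → Fin n → Model n → ℝ) (i j : Fin n) (y : Model n) : ℝ :=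
  ∑ a, curvature G a j a i y

/-- Scalar curvature. -/
def scal (G : Fin n → Fin n → Model n → ℝ) (y : Model n) : ℝ :=
  ∑ a, ∑ b, gInv G a b y * ricci G a b y

/-- Schouten tensor (used for `n ≥ 3` only). -/
def schouten (G : Fin n → Fin n → Model n → ℝ) (i j : Fin n) (y : Model n) : ℝ :=
  1 / ((n : ℝ) - 2) * (ricci G i j y - scal G y / (2 * ((n : ℝ) - 1)) * G i j y)

/-- Hessian `∇²ᵢⱼ t`. -/
def hess (G : Fin n → Fin n → Model n → ℝ) (t : Model n → ℝ) (i j : Fin n) (y : Model n) : ℝ :=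
  pd i (pd j t) y - ∑ m, christoffel G m i j y * pd m t y

/-- Laplace-Beltrami operator. -/
def laplacian (G : Fin n → Fin n → Model n → ℝ) (t : Model n → ℝ) (y : Model n) : ℝ :=
  ∑ a, ∑ b, gInv G a b y * hess G t a b y

/-- `tⁱ = gⁱᵃ tₐ`. -/
def gradUp (G : Fin n → Fin n → Model n → ℝ) (t : Model n → ℝ) (i : Fin n) (y : Model n) : ℝ :=
  ∑ a, gInv G i a y * pd a t y

/-- `|grad t|² = tᵃ tₐ`. -/
def gradSq (G : Fin n → Fin n → Model n → ℝ) (t : Model n → ℝ) (y : Model n) : ℝ :=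
  ∑ a, gradUp G t a y * pd a t y

/-- `∇ₗ Qᵢⱼ`. -/
def nabla2 (G Q : Fin n → Fin n → Model n → ℝ) (l i j : Fin n) (y : Model n) : ℝ :=
  pd l (Q i j) y - ∑ m, (christoffel G m l i y * Q m j y + christoffel G m l j y * Q i m y)

/-- `∇ₗ Sᵢⱼₖ`. -/
def nabla3 (G : Fin n → Fin n → Model n → ℝ) (S : Fin n → Fin n → Fin n → Model n → ℝ)
    (l i j k : Fin n) (y : Model n) : ℝ :=
  pd l (S i j k) y - ∑ m, (christoffel G m l i y * S m j k y + christoffel G m l j y * S i m k y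
    + christoffel G m l k y * S i j m y)

/-- `Qᵃᵇ = gᵃᶜ gᵇᵈ Q_cd`. -/
def up2 (G Q : Fin n → Fin n → Model n → ℝ) (a b : Fin n) (y : Model n) : ℝ :=
  ∑ c, ∑ d, gInv G a c y * gInv G b d y * Q c d y

/-- `Sᵢⱼₐ tᵃ`. -/
def contrS (G : Fin n → Fin n → Model n → ℝ) (S : Fin n → Fin n → Fin n → Model n → ℝ)
    (t : Model n → ℝ) (i j : Fin n) (y : Model n) : ℝ :=
  ∑ a, S i j a y * gradUp G t a y

/-- `gᵃᵇ S_ija S_klb`. -/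
def contrSS1 (G : Fin n → Fin n → Model n → ℝ) (S : Fin n → Fin n → Fin n → Model n → ℝ)
    (i j k l : Fin n) (y : Model n) : ℝ :=
  ∑ a, ∑ b, gInv G a b y * S i j a y * S k l b y

/-- `Sᵢᵃᵇ Sⱼₐᵦ`. -/
def contrSS2 (G : Fin n → Fin n → Model n → ℝ) (S : Fin n → Fin n → Fin n → Model n → ℝ)
    (i j : Fin n) (y : Model n) : ℝ :=
  ∑ a, ∑ b, up2 G (S i) a b y * S j a b y

/-- `|S|²`. -/
def normSqS (G : Fin n → Fin n → Model n → ℝ) (S : Fin n → Fin n → Fin n → Model n → ℝ)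
    (y : Model n) : ℝ :=
  ∑ i, ∑ j, gInv G i j y * contrSS2 G S i j y

/-! ### Projectors (at a point with metric `g` and inverse metric `h`) -/

/-- `Π_(ij)∘`: symmetric, trace-free part. -/
def proj2 (g h : Fin n → Fin n → ℝ) (T : Fin n → Fin n → ℝ) (i j : Fin n) : ℝ :=
  (T i j + T j i) / 2 - (1 / (n : ℝ)) * g i j * ∑ a, ∑ b, h a b * ((T a b + T b a) / 2)

/-- Totally symmetric part. -/
def sym3 (T : Fin n → Fin n → Fin n → ℝ) (i j k : Fin n) : ℝ :=
  (T i j k + T i k j + T j i k + T j k i + T k i j + T k j i) / 6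

/-- The trace `hᵃᵇ T_abk`. -/
def trace12 (h : Fin n → Fin n → ℝ) (T : Fin n → Fin n → Fin n → ℝ) (k : Fin n) : ℝ :=
  ∑ a, ∑ b, h a b * T a b k

/-- `Π_(ijk)∘`: totally symmetric, trace-free part. -/
def proj3 (g h : Fin n → Fin n → ℝ) (T : Fin n → Fin n → Fin n → ℝ) (i j k : Fin n) : ℝ :=
  sym3 T i j k - (1 / ((n : ℝ) + 2)) *
    (g i j * trace12 h (sym3 T) k + g j k * trace12 h (sym3 T) i + g i k * trace12 h (sym3 T) j)

/-- Totally trace-free tensors of rank four: every contraction of two indices vanishes. -/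
def IsTraceFree4 (h : Fin n → Fin n → ℝ) (T : Fin n → Fin n → Fin n → Fin n → ℝ) : Prop :=
  ∀ k l, ∑ a, ∑ b, h a b * T a b k l = 0 ∧ ∑ a, ∑ b, h a b * T a k b l = 0 ∧
    ∑ a, ∑ b, h a b * T a k l b = 0 ∧ ∑ a, ∑ b, h a b * T k a b l = 0 ∧
    ∑ a, ∑ b, h a b * T k a l b = 0 ∧ ∑ a, ∑ b, h a b * T k l a b = 0

/-- The inner product of tensors of rank four. -/
def inner4 (h : Fin n → Fin n → ℝ) (T U : Fin n → Fin n → Fin n → Fin n → ℝ) : ℝ :=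
  ∑ i, ∑ j, ∑ k, ∑ l, ∑ a, ∑ b, ∑ c, ∑ d,
    h i a * h j b * h k c * h l d * T i j k l * U a b c d

/-- `W = Π_∘ T`: `W` is the orthogonal projection of `T` to the totally trace-free tensors. -/
def IsTraceFreePart4 (h : Fin n → Fin n → ℝ) (T W : Fin n → Fin n → Fin n → Fin n → ℝ) : Prop :=
  IsTraceFree4 h W ∧ ∀ U, IsTraceFree4 h U → inner4 h (T - W) U = 0

/-! ### The structural equations -/

/-- The equations for `n ≥ 3`, at the point `y`. -/
structure StructEqHigh (G : Fin n → Fin n → Model n → ℝ)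
    (S : Fin n → Fin n → Fin n → Model n → ℝ) (t : Model n → ℝ) (y : Model n) : Prop where
  hess_t : ∀ i j, hess G t i j y =
    3 * schouten G i j y
    + 1 / (3 * ((n : ℝ) - 2)) * (contrSS2 G S i j y
      + ((n : ℝ) - 6) / (2 * ((n : ℝ) - 1) * ((n : ℝ) + 2)) * normSqS G S y * G i j y)
    + 1 / 3 * (pd i t y * pd j t y - 1 / 2 * gradSq G t y * G i j y)
  nabla_S : ∀ l i j k, nabla3 G S l i j k y =
    1 / 3 * proj3 (fun a b => G a b y) (fun a b => gInv G a b y)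
      (fun i j k => contrSS1 G S i l j k y + 3 * S i j l y * pd k t y + S i j k y * pd l t y
        + (4 / ((n : ℝ) - 2) * contrSS2 G S j k y - 3 * contrS G S t j k y) * G i l y) i j k
  weyl_S : IsTraceFreePart4 (fun a b => gInv G a b y)
    (fun i j k l => ∑ a, ∑ b, (gInv G a b y * S a i k y * S b j l y
      - gInv G a b y * S a i l y * S b j k y)) 0

/-- `Ξᵢⱼ = ∇ᵃ Sₐᵢⱼ + (2/3) Sᵢⱼₐ tᵃ`. -/
def xi (G : Fin n → Fin n → Model n → ℝ) (S : Fin n → Fin n → Fin n → Model n → ℝ)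
    (t : Model n → ℝ) (i j : Fin n) (y : Model n) : ℝ :=
  ∑ a, ∑ b, gInv G a b y * nabla3 G S b a i j y + 2 / 3 * contrS G S t i j y

/-- The tensor `τ` (used for `n = 2` only). -/
def tau (G : Fin n → Fin n → Model n → ℝ) (S : Fin n → Fin n → Fin n → Model n → ℝ)
    (t : Model n → ℝ) (i j : Fin n) (y : Model n) : ℝ :=
  2 / 3 * (hess G t i j y - 1 / (n : ℝ) * laplacian G t y * G i j y)
    - 2 / 3 * contrS G S t i j y + 1 / 3 * xi G S t i j y
    - 8 / 9 * (pd i t y * pd j t y - 1 / (n : ℝ) * gradSq G t y * G i j y)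

/-- `βₖ = Sₖₐᵦ Ξᵃᵇ`. -/
def beta (G : Fin n → Fin n → Model n → ℝ) (S : Fin n → Fin n → Fin n → Model n → ℝ)
    (t : Model n → ℝ) (k : Fin n) (y : Model n) : ℝ :=
  ∑ a, ∑ b, S k a b y * up2 G (xi G S t) a b y

/-- The equations for `n = 2`, at the point `y`. -/
structure StructEqTwo (G : Fin n → Fin n → Model n → ℝ)
    (S : Fin n → Fin n → Fin n → Model n → ℝ) (t : Model n → ℝ) (y : Model n) : Prop where
  nabla_S : ∀ l i j k, nabla3 G S l i j k y =
    proj3 (fun a b => G a b y) (fun a b => gInv G a b y)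
      (fun i j k => -(2 / 3) * S i j k y * pd l t y + 2 * pd i t y * S j k l y
        + xi G S t i j y * G k l y) i j k
  nabla_xi : ∀ k i j, nabla2 G (xi G S t) k i j y =
    1 / 3 * S i j k y * normSqS G S y
    + 4 / 3 * proj3 (fun a b => G a b y) (fun a b => gInv G a b y)
      (fun i j k => xi G S t j k y * pd i t y) i j k
    + 4 / 3 * proj2 (fun a b => G a b y) (fun a b => gInv G a b y)
      (fun i j => G j k y * beta G S t i y) i j
  div_tau : ∀ k, ∑ a, ∑ b, gInv G a b y * nabla2 G (tau G S t) b a k y =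
    -(∑ a, ∑ b, S k a b y * up2 G (tau G S t) a b y) + beta G S t k y
    - 2 / 3 * ∑ a, xi G S t k a y * gradUp G t a y
    - 4 / 9 * ∑ a, contrS G S t k a y * gradUp G t a y
    - 5 / 9 * normSqS G S y * pd k t y
    + 1 / 2 * pd k (scal G) y - scal G y * pd k t y
  hess_t : ∀ i j, hess G t i j y =
    3 / 2 * (tau G S t i j y + 2 / 3 * contrS G S t i j y
      + 8 / 9 * proj2 (fun a b => G a b y) (fun a b => gInv G a b y)
          (fun i j => pd i t y * pd j t y) i j
      - 1 / 3 * xi G S t i j y)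
    + 1 / 2 * G i j y * (1 / 3 * normSqS G S y + 3 / 2 * scal G y)

end Coordinates

/-! ## Abundant structures -/

section Abundant

variable {n : ℕ} {M : Type*} [TopologicalSpace M] [ChartedSpace (Model n) M]
  [IsManifold 𝓘(ℝ, Model n) ∞ M]

/-- A metric is flat if its curvature tensor vanishes. -/
def IsFlat (h : Metric n M) : Prop :=
  ∀ e ∈ IsManifold.maximalAtlas 𝓘(ℝ, Model n) ∞ M, ∀ y ∈ e.target,
    ∀ l k i j, curvature (metricComp h e) l k i j y = 0

/-- `g` is conformally flat: some metric `Ω² g` in its conformal class is flat. -/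
def IsConformallyFlat (g : Metric n M) : Prop :=
  ∃ (Ω : M → ℝ) (h : Metric n M), IsRescaling Ω g h ∧ IsFlat h

/-- `(S, t)` is an abundant structure on `(M, g)`. -/
structure IsAbundantStructure (g : Metric n M) (S : Tensor3 n M) (t : M → ℝ) : Prop where
  two_le_dim : 2 ≤ n
  conformallyFlat : IsConformallyFlat g
  smooth_S : S.Smooth
  smooth_t : SmoothFun n t
  symm_left : ∀ (x : M) (u v w : Tan n x), S x u v w = S x v u w
  symm_right : ∀ (x : M) (u v w : Tan n x), S x u v w = S x u w v
  traceFree : ∀ e ∈ IsManifold.maximalAtlas 𝓘(ℝ, Model n) ∞ M, ∀ y ∈ e.target, ∀ k,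
    ∑ a, ∑ b, gInv (metricComp g e) a b y * tensorComp S e a b k y = 0
  eq_high : 3 ≤ n → ∀ e ∈ IsManifold.maximalAtlas 𝓘(ℝ, Model n) ∞ M, ∀ y ∈ e.target,
    StructEqHigh (metricComp g e) (tensorComp S e) (t ∘ e.symm) y
  eq_two : n = 2 → ∀ e ∈ IsManifold.maximalAtlas 𝓘(ℝ, Model n) ∞ M, ∀ y ∈ e.target,
    StructEqTwo (metricComp g e) (tensorComp S e) (t ∘ e.symm) y

end Abundant

end WeylAbundant

end

/-! The two representatives are related by g' = Ω²g and d(φ − φ') = d ln|Ω|. Put w = φ − φ' and E =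
Ω², so that dE = 2E dw, S' = ES and t' = t − 3w. Only dw ever enters, so it does not matter that w
agrees with ln|Ω| only up to a locally constant function. The structural equations are pointwise
identities between components in a chart. It therefore suffices to know how each ingredient changes
under the data recorded in `ConformalOn`; the rest is bookkeeping of terms in dw.

The basis is the change of the Christoffel symbols, `ConformalOn.christoffel_eq`. It yields the
change of Hessians, of ∇S, and of the Ricci and scalar curvatures. Contractions of S only pick up
powers of E, and the projectors do not change.

For n ≥ 3 the Schouten tensor changes by −∇²w + dw⊗dw − ½|dw|²g. Three times its Hessian term is the
Hessian term coming from t' = t − 3w, which explains the coefficient 3, and the quadratic terms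
agree as well. In the equation for ∇S the terms in dw reduce to one projector identity,
`proj3_conformal_variation`. The Weyl-type condition on S is conformally covariant.

For n = 2 the key fact is that Ξ is invariant (`ConformalOn.xi_eq`). The equations for ∇S and ∇Ξ
then follow from identities for symmetric trace-free tensors that hold only in dimension two. The
Hessian equation says no more than its trace Δt = ⅓|S|² + (3/2)R (`hess_two_iff`), since τ is
defined by its trace-free part. The divergence equation is the hardest. The variation of τ is
computed explicitly, and its divergence is evaluated with the Bochner identity (`divergence_hess`)
and Ric = ½Rg. The trace equation then eliminates Δt, and SᵢᵃᵇSⱼₐᵦ = ½|S|²gᵢⱼ handles the quadratic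
term. -/

namespace WeylAbundant

/-! ### Rules for partial derivatives on an open set of coordinates. -/

section PartialDerivatives

variable {n : ℕ} {U : Set (Model n)} {f h : Model n → ℝ} {y : Model n}

lemma differentiableAt_of_contDiffOn (hU : IsOpen U) (hf : ContDiffOn ℝ ∞ f U) (hy : y ∈ U) :
    DifferentiableAt ℝ f y :=
  (hf.contDiffAt (hU.mem_nhds hy)).differentiableAt (by simp)

lemma contDiffOn_pd (hU : IsOpen U) (hf : ContDiffOn ℝ ∞ f U) (k : Fin n) :
    ContDiffOn ℝ ∞ (pd k f) U :=
  (hf.fderiv_of_isOpen hU (m := ∞) (by simp)).clm_apply contDiffOn_const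

/-- This allows differentiating identities that are known only on the chart domain. -/
lemma pd_congr (hU : IsOpen U) (hfh : ∀ z ∈ U, f z = h z) (hy : y ∈ U) (k : Fin n) :
    pd k f y = pd k h y := by
  have : f =ᶠ[nhds y] h := Filter.eventually_of_mem (hU.mem_nhds hy) hfh
  unfold pd
  rw [this.fderiv_eq]

lemma pd_add (hf : DifferentiableAt ℝ f y) (hh : DifferentiableAt ℝ h y) (k : Fin n) :
    pd k (fun z => f z + h z) y = pd k f y + pd k h y := by
  unfold pd
  rw [fderiv_fun_add hf hh]; rfl

lemma pd_sub (hf : DifferentiableAt ℝ f y) (hh : DifferentiableAt ℝ h y) (k : Fin n) :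
    pd k (fun z => f z - h z) y = pd k f y - pd k h y := by
  unfold pd
  rw [fderiv_fun_sub hf hh]; rfl

lemma pd_mul (hf : DifferentiableAt ℝ f y) (hh : DifferentiableAt ℝ h y) (k : Fin n) :
    pd k (fun z => f z * h z) y = pd k f y * h y + f y * pd k h y := by
  unfold pd
  rw [fderiv_fun_mul hf hh]
  simp only [add_apply, smul_apply, smul_eq_mul]
  ring

lemma pd_const (c : ℝ) (k : Fin n) : pd k (fun _ => c) y = 0 := by
  simp [pd]

lemma pd_const_mul (hf : DifferentiableAt ℝ f y) (c : ℝ) (k : Fin n) :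
    pd k (fun z => c * f z) y = c * pd k f y := by
  rw [pd_mul (differentiableAt_const c) hf, pd_const]
  ring

lemma pd_sum {ι : Type*} {s : Finset ι} {F : ι → Model n → ℝ}
    (hF : ∀ i ∈ s, DifferentiableAt ℝ (F i) y) (k : Fin n) :
    pd k (fun z => ∑ i ∈ s, F i z) y = ∑ i ∈ s, pd k (F i) y := by
  unfold pd
  rw [fderiv_fun_sum hF]
  simp

lemma pd_comm (hU : IsOpen U) (hf : ContDiffOn ℝ ∞ f U) (hy : y ∈ U) (i j : Fin n) :
    pd i (pd j f) y = pd j (pd i f) y := by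
  have hc : ContDiffAt ℝ ∞ f y := hf.contDiffAt (hU.mem_nhds hy)
  have hd : DifferentiableAt ℝ (fderiv ℝ f) y :=
    (hc.fderiv_right (m := ∞) (by simp)).differentiableAt (by simp)
  have key : ∀ a b : Fin n, pd a (pd b f) y =
      fderiv ℝ (fderiv ℝ f) y (EuclideanSpace.single a 1) (EuclideanSpace.single b 1) := by
    intro a b
    change fderiv ℝ (fun z => fderiv ℝ f z (EuclideanSpace.single b (1 : ℝ))) y
      (EuclideanSpace.single a 1) = _
    rw [fderiv_clm_apply hd (differentiableAt_const _)]
    simp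
  rw [key, key]
  exact (hc.isSymmSndFDerivAt (by simpa using WithTop.coe_le_coe.2 (le_top : (2 : ℕ∞) ≤ ⊤))).eq _ _

end PartialDerivatives

/-! ### Levi-Civita calculus of a single metric. -/

section MetricCalculus

variable {n : ℕ} {U : Set (Model n)} {G : Fin n → Fin n → Model n → ℝ} {y : Model n}

/-- The components of a smooth pseudo-Riemannian metric on an open set. -/
structure SmoothMetricOn (G : Fin n → Fin n → Model n → ℝ) (U : Set (Model n)) : Prop where
  isOpen : IsOpen U
  smooth : ∀ i j, ContDiffOn ℝ ∞ (G i j) U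
  symm : ∀ i j y, G i j y = G j i y
  isUnit_det : ∀ y ∈ U, IsUnit (Matrix.of fun a b => G a b y).det

lemma sum_gInv_mul (hG : SmoothMetricOn G U) (hy : y ∈ U) (i j : Fin n) :
    ∑ a, gInv G i a y * G a j y = if i = j then 1 else 0 := by
  have := congrFun (congrFun (Matrix.nonsing_inv_mul _ (hG.isUnit_det y hy)) i) j
  simpa [Matrix.mul_apply, Matrix.one_apply, gInv] using this

lemma sum_mul_gInv (hG : SmoothMetricOn G U) (hy : y ∈ U) (i j : Fin n) :
    ∑ a, G i a y * gInv G a j y = if i = j then 1 else 0 := by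
  have := congrFun (congrFun (Matrix.mul_nonsing_inv _ (hG.isUnit_det y hy)) i) j
  simpa [Matrix.mul_apply, Matrix.one_apply, gInv] using this

lemma gInv_symm (hG : SmoothMetricOn G U) (i j : Fin n) (y : Model n) :
    gInv G i j y = gInv G j i y := by
  have h : (Matrix.of fun a b => G a b y).transpose = Matrix.of fun a b => G a b y := by
    ext a b; simp [hG.symm a b]
  have h2 := congrFun (congrFun (Matrix.transpose_nonsing_inv (Matrix.of fun a b => G a b y)) j) i
  rw [h] at h2
  simpa [gInv] using h2

lemma contDiffOn_gInv (hG : SmoothMetricOn G U) (i j : Fin n) :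
    ContDiffOn ℝ ∞ (gInv G i j) U := by
  have hdet : ∀ F : Fin n → Fin n → Model n → ℝ, (∀ a b, ContDiffOn ℝ ∞ (F a b) U) →
      ContDiffOn ℝ ∞ (fun y => (Matrix.of fun a b => F a b y).det) U := by
    intro F hF
    simp only [Matrix.det_apply', Matrix.of_apply]
    exact ContDiffOn.sum fun σ _ => contDiffOn_const.mul (contDiffOn_prod fun a _ => hF _ _)
  have h1 : ContDiffOn ℝ ∞ (fun y => ((Matrix.of fun a b => G a b y).det)⁻¹) U :=
    (hdet G hG.smooth).inv fun y hy => (hG.isUnit_det y hy).ne_zero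
  -- Cramer's rule: an entry of the adjugate is the determinant of the matrix with row `j` replaced
  -- by a constant unit row, hence polynomial in smooth functions.
  have h2 : ContDiffOn ℝ ∞ (fun y => (Matrix.of fun a b => G a b y).adjugate i j) U := by
    have : ∀ y, (Matrix.of fun a b => G a b y).adjugate i j = (Matrix.of fun a b =>
        (if a = j then fun _ => (if b = i then 1 else 0) else G a b : Model n → ℝ) y).det := by
      intro y
      rw [Matrix.adjugate_apply]
      congr 1
      ext a b
      by_cases h : a = j <;> simp [Matrix.updateRow_apply, h, Pi.single_apply]
    simp only [this]
    refine hdet _ fun a b => ?_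
    by_cases h : a = j
    · simp only [h, if_true]; exact contDiffOn_const
    · simp only [h, if_false]; exact hG.smooth a b
  refine (h1.mul h2).congr fun y hy => ?_
  simp [gInv, Matrix.inv_def, Ring.inverse_eq_inv']

lemma christoffel_symm (hG : SmoothMetricOn G U) (k i j : Fin n) (y : Model n) :
    christoffel G k i j y = christoffel G k j i y := by
  have : G i j = G j i := funext (hG.symm i j)
  simp only [christoffel, this]
  congr 1
  exact Finset.sum_congr rfl fun l _ => by ring

lemma contDiffOn_christoffel (hG : SmoothMetricOn G U) (k i j : Fin n) :
    ContDiffOn ℝ ∞ (christoffel G k i j) U := by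
  have h := fun a b c => contDiffOn_pd hG.isOpen (hG.smooth a b) c
  exact contDiffOn_const.mul (ContDiffOn.sum fun l _ =>
    (contDiffOn_gInv hG k l).mul (((h _ _ _).add (h _ _ _)).sub (h _ _ _)))

/-- Lowering an index that was raised. -/
lemma sum_raise_mul (hG : SmoothMetricOn G U) (hy : y ∈ U) (v : Fin n → ℝ) (j : Fin n) :
    ∑ a, (∑ l, gInv G a l y * v l) * G a j y = v j := by
  simp only [Finset.sum_mul]
  rw [Finset.sum_comm]
  have : ∀ l, ∑ a, gInv G a l y * v l * G a j y = v l * if l = j then 1 else 0 := by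
    intro l
    rw [← sum_gInv_mul hG hy l j, Finset.mul_sum]
    exact Finset.sum_congr rfl fun a _ => by rw [gInv_symm hG l a]; ring
  simp [this]

/-- Raising an index that was lowered. -/
lemma sum_christoffel_mul (hG : SmoothMetricOn G U) (hy : y ∈ U) (i j k : Fin n) :
    ∑ m, christoffel G m i j y * G m k y =
      1 / 2 * (pd i (G j k) y + pd j (G i k) y - pd k (G i j) y) := by
  rw [← sum_raise_mul hG hy (fun k => 1 / 2 * (pd i (G j k) y + pd j (G i k) y - pd k (G i j) y))]
  refine Finset.sum_congr rfl fun m _ => ?_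
  simp only [christoffel, Finset.mul_sum]
  congr 1
  exact Finset.sum_congr rfl fun l _ => by ring

/-- Metric compatibility: on adding the two lowered Christoffel symbols, all derivatives except ∂ₖ
cancel. -/
lemma pd_metric (hG : SmoothMetricOn G U) (hy : y ∈ U) (k i j : Fin n) :
    pd k (G i j) y =
      ∑ m, (christoffel G m k i y * G m j y + christoffel G m k j y * G i m y) := by
  rw [Finset.sum_add_distrib]
  simp only [hG.symm i]
  rw [sum_christoffel_mul hG hy, sum_christoffel_mul hG hy]
  have : ∀ a b, G a b = G b a := fun a b => funext (hG.symm a b)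
  rw [this k j, this k i, this j i]
  ring

lemma pd_gInv (hG : SmoothMetricOn G U) (hy : y ∈ U) (k i j : Fin n) :
    pd k (gInv G i j) y =
      -∑ m, (christoffel G i k m y * gInv G m j y + christoffel G j k m y * gInv G i m y) := by
  set Gm : Matrix (Fin n) (Fin n) ℝ := Matrix.of fun a b => G a b y with hGm
  set H : Matrix (Fin n) (Fin n) ℝ := Matrix.of fun a b => gInv G a b y with hH
  set dG : Matrix (Fin n) (Fin n) ℝ := Matrix.of fun a b => pd k (G a b) y
  set dH : Matrix (Fin n) (Fin n) ℝ := Matrix.of fun a b => pd k (gInv G a b) y with hdH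
  set Γ : Matrix (Fin n) (Fin n) ℝ := Matrix.of fun a b => christoffel G a k b y with hΓ
  have dg := fun a b => differentiableAt_of_contDiffOn hG.isOpen (hG.smooth a b) hy
  have dh := fun a b => differentiableAt_of_contDiffOn hG.isOpen (contDiffOn_gInv hG a b) hy
  have h1 : dG = Γ.transpose * Gm + Gm * Γ := by
    ext a b
    simp only [dG, hΓ, hGm, Matrix.add_apply, Matrix.mul_apply, Matrix.of_apply,
      Matrix.transpose_apply]
    rw [pd_metric hG hy, Finset.sum_add_distrib]
    congr 1
    exact Finset.sum_congr rfl fun m _ => mul_comm _ _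
  have h2 : dH * Gm + H * dG = 0 := by
    ext a b
    simp only [hdH, dG, hH, hGm, Matrix.add_apply, Matrix.mul_apply, Matrix.of_apply,
      Matrix.zero_apply]
    have := pd_congr hG.isOpen (fun z hz => sum_gInv_mul hG hz a b) hy k
    rw [pd_const, pd_sum (fun c _ => (dh a c).fun_mul (dg c b))] at this
    simp only [pd_mul (dh _ _) (dg _ _)] at this
    rw [← Finset.sum_add_distrib]
    exact this
  have h3 : Gm * H = 1 := by
    ext a b
    simpa [Matrix.mul_apply, Matrix.one_apply, hGm, hH] using sum_mul_gInv hG hy a b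
  have h4 : H * Gm = 1 := by
    ext a b
    simpa [Matrix.mul_apply, Matrix.one_apply, hGm, hH] using sum_gInv_mul hG hy a b
  -- The derivative of HG = 1 is solved for dH by multiplying with H on the right; metric
  -- compatibility then replaces dG.
  have h5 : dH = -(H * Γ.transpose + Γ * H) := by
    calc dH = dH * (Gm * H) := by rw [h3, mul_one]
      _ = (dH * Gm + H * dG) * H - H * dG * H := by noncomm_ring
      _ = -(H * Γ.transpose * (Gm * H) + (H * Gm) * Γ * H) := by rw [h2, h1]; noncomm_ring
      _ = _ := by rw [h3, h4]; noncomm_ring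
  have h6 := congrFun (congrFun h5 i) j
  simp only [hdH, hH, hΓ, Matrix.neg_apply, Matrix.add_apply, Matrix.mul_apply, Matrix.of_apply,
    Matrix.transpose_apply] at h6
  rw [h6, Finset.sum_add_distrib, add_comm]
  congr 2
  exact Finset.sum_congr rfl fun m _ => mul_comm _ _

/-- The curvature endomorphisms are skew with respect to the metric. -/
lemma sum_curvature_mul_gInv (hG : SmoothMetricOn G U) (hy : y ∈ U) (a b i j : Fin n) :
    ∑ m, curvature G a m i j y * gInv G m b y = -∑ m, curvature G b m i j y * gInv G m a y := by
  set H : Matrix (Fin n) (Fin n) ℝ := Matrix.of fun a b => gInv G a b y with hH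
  set Γ : Fin n → Matrix (Fin n) (Fin n) ℝ := fun k => Matrix.of fun a b => christoffel G a k b y
    with hΓ
  set dΓ : Fin n → Fin n → Matrix (Fin n) (Fin n) ℝ :=
    fun k l => Matrix.of fun a b => pd k (christoffel G a l b) y with hdΓ
  set dH : Fin n → Matrix (Fin n) (Fin n) ℝ :=
    fun k => Matrix.of fun a b => pd k (gInv G a b) y with hdH
  set ddH : Fin n → Fin n → Matrix (Fin n) (Fin n) ℝ :=
    fun k l => Matrix.of fun a b => pd k (pd l (gInv G a b)) y with hddH
  have dh := fun a b => differentiableAt_of_contDiffOn hG.isOpen (contDiffOn_gInv hG a b) hy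
  have dc := fun a b c =>
    differentiableAt_of_contDiffOn hG.isOpen (contDiffOn_christoffel hG a b c) hy
  have h1 : ∀ k, dH k = -(Γ k * H + H * (Γ k).transpose) := by
    intro k
    ext a b
    simp only [hdH, hΓ, hH, Matrix.neg_apply, Matrix.add_apply, Matrix.mul_apply, Matrix.of_apply,
      Matrix.transpose_apply]
    rw [pd_gInv hG hy, Finset.sum_add_distrib]
    congr 2
    exact Finset.sum_congr rfl fun m _ => mul_comm _ _
  have h2 : ∀ k l, ddH k l = -(dΓ k l * H + Γ l * dH k + dH k * (Γ l).transpose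
      + H * (dΓ k l).transpose) := by
    intro k l
    ext a b
    simp only [hddH, hdH, hdΓ, hΓ, hH, Matrix.neg_apply, Matrix.add_apply, Matrix.mul_apply,
      Matrix.of_apply, Matrix.transpose_apply]
    rw [pd_congr hG.isOpen (fun z hz => (pd_gInv hG hz l a b).trans (neg_one_mul _).symm) hy k,
      pd_const_mul (DifferentiableAt.fun_sum fun m _ =>
        ((dc _ _ _).fun_mul (dh _ _)).fun_add ((dc _ _ _).fun_mul (dh _ _))),
      pd_sum (fun m _ => ((dc _ _ _).fun_mul (dh _ _)).fun_add ((dc _ _ _).fun_mul (dh _ _))), neg_one_mul]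
    congr 1
    simp only [← Finset.sum_add_distrib]
    refine Finset.sum_congr rfl fun m _ => ?_
    rw [pd_add ((dc _ _ _).fun_mul (dh _ _)) ((dc _ _ _).fun_mul (dh _ _)), pd_mul (dc _ _ _) (dh _ _),
      pd_mul (dc _ _ _) (dh _ _)]
    ring
  have h3 : ddH i j = ddH j i := by
    ext a b
    exact pd_comm hG.isOpen (contDiffOn_gInv hG a b) hy i j
  -- K is the curvature endomorphism. In ∂ᵢ∂ⱼH − ∂ⱼ∂ᵢH the mixed products ΓHΓᵀ are symmetric in i, j
  -- and drop out, so equality of mixed derivatives becomes KH + HKᵀ = 0.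
  set K : Matrix (Fin n) (Fin n) ℝ := dΓ i j - dΓ j i + Γ i * Γ j - Γ j * Γ i with hK
  have h4 : K * H = -(H * K.transpose) := by
    rw [h2, h2, h1, h1] at h3
    have h5 := sub_eq_zero.2 h3
    rw [eq_neg_iff_add_eq_zero, ← neg_eq_zero, ← h5, hK]
    simp only [Matrix.transpose_sub, Matrix.transpose_add, Matrix.transpose_mul]
    noncomm_ring
  have h6 : ∀ a m, K a m = curvature G a m i j y := by
    intro a m
    simp only [hK, hdΓ, hΓ, Matrix.sub_apply, Matrix.add_apply, Matrix.mul_apply, Matrix.of_apply,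
      curvature, Finset.sum_sub_distrib]
    ring
  have h7 := congrFun (congrFun h4 a) b
  simp only [Matrix.neg_apply, Matrix.mul_apply, Matrix.transpose_apply, h6, hH,
    Matrix.of_apply] at h7
  rw [h7]
  congr 1
  exact Finset.sum_congr rfl fun m _ => by rw [gInv_symm hG a m, mul_comm]

lemma curvature_antisymm (l k i j : Fin n) (y : Model n) :
    curvature G l k i j y = -curvature G l k j i y := by
  simp only [curvature, Finset.sum_sub_distrib]
  ring

end MetricCalculus

/-! ### Conformal change of the connection, of Hessians and of covariant derivatives. -/

section ConformalChange

variable {n : ℕ} {U : Set (Model n)} {G G' : Fin n → Fin n → Model n → ℝ} {E w : Model n → ℝ}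
  {y : Model n}

/-- `⟨grad f, grad h⟩`. -/
noncomputable def gradInner (G : Fin n → Fin n → Model n → ℝ) (f h : Model n → ℝ) (y : Model n) : ℝ :=
  ∑ a, gradUp G f a y * pd a h y

/-- `G' = E G` with `d ln E = 2 dw`. -/
structure ConformalOn (G G' : Fin n → Fin n → Model n → ℝ) (E w : Model n → ℝ)
    (U : Set (Model n)) : Prop where
  base : SmoothMetricOn G U
  factor_smooth : ContDiffOn ℝ ∞ E U
  factor_ne : ∀ y, E y ≠ 0
  exponent_smooth : ContDiffOn ℝ ∞ w U
  pd_factor : ∀ y ∈ U, ∀ k, pd k E y = 2 * pd k w y * E y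
  eq : ∀ i j y, G' i j y = E y * G i j y

lemma ConformalOn.matrix_eq (h : ConformalOn G G' E w U) (y : Model n) :
    (Matrix.of fun a b => G' a b y) = E y • Matrix.of fun a b => G a b y := by
  ext a b
  simp [h.eq]

lemma ConformalOn.target (h : ConformalOn G G' E w U) : SmoothMetricOn G' U where
  isOpen := h.base.isOpen
  smooth i j := (h.factor_smooth.mul (h.base.smooth i j)).congr fun y _ => h.eq i j y
  symm i j y := by rw [h.eq, h.eq, h.base.symm]
  isUnit_det y hy := by
    rw [h.matrix_eq, Matrix.det_smul]
    exact ((isUnit_iff_ne_zero.2 (h.factor_ne y)).pow _).mul (h.base.isUnit_det y hy)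

lemma ConformalOn.gInv_eq (h : ConformalOn G G' E w U) (hy : y ∈ U) (i j : Fin n) :
    gInv G' i j y = (E y)⁻¹ * gInv G i j y := by
  have hE : Invertible (E y) := invertibleOfNonzero (h.factor_ne y)
  simp only [gInv, h.matrix_eq]
  rw [Matrix.inv_smul _ _ (h.base.isUnit_det y hy)]
  simp

lemma sum_mul_gradUp (hG : SmoothMetricOn G U) (hy : y ∈ U) (f : Model n → ℝ) (i : Fin n) :
    ∑ a, G i a y * gradUp G f a y = pd i f y := by
  rw [← sum_raise_mul hG hy (fun a => pd a f y) i]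
  exact Finset.sum_congr rfl fun a _ => by rw [hG.symm i a, mul_comm]; rfl

lemma sum_gradUp_mul (hG : SmoothMetricOn G U) (hy : y ∈ U) (f : Model n → ℝ) (i : Fin n) :
    ∑ a, gradUp G f a y * G a i y = pd i f y :=
  sum_raise_mul hG hy (fun a => pd a f y) i

lemma ConformalOn.gradUp_eq (h : ConformalOn G G' E w U) (hy : y ∈ U) (f : Model n → ℝ)
    (i : Fin n) : gradUp G' f i y = (E y)⁻¹ * gradUp G f i y := by
  simp only [gradUp, h.gInv_eq hy, Finset.mul_sum, mul_assoc]

lemma ConformalOn.christoffel_eq (h : ConformalOn G G' E w U) (hy : y ∈ U) (k i j : Fin n) :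
    christoffel G' k i j y = christoffel G k i j y + (if k = i then pd j w y else 0)
      + (if k = j then pd i w y else 0) - G i j y * gradUp G w k y := by
  have hpd : ∀ a b c, pd c (G' a b) y = E y * (2 * pd c w y * G a b y + pd c (G a b) y) := by
    intro a b c
    have e : G' a b = fun z => E z * G a b z := funext fun z => h.eq a b z
    rw [e, pd_mul (differentiableAt_of_contDiffOn h.base.isOpen h.factor_smooth hy)
      (differentiableAt_of_contDiffOn h.base.isOpen (h.base.smooth a b) hy), h.pd_factor y hy]
    ring
  -- The Kronecker deltas are written as contractions g⁻¹g, so that both sides become sums over the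
  -- same index and can be compared termwise.
  have h1 : (if k = i then pd j w y else 0) = ∑ l, gInv G k l y * G l i y * pd j w y := by
    rw [← Finset.sum_mul, sum_gInv_mul h.base hy]; simp
  have h2 : (if k = j then pd i w y else 0) = ∑ l, gInv G k l y * G l j y * pd i w y := by
    rw [← Finset.sum_mul, sum_gInv_mul h.base hy]; simp
  rw [h1, h2]
  simp only [christoffel, gradUp, h.gInv_eq hy, hpd, Finset.mul_sum, ← Finset.sum_add_distrib,
    ← Finset.sum_sub_distrib]
  refine Finset.sum_congr rfl fun l _ => ?_
  rw [h.base.symm l i, h.base.symm l j]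
  have := h.factor_ne y
  field_simp
  ring

lemma ConformalOn.hess_eq (h : ConformalOn G G' E w U) (hy : y ∈ U) (f : Model n → ℝ)
    (i j : Fin n) :
    hess G' f i j y = hess G f i j y - (pd i w y * pd j f y + pd j w y * pd i f y)
      + G i j y * gradInner G w f y := by
  simp only [hess, gradInner, h.christoffel_eq hy, add_mul, sub_mul, Finset.sum_add_distrib,
    Finset.sum_sub_distrib, ite_mul, zero_mul, Finset.sum_ite_eq', Finset.mem_univ, if_true,
    Finset.mul_sum]
  simp only [mul_assoc]
  ring

lemma ConformalOn.nabla2_eq (h : ConformalOn G G' E w U) (hy : y ∈ U)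
    (Q : Fin n → Fin n → Model n → ℝ) (l i j : Fin n) :
    nabla2 G' Q l i j y = nabla2 G Q l i j y - 2 * pd l w y * Q i j y
      - pd i w y * Q l j y - pd j w y * Q i l y
      + G l i y * ∑ m, gradUp G w m y * Q m j y + G l j y * ∑ m, gradUp G w m y * Q i m y := by
  simp only [nabla2, h.christoffel_eq hy, add_mul, sub_mul, Finset.sum_add_distrib,
    Finset.sum_sub_distrib, ite_mul, zero_mul, Finset.sum_ite_eq', Finset.mem_univ, if_true,
    Finset.mul_sum]
  simp only [mul_assoc]
  ring

/-- The derivative of the weight E contributes +2∂ₗw and each of the three slots contributes −∂ₗw,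
which leaves the coefficient −1. -/
lemma ConformalOn.nabla3_eq (h : ConformalOn G G' E w U) (hy : y ∈ U)
    (S : Fin n → Fin n → Fin n → Model n → ℝ) (hS : ∀ i j k, DifferentiableAt ℝ (S i j k) y)
    (l i j k : Fin n) :
    nabla3 G' (fun a b c z => E z * S a b c z) l i j k y = E y * (nabla3 G S l i j k y
      - pd l w y * S i j k y - pd i w y * S l j k y - pd j w y * S i l k y - pd k w y * S i j l y
      + G l i y * ∑ m, gradUp G w m y * S m j k y + G l j y * ∑ m, gradUp G w m y * S i m k y
      + G l k y * ∑ m, gradUp G w m y * S i j m y) := by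
  have hE := differentiableAt_of_contDiffOn h.base.isOpen h.factor_smooth hy
  simp only [nabla3, h.christoffel_eq hy, pd_mul hE (hS _ _ _), h.pd_factor y hy, add_mul, sub_mul,
    Finset.sum_add_distrib, Finset.sum_sub_distrib, ite_mul, zero_mul, Finset.sum_ite_eq',
    Finset.mem_univ, if_true]
  have e : ∀ (P Q : Fin n → ℝ) (c : ℝ), ∑ m, P m * (E y * Q m) = E y * ∑ m, P m * Q m := by
    intro P Q _
    rw [Finset.mul_sum]
    exact Finset.sum_congr rfl fun m _ => by ring
  have e' : ∀ (P Q : Fin n → ℝ) (c : ℝ),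
      ∑ m, c * P m * (E y * Q m) = E y * (c * ∑ m, P m * Q m) := by
    intro P Q _
    rw [Finset.mul_sum, Finset.mul_sum]
    exact Finset.sum_congr rfl fun m _ => by ring
  simp only [e', e _ _ 0]
  ring

lemma contDiffOn_gradUp (hG : SmoothMetricOn G U) {f : Model n → ℝ} (hf : ContDiffOn ℝ ∞ f U)
    (i : Fin n) : ContDiffOn ℝ ∞ (gradUp G f i) U :=
  ContDiffOn.sum fun a _ => (contDiffOn_gInv hG i a).mul (contDiffOn_pd hG.isOpen hf a)

lemma contDiffOn_hess (hG : SmoothMetricOn G U) {f : Model n → ℝ} (hf : ContDiffOn ℝ ∞ f U)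
    (i j : Fin n) : ContDiffOn ℝ ∞ (hess G f i j) U :=
  (contDiffOn_pd hG.isOpen (contDiffOn_pd hG.isOpen hf j) i).sub
    (ContDiffOn.sum fun m _ => (contDiffOn_christoffel hG m i j).mul (contDiffOn_pd hG.isOpen hf m))

lemma contDiffOn_laplacian (hG : SmoothMetricOn G U) {f : Model n → ℝ} (hf : ContDiffOn ℝ ∞ f U) :
    ContDiffOn ℝ ∞ (laplacian G f) U :=
  ContDiffOn.sum fun a _ => ContDiffOn.sum fun b _ =>
    (contDiffOn_gInv hG a b).mul (contDiffOn_hess hG hf a b)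

lemma contDiffOn_gradInner (hG : SmoothMetricOn G U) {f h : Model n → ℝ}
    (hf : ContDiffOn ℝ ∞ f U) (hh : ContDiffOn ℝ ∞ h U) : ContDiffOn ℝ ∞ (gradInner G f h) U :=
  ContDiffOn.sum fun a _ => (contDiffOn_gradUp hG hf a).mul (contDiffOn_pd hG.isOpen hh a)

lemma hess_symm (hG : SmoothMetricOn G U) (hy : y ∈ U) {f : Model n → ℝ}
    (hf : ContDiffOn ℝ ∞ f U) (i j : Fin n) : hess G f i j y = hess G f j i y := by
  simp only [hess, christoffel_symm hG _ i j]
  rw [pd_comm hG.isOpen hf hy]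

lemma pd_pd (G : Fin n → Fin n → Model n → ℝ) (f : Model n → ℝ) (i j : Fin n) (y : Model n) :
    pd i (pd j f) y = hess G f i j y + ∑ m, christoffel G m i j y * pd m f y := by
  simp [hess]

/-- The covariant derivative of the gradient is the Hessian with an index raised. -/
lemma pd_gradUp (hG : SmoothMetricOn G U) (hy : y ∈ U) {f : Model n → ℝ}
    (hf : ContDiffOn ℝ ∞ f U) (k i : Fin n) :
    pd k (gradUp G f i) y =
      ∑ a, gInv G i a y * hess G f k a y - ∑ m, christoffel G i k m y * gradUp G f m y := by
  have dh := fun a => differentiableAt_of_contDiffOn hG.isOpen (contDiffOn_gInv hG i a) hy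
  have df := fun a => differentiableAt_of_contDiffOn hG.isOpen (contDiffOn_pd hG.isOpen hf a) hy
  have e : gradUp G f i = fun z => ∑ a, gInv G i a z * pd a f z := rfl
  rw [e, pd_sum (fun a _ => (dh a).fun_mul (df a))]
  simp only [pd_mul (dh _) (df _), pd_gInv hG hy, pd_pd G, Finset.sum_add_distrib, mul_add,
    neg_add, add_mul, neg_mul, Finset.sum_neg_distrib, Finset.sum_mul, Finset.mul_sum, gradUp]
  rw [Finset.sum_comm (f := fun a m => christoffel G i k m y * gInv G m a y * pd a f y),
    Finset.sum_comm (f := fun a m => christoffel G a k m y * gInv G i m y * pd a f y)]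
  have h1 : ∑ a, ∑ m, gInv G i a y * (christoffel G m k a y * pd m f y)
      = ∑ a, ∑ m, christoffel G m k a y * gInv G i a y * pd m f y :=
    Finset.sum_congr rfl fun a _ => Finset.sum_congr rfl fun m _ => by ring
  rw [h1]
  simp only [mul_assoc]
  ring

lemma sum_pd_gradUp (hG : SmoothMetricOn G U) (hy : y ∈ U) {f : Model n → ℝ}
    (hf : ContDiffOn ℝ ∞ f U) :
    ∑ a, pd a (gradUp G f a) y =
      laplacian G f y - ∑ a, ∑ m, christoffel G a a m y * gradUp G f m y := by
  simp only [pd_gradUp hG hy hf, Finset.sum_sub_distrib, laplacian]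

end ConformalChange

/-! ### Conformal change of the Ricci and scalar curvatures. -/

section ConformalRicci

variable {n : ℕ} {U : Set (Model n)} {G G' : Fin n → Fin n → Model n → ℝ} {E w : Model n → ℝ}
  {y : Model n}

/-- The trace Γᵃₐⱼ is kept together as one function: it changes by n∂ⱼw, which can be differentiated
as a whole. -/
lemma ricci_eq_sums (hG : SmoothMetricOn G U) (hy : y ∈ U) (i j : Fin n) :
    ricci G i j y = ∑ a, pd a (christoffel G a i j) y
      - pd i (fun z => ∑ a, christoffel G a a j z) y
      + ∑ m, (∑ a, christoffel G a a m y) * christoffel G m i j y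
      - ∑ a, ∑ m, christoffel G a i m y * christoffel G m a j y := by
  rw [pd_sum fun a _ =>
    differentiableAt_of_contDiffOn hG.isOpen (contDiffOn_christoffel hG a a j) hy]
  simp only [ricci, curvature, Finset.sum_add_distrib, Finset.sum_sub_distrib, Finset.sum_mul]
  rw [Finset.sum_comm (f := fun m a => christoffel G a a m y * christoffel G m i j y)]
  ring

lemma ConformalOn.trace_christoffel_eq (h : ConformalOn G G' E w U) (hy : y ∈ U) (j : Fin n) :
    ∑ a, christoffel G' a a j y = ∑ a, christoffel G a a j y + n * pd j w y := by
  simp only [h.christoffel_eq hy, Finset.sum_add_distrib, Finset.sum_sub_distrib, if_true,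
    Finset.sum_ite_eq', Finset.mem_univ, Finset.sum_const, Finset.card_univ, Fintype.card_fin,
    nsmul_eq_mul, h.base.symm _ j, sum_mul_gradUp h.base hy]
  ring

lemma ConformalOn.sum_pd_christoffel_eq (h : ConformalOn G G' E w U) (hy : y ∈ U) (i j : Fin n) :
    ∑ a, pd a (christoffel G' a i j) y = ∑ a, pd a (christoffel G a i j) y
      + pd i (pd j w) y + pd j (pd i w) y - ∑ a, pd a (G i j) y * gradUp G w a y
      - G i j y * ∑ a, pd a (gradUp G w a) y := by
  have hU := h.base.isOpen
  have d1 := differentiableAt_of_contDiffOn hU (h.base.smooth i j) hy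
  have d2 := fun a =>
    differentiableAt_of_contDiffOn hU (contDiffOn_gradUp h.base h.exponent_smooth a) hy
  have d3 := fun a => differentiableAt_of_contDiffOn hU (contDiffOn_pd hU h.exponent_smooth a) hy
  have d4 := fun a => differentiableAt_of_contDiffOn hU (contDiffOn_christoffel h.base a i j) hy
  have d5 : ∀ (p : Prop) [Decidable p] (b : Fin n),
      DifferentiableAt ℝ (fun z => if p then pd b w z else 0) y := by
    intro p _ b
    by_cases hp : p <;> simp [hp, d3]
  have e5 : ∀ (p : Prop) [Decidable p] (a b : Fin n),
      pd a (fun z => if p then pd b w z else 0) y = if p then pd a (pd b w) y else 0 := by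
    intro p _ a b
    by_cases hp : p
    · simp only [hp, if_true]
    · simp only [hp, if_false, pd_const]
  have key : ∀ a, pd a (christoffel G' a i j) y = pd a (christoffel G a i j) y
      + (if a = i then pd a (pd j w) y else 0) + (if a = j then pd a (pd i w) y else 0)
      - (pd a (G i j) y * gradUp G w a y + G i j y * pd a (gradUp G w a) y) := by
    intro a
    rw [pd_congr hU (fun z hz => h.christoffel_eq hz a i j) hy,
      pd_sub (((d4 a).fun_add (d5 _ _)).fun_add (d5 _ _)) (d1.fun_mul (d2 a)),
      pd_add ((d4 a).fun_add (d5 _ _)) (d5 _ _), pd_add (d4 a) (d5 _ _), pd_mul d1 (d2 a), e5, e5]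
  simp only [key, Finset.sum_add_distrib, Finset.sum_sub_distrib, Finset.sum_ite_eq',
    Finset.mem_univ, if_true, Finset.mul_sum]
  ring

lemma ConformalOn.sum_christoffel_mul_christoffel_eq (h : ConformalOn G G' E w U) (hy : y ∈ U)
    (i j : Fin n) :
    ∑ a, ∑ m, christoffel G' a i m y * christoffel G' m a j y =
      ∑ a, ∑ m, christoffel G a i m y * christoffel G m a j y
      + pd j w y * ∑ a, christoffel G a a i y + pd i w y * ∑ a, christoffel G a a j y
      + 2 * ∑ m, christoffel G m i j y * pd m w y
      - ∑ a, pd a (G i j) y * gradUp G w a y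
      + (n + 2) * pd i w y * pd j w y - 2 * G i j y * gradInner G w w y := by
  have hs := h.base.symm
  have g1 := sum_mul_gradUp h.base hy w
  have g2 := sum_gradUp_mul h.base hy w
  -- By metric compatibility, the two products of Γ, g and grad w arising in the expansion add up to
  -- the derivative of gᵢⱼ along grad w.
  have e1 : ∑ a, pd a (G i j) y * gradUp G w a y =
      ∑ a, ∑ m, christoffel G a i m y * (G a j y * gradUp G w m y)
      + ∑ a, ∑ m, G i m y * gradUp G w a y * christoffel G m a j y := by
    simp only [pd_metric h.base hy, Finset.sum_mul, Finset.sum_add_distrib, add_mul]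
    rw [Finset.sum_comm (f := fun a m => christoffel G m a i y * G m j y * gradUp G w a y)]
    congr 1
    · refine Finset.sum_congr rfl fun a _ => Finset.sum_congr rfl fun m _ => ?_
      rw [christoffel_symm h.base a m i]; ring
    · exact Finset.sum_congr rfl fun a _ => Finset.sum_congr rfl fun m _ => by ring
  -- These are the sixteen products of the four terms in each Christoffel symbol. The deltas remain
  -- as conditionals, which later collapse the sums.
  have e2 : ∀ a m, christoffel G' a i m y * christoffel G' m a j y =
      christoffel G a i m y * christoffel G m a j y
      + (if m = a then christoffel G a i m y * pd j w y else 0)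
      + (if m = j then christoffel G a i m y * pd a w y else 0)
      - christoffel G a i m y * (G a j y * gradUp G w m y)
      + (if a = i then pd m w y * christoffel G m a j y else 0)
      + (if a = m then pd i w y * christoffel G m a j y else 0)
      - G i m y * gradUp G w a y * christoffel G m a j y
      + (if a = i then if m = a then pd m w y * pd j w y else 0 else 0)
      + (if a = i then if m = j then pd m w y * pd a w y else 0 else 0)
      - (if a = i then G a j y * (gradUp G w m y * pd m w y) else 0)
      + (if m = a then pd i w y * pd j w y else 0)
      + (if a = m then if m = j then pd i w y * pd a w y else 0 else 0)
      - (if a = m then pd i w y * (G a j y * gradUp G w m y) else 0)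
      - (if m = a then G i m y * gradUp G w a y * pd j w y else 0)
      - (if m = j then G i m y * (gradUp G w a y * pd a w y) else 0)
      + G i m y * gradUp G w m y * (gradUp G w a y * G a j y) := by
    intro a m
    rw [h.christoffel_eq hy, h.christoffel_eq hy]
    split_ifs <;> subst_vars <;> first | exact absurd rfl (by assumption) | ring
  simp only [e2, Finset.sum_add_distrib, Finset.sum_sub_distrib]
  rw [e1]
  have f1 : ∀ F : Fin n → Fin n → ℝ, (∑ a, ∑ m, if a = i then F a m else 0) = ∑ m, F i m := by
    intro F
    rw [Finset.sum_comm]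
    simp
  simp only [f1, Finset.sum_ite_eq', Finset.sum_ite_eq, Finset.mem_univ, if_true]
  simp only [← Finset.mul_sum, ← Finset.sum_mul, g1, Finset.sum_const, Finset.card_univ,
    Fintype.card_fin, nsmul_eq_mul, hs _ j, gradInner]
  simp only [christoffel_symm h.base _ i, christoffel_symm h.base _ _ j]
  have f2 : ∑ m, pd m w y * christoffel G m j i y = ∑ m, christoffel G m j i y * pd m w y :=
    Finset.sum_congr rfl fun m _ => mul_comm _ _
  have f3 : ∑ m, gradUp G w m y * G j m y = pd j w y := by
    rw [← g1 j]
    exact Finset.sum_congr rfl fun m _ => mul_comm _ _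
  rw [f2, f3]
  ring

lemma ConformalOn.ricci_eq (h : ConformalOn G G' E w U) (hy : y ∈ U) (i j : Fin n) :
    ricci G' i j y = ricci G i j y - (n - 2) * (hess G w i j y - pd i w y * pd j w y)
      - (laplacian G w y + (n - 2) * gradInner G w w y) * G i j y := by
  have hU := h.base.isOpen
  have d1 : DifferentiableAt ℝ (fun z => ∑ a, christoffel G a a j z) y :=
    DifferentiableAt.fun_sum fun a _ =>
      differentiableAt_of_contDiffOn hU (contDiffOn_christoffel h.base a a j) hy
  have d2 := differentiableAt_of_contDiffOn hU (contDiffOn_pd hU h.exponent_smooth j) hy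
  rw [ricci_eq_sums h.base hy, ricci_eq_sums h.target hy, h.sum_christoffel_mul_christoffel_eq hy,
    h.sum_pd_christoffel_eq hy, sum_pd_gradUp h.base hy h.exponent_smooth,
    pd_congr hU (fun z hz => h.trace_christoffel_eq hz j) hy,
    pd_add d1 (d2.const_mul _), pd_const_mul d2, hess, pd_comm hU h.exponent_smooth hy j i]
  -- The terms linear in Γ produced here cancel those from the other sums and from rewriting second
  -- derivatives of w as Hessians.
  have e : ∑ m, (∑ a, christoffel G' a a m y) * christoffel G' m i j y =
      ∑ m, (∑ a, christoffel G a a m y) * christoffel G m i j y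
      + n * ∑ m, christoffel G m i j y * pd m w y
      + (∑ a, christoffel G a a i y + n * pd i w y) * pd j w y
      + (∑ a, christoffel G a a j y + n * pd j w y) * pd i w y
      - G i j y * ∑ a, ∑ m, christoffel G a a m y * gradUp G w m y
      - n * G i j y * gradInner G w w y := by
    simp only [h.trace_christoffel_eq hy]
    simp only [h.christoffel_eq hy, mul_add, mul_sub, Finset.sum_add_distrib,
      Finset.sum_sub_distrib, mul_ite, mul_zero, Finset.sum_ite_eq', Finset.mem_univ, if_true,
      add_mul, gradInner]
    rw [Finset.sum_comm (f := fun a m => christoffel G a a m y * gradUp G w m y)]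
    simp only [Finset.mul_sum, Finset.sum_mul]
    have e1 : ∀ P Q : Fin n → ℝ, (∀ m, P m = Q m) → ∑ m, P m = ∑ m, Q m :=
      fun P Q hPQ => Finset.sum_congr rfl fun m _ => hPQ m
    rw [e1 (fun m => n * pd m w y * christoffel G m i j y)
        (fun m => n * (christoffel G m i j y * pd m w y)) (fun m => by ring),
      e1 (fun m => christoffel G m m j y * pd i w y) (fun m => pd i w y * christoffel G m m j y)
        (fun m => by ring),
      e1 (fun m => n * pd m w y * (G i j y * gradUp G w m y))
        (fun m => n * G i j y * (gradUp G w m y * pd m w y)) (fun m => by ring)]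
    have e2 : ∑ m, ∑ a, christoffel G a a m y * (G i j y * gradUp G w m y) =
        ∑ m, ∑ a, G i j y * (christoffel G a a m y * gradUp G w m y) :=
      Finset.sum_congr rfl fun m _ => Finset.sum_congr rfl fun a _ => by ring
    rw [e2]
    ring
  rw [e]
  ring

lemma ConformalOn.scal_eq (h : ConformalOn G G' E w U) (hy : y ∈ U) :
    scal G' y = (E y)⁻¹ * (scal G y - 2 * (n - 1) * laplacian G w y
      - (n - 1) * (n - 2) * gradInner G w w y) := by
  have e : ∑ a, ∑ b, gInv G a b y * G a b y = n := by
    have : ∀ a, ∑ b, gInv G a b y * G a b y = 1 := fun a => by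
      simpa [h.base.symm a] using sum_gInv_mul h.base hy a a
    simp [this]
  have e2 : gradInner G w w y = ∑ a, ∑ b, gInv G a b y * (pd a w y * pd b w y) := by
    simp only [gradInner, gradUp, Finset.sum_mul]
    exact Finset.sum_congr rfl fun a _ => Finset.sum_congr rfl fun b _ => by ring
  have e3 : ∀ a b, gInv G' a b y * ricci G' a b y = (E y)⁻¹ * (gInv G a b y * ricci G a b y
      - (n - 2) * (gInv G a b y * hess G w a b y)
      + (n - 2) * (gInv G a b y * (pd a w y * pd b w y))
      - (laplacian G w y + (n - 2) * gradInner G w w y) * (gInv G a b y * G a b y)) := by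
    intro a b
    rw [h.ricci_eq hy, h.gInv_eq hy]
    ring
  simp only [scal, e3, ← Finset.mul_sum, Finset.sum_sub_distrib, Finset.sum_add_distrib, e, ← e2]
  rw [← laplacian]
  ring

end ConformalRicci

/-! ### Conformal weights of contractions, and the passage from t to t − 3w. -/

section Contractions

variable {n : ℕ} {U : Set (Model n)} {G G' : Fin n → Fin n → Model n → ℝ} {E w : Model n → ℝ}
  {S : Fin n → Fin n → Fin n → Model n → ℝ} {y : Model n}

lemma gradUp_sub_smul {t w : Model n → ℝ} {t' : Model n → ℝ}
    (ht : ∀ k, pd k t' y = pd k t y - 3 * pd k w y) (i : Fin n) :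
    gradUp G t' i y = gradUp G t i y - 3 * gradUp G w i y := by
  simp only [gradUp, ht, mul_sub, Finset.sum_sub_distrib, Finset.mul_sum]
  congr 1
  exact Finset.sum_congr rfl fun a _ => by ring

lemma contrS_sub_smul {t w : Model n → ℝ} {t' : Model n → ℝ}
    (ht : ∀ k, pd k t' y = pd k t y - 3 * pd k w y) (i j : Fin n) :
    contrS G S t' i j y = contrS G S t i j y - 3 * contrS G S w i j y := by
  simp only [contrS, gradUp_sub_smul ht, mul_sub, Finset.sum_sub_distrib, Finset.mul_sum]
  congr 1
  exact Finset.sum_congr rfl fun a _ => by ring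

lemma gradInner_symm (hG : SmoothMetricOn G U) (f h : Model n → ℝ) (y : Model n) :
    gradInner G f h y = gradInner G h f y := by
  simp only [gradInner, gradUp, Finset.sum_mul]
  rw [Finset.sum_comm]
  refine Finset.sum_congr rfl fun a _ => Finset.sum_congr rfl fun b _ => ?_
  rw [gInv_symm hG]
  ring

lemma gradSq_sub_smul (hG : SmoothMetricOn G U) {t w : Model n → ℝ} {t' : Model n → ℝ}
    (ht : ∀ k, pd k t' y = pd k t y - 3 * pd k w y) :
    gradSq G t' y = gradSq G t y - 6 * gradInner G w t y + 9 * gradSq G w y := by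
  have e : gradSq G t' y = gradInner G t t y - 3 * gradInner G t w y - 3 * gradInner G w t y
      + 9 * gradInner G w w y := by
    simp only [gradSq, gradInner, gradUp_sub_smul ht, ht, Finset.mul_sum,
      ← Finset.sum_sub_distrib, ← Finset.sum_add_distrib]
    exact Finset.sum_congr rfl fun a _ => by ring
  rw [e, gradInner_symm hG t w]
  simp only [gradInner, gradSq]
  ring

lemma ConformalOn.gradInner_eq (h : ConformalOn G G' E w U) (hy : y ∈ U) (f k : Model n → ℝ) :
    gradInner G' f k y = (E y)⁻¹ * gradInner G f k y := by
  simp only [gradInner, h.gradUp_eq hy, Finset.mul_sum, mul_assoc]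

lemma ConformalOn.up2_eq (h : ConformalOn G G' E w U) (hy : y ∈ U)
    (Q : Fin n → Fin n → Model n → ℝ) (a b : Fin n) :
    up2 G' Q a b y = (E y)⁻¹ * (E y)⁻¹ * up2 G Q a b y := by
  simp only [up2, h.gInv_eq hy, Finset.mul_sum]
  exact Finset.sum_congr rfl fun c _ => Finset.sum_congr rfl fun d _ => by ring

lemma up2_mul (c : Model n → ℝ) (Q : Fin n → Fin n → Model n → ℝ) (a b : Fin n) :
    up2 G (fun i j z => c z * Q i j z) a b y = c y * up2 G Q a b y := by
  simp only [up2, Finset.mul_sum]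
  exact Finset.sum_congr rfl fun c _ => Finset.sum_congr rfl fun d _ => by ring

/-- Weights are counted: every factor S gives E and every inverse metric gives E⁻¹. The next three
lemmas follow the same count. -/
lemma ConformalOn.contrS_eq (h : ConformalOn G G' E w U) (hy : y ∈ U) (f : Model n → ℝ)
    (i j : Fin n) :
    contrS G' (fun a b c z => E z * S a b c z) f i j y = contrS G S f i j y := by
  simp only [contrS, h.gradUp_eq hy]
  have := h.factor_ne y
  exact Finset.sum_congr rfl fun a _ => by field_simp

lemma ConformalOn.contrSS1_eq (h : ConformalOn G G' E w U) (hy : y ∈ U) (i j k l : Fin n) :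
    contrSS1 G' (fun a b c z => E z * S a b c z) i j k l y = E y * contrSS1 G S i j k l y := by
  simp only [contrSS1, h.gInv_eq hy, Finset.mul_sum]
  have := h.factor_ne y
  exact Finset.sum_congr rfl fun a _ => Finset.sum_congr rfl fun b _ => by field_simp

lemma ConformalOn.contrSS2_eq (h : ConformalOn G G' E w U) (hy : y ∈ U) (i j : Fin n) :
    contrSS2 G' (fun a b c z => E z * S a b c z) i j y = contrSS2 G S i j y := by
  simp only [contrSS2]
  have := h.factor_ne y
  refine Finset.sum_congr rfl fun a _ => Finset.sum_congr rfl fun b _ => ?_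
  rw [h.up2_eq hy, up2_mul]
  field_simp

lemma ConformalOn.normSqS_eq (h : ConformalOn G G' E w U) (hy : y ∈ U) :
    normSqS G' (fun a b c z => E z * S a b c z) y = (E y)⁻¹ * normSqS G S y := by
  simp only [normSqS, h.contrSS2_eq hy, h.gInv_eq hy, Finset.mul_sum, mul_assoc]

lemma hess_sub_smul (hU : IsOpen U) (hy : y ∈ U) {t w : Model n → ℝ}
    (ht : ContDiffOn ℝ ∞ t U) (hw : ContDiffOn ℝ ∞ w U) (i j : Fin n) :
    hess G (fun z => t z - 3 * w z) i j y = hess G t i j y - 3 * hess G w i j y := by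
  have hd : ∀ k, ∀ z ∈ U, pd k (fun z => t z - 3 * w z) z = pd k t z - 3 * pd k w z := by
    intro k z hz
    have := differentiableAt_of_contDiffOn hU hw hz
    rw [pd_sub (differentiableAt_of_contDiffOn hU ht hz) (this.const_mul 3), pd_const_mul this]
  have d1 := differentiableAt_of_contDiffOn hU (contDiffOn_pd hU ht j) hy
  have d2 := differentiableAt_of_contDiffOn hU (contDiffOn_pd hU hw j) hy
  simp only [hess, pd_congr hU (hd j) hy, hd _ y hy]
  rw [pd_sub d1 (d2.const_mul 3), pd_const_mul d2]
  simp only [mul_sub, Finset.sum_sub_distrib, Finset.mul_sum]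
  rw [Finset.sum_congr rfl fun m _ => mul_left_comm (christoffel G m i j y) 3 (pd m w y)]
  ring

lemma pd_sub_smul (hU : IsOpen U) (hy : y ∈ U) {t w : Model n → ℝ}
    (ht : ContDiffOn ℝ ∞ t U) (hw : ContDiffOn ℝ ∞ w U) (k : Fin n) :
    pd k (fun z => t z - 3 * w z) y = pd k t y - 3 * pd k w y := by
  have := differentiableAt_of_contDiffOn hU hw hy
  rw [pd_sub (differentiableAt_of_contDiffOn hU ht hy) (this.const_mul 3), pd_const_mul this]

end Contractions

/-! ### The trace-free projectors and their conformal behaviour. -/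

section Projectors

variable {n : ℕ} {g h : Fin n → Fin n → ℝ}

/-- Each correction term contains one metric and one inverse metric, so the factors c and c⁻¹
cancel. -/
lemma proj3_conformal {c : ℝ} (hc : c ≠ 0) (T : Fin n → Fin n → Fin n → ℝ) (i j k : Fin n) :
    proj3 (fun a b => c * g a b) (fun a b => c⁻¹ * h a b) T i j k = proj3 g h T i j k := by
  have e : ∀ l, trace12 (fun a b => c⁻¹ * h a b) (sym3 T) l = c⁻¹ * trace12 h (sym3 T) l := by
    intro l
    simp only [trace12, Finset.mul_sum, mul_assoc]
  simp only [proj3, e]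
  field_simp

lemma proj2_conformal {c : ℝ} (hc : c ≠ 0) (T : Fin n → Fin n → ℝ) (i j : Fin n) :
    proj2 (fun a b => c * g a b) (fun a b => c⁻¹ * h a b) T i j = proj2 g h T i j := by
  simp only [proj2, mul_assoc, ← Finset.mul_sum]
  field_simp

lemma proj3_add (T T' : Fin n → Fin n → Fin n → ℝ) (i j k : Fin n) :
    proj3 g h (fun i j k => T i j k + T' i j k) i j k = proj3 g h T i j k + proj3 g h T' i j k := by
  have e : ∀ a b c, sym3 (fun i j k => T i j k + T' i j k) a b c = sym3 T a b c + sym3 T' a b c := by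
    intro a b c
    simp only [sym3]
    ring
  simp only [proj3, trace12, e, mul_add, Finset.sum_add_distrib]
  ring

lemma proj3_smul (c : ℝ) (T : Fin n → Fin n → Fin n → ℝ) (i j k : Fin n) :
    proj3 g h (fun i j k => c * T i j k) i j k = c * proj3 g h T i j k := by
  have e : ∀ a b d, sym3 (fun i j k => c * T i j k) a b d = c * sym3 T a b d := by
    intro a b d
    simp only [sym3]
    ring
  simp only [proj3, trace12, e, mul_left_comm _ c, ← Finset.mul_sum]
  ring

/-- A projection is computed by exhibiting the symmetrisation and checking that it is already
trace-free. -/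
lemma proj3_eq_of_sym3 {T F : Fin n → Fin n → Fin n → ℝ} (hF : ∀ i j k, sym3 T i j k = F i j k)
    (htr : ∀ k, ∑ a, ∑ b, h a b * F a b k = 0) (i j k : Fin n) :
    proj3 g h T i j k = F i j k := by
  simp only [proj3, trace12, hF, htr]
  ring

/-- Both inverse metrics have the same trace-free test tensors, and the pairing with them merely
scales, by c⁻⁴ from the inverse metrics and c from the tensor. -/
lemma isTraceFreePart4_conformal {c : ℝ} (hc : c ≠ 0) {T : Fin n → Fin n → Fin n → Fin n → ℝ}
    (hT : IsTraceFreePart4 h T 0) :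
    IsTraceFreePart4 (fun a b => c⁻¹ * h a b) (fun i j k l => c * T i j k l) 0 := by
  refine ⟨fun k l => by simp, fun V hV => ?_⟩
  have hV' : IsTraceFree4 h V := by
    intro k l
    have := hV k l
    simpa only [mul_assoc, ← Finset.mul_sum, mul_eq_zero, inv_eq_zero, hc, false_or] using this
  have h0 := hT.2 V hV'
  have e : inner4 (fun a b => c⁻¹ * h a b) ((fun i j k l => c * T i j k l) - 0) V =
      c⁻¹ ^ 4 * c * inner4 h (T - 0) V := by
    simp only [inner4, sub_zero, Finset.mul_sum]
    refine Finset.sum_congr rfl fun i _ => Finset.sum_congr rfl fun j _ =>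
      Finset.sum_congr rfl fun k _ => Finset.sum_congr rfl fun l _ =>
      Finset.sum_congr rfl fun a _ => Finset.sum_congr rfl fun b _ =>
      Finset.sum_congr rfl fun c _ => Finset.sum_congr rfl fun d _ => by ring
  rw [e, h0, mul_zero]

/-- The conformal variation of the right-hand side of the equation for `∇S`, `n ≥ 3`. -/
lemma proj3_conformal_variation {T : Fin n → Fin n → Fin n → ℝ} {w X : Fin n → ℝ}
    (hg : ∀ i j, g i j = g j i) (hh : ∀ i j, h i j = h j i)
    (hgh : ∀ i j, ∑ a, h i a * g a j = if i = j then 1 else 0)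
    (hX : ∀ i, X i = ∑ a, h i a * w a)
    (h1 : ∀ i j k, T i j k = T j i k) (h2 : ∀ i j k, T i j k = T i k j)
    (htr : ∀ k, ∑ a, ∑ b, h a b * T a b k = 0) (l i j k : Fin n) :
    proj3 g h (fun i j k => -9 * (T i j l * w k) - 3 * (T i j k * w l)
      + 9 * ((∑ m, X m * T m j k) * g i l)) i j k =
    -3 * (w l * T i j k) - 3 * (w i * T l j k + w j * T i l k + w k * T i j l)
      + 3 * (g l i * ∑ m, X m * T m j k + g l j * ∑ m, X m * T i m k
        + g l k * ∑ m, X m * T i j m) := by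
  set V : Fin n → Fin n → ℝ := fun j k => ∑ m, X m * T m j k with hV
  have hVs : ∀ j k, V j k = V k j := fun j k =>
    Finset.sum_congr rfl fun m _ => by rw [h2 m j k]
  have hV1 : ∀ i k, ∑ m, X m * T i m k = V i k := fun i k =>
    Finset.sum_congr rfl fun m _ => by rw [h1 i m k]
  have hV2 : ∀ i j, ∑ m, X m * T i j m = V i j := fun i j =>
    Finset.sum_congr rfl fun m _ => by rw [h2 i j m, h1 i m j]
  have t1 : ∀ k, ∑ a, ∑ b, h a b * (w a * T l b k) = V l k := by
    intro k
    rw [← hV1, Finset.sum_comm]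
    refine Finset.sum_congr rfl fun b _ => ?_
    rw [hX, Finset.sum_mul]
    exact Finset.sum_congr rfl fun a _ => by rw [hh a b]; ring
  have t2 : ∀ k, ∑ a, ∑ b, h a b * (w b * T a l k) = V l k := by
    intro k
    rw [← hV1]
    refine Finset.sum_congr rfl fun a _ => ?_
    rw [hX, Finset.sum_mul]
    exact Finset.sum_congr rfl fun b _ => by rw [h1 a l k]; ring
  have t3 : ∀ k, ∑ a, ∑ b, h a b * (g l a * V b k) = V l k := by
    intro k
    have : ∀ b, ∑ a, h a b * (g l a * V b k) = V b k * if b = l then 1 else 0 := by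
      intro b
      rw [← hgh, Finset.mul_sum]
      exact Finset.sum_congr rfl fun a _ => by rw [hh a b, hg l a]; ring
    rw [Finset.sum_comm]
    simp [this]
  have t4 : ∀ k, ∑ a, ∑ b, h a b * (g l b * V a k) = V l k := by
    intro k
    have : ∀ a, ∑ b, h a b * (g l b * V a k) = V a k * if a = l then 1 else 0 := by
      intro a
      rw [← hgh, Finset.mul_sum]
      exact Finset.sum_congr rfl fun b _ => by rw [hg l b]; ring
    simp [this]
  have t5 : ∑ a, ∑ b, h a b * V a b = 0 := by
    have : ∀ a b, h a b * V a b = ∑ m, X m * (h a b * T a b m) := by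
      intro a b
      rw [← hV2, Finset.mul_sum]
      exact Finset.sum_congr rfl fun m _ => by ring
    simp only [this]
    rw [Finset.sum_congr rfl fun a _ => Finset.sum_comm, Finset.sum_comm]
    simp only [← Finset.mul_sum, htr, mul_zero, Finset.sum_const_zero]
  simp only [hV1, hV2]
  -- The right-hand side is the symmetrisation itself. In its trace the contraction `V l k` occurs
  -- with coefficients −3 − 3 + 3 + 3 = 0, independently of the dimension.
  refine proj3_eq_of_sym3 (F := fun i j k => -3 * (w l * T i j k)
    - 3 * (w i * T l j k + w j * T i l k + w k * T i j l)
      + 3 * (g l i * V j k + g l j * V i k + g l k * V i j)) (fun i j k => ?_) (fun k => ?_) i j k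
  · have hVd : ∀ j k, ∑ m, X m * T m j k = V j k := fun _ _ => rfl
    simp only [sym3, hVd]
    rw [hg i l, hg j l, hg k l, hVs k j, hVs k i, hVs j i, h1 l j k, h2 j l k, h2 i l k,
      h1 j i l, h1 k i l, h2 i k l, h1 k j l, h2 j k l, h1 k j i, h2 j k i, h1 j i k,
      h1 k i j, h2 i k j]
    ring
  · have : ∀ a b, h a b * (-3 * (w l * T a b k)
        - 3 * (w a * T l b k + w b * T a l k + w k * T a b l)
        + 3 * (g l a * V b k + g l b * V a k + g l k * V a b)) =
        (-3 * w l) * (h a b * T a b k) - 3 * (h a b * (w a * T l b k))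
        - 3 * (h a b * (w b * T a l k)) - 3 * w k * (h a b * T a b l)
        + 3 * (h a b * (g l a * V b k)) + 3 * (h a b * (g l b * V a k))
        + 3 * g l k * (h a b * V a b) := fun a b => by ring
    simp only [this, Finset.sum_add_distrib, Finset.sum_sub_distrib, ← Finset.mul_sum, htr, t1,
      t2, t3, t4, t5]
    ring

end Projectors

/-! ### The structural equations for n ≥ 3. -/

section DimensionAtLeastThree

variable {n : ℕ} {U : Set (Model n)} {G G' : Fin n → Fin n → Model n → ℝ} {E w : Model n → ℝ}
  {S : Fin n → Fin n → Fin n → Model n → ℝ} {t : Model n → ℝ} {y : Model n}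

/-- The Schouten combination is the one in which Δw cancels between the Ricci and scalar terms; the
common factor n − 2 can then be divided out. -/
lemma ConformalOn.schouten_eq (h : ConformalOn G G' E w U) (hn : 3 ≤ n) (hy : y ∈ U)
    (i j : Fin n) :
    schouten G' i j y = schouten G i j y - hess G w i j y + pd i w y * pd j w y
      - 1 / 2 * gradSq G w y * G i j y := by
  have hn' : (3 : ℝ) ≤ n := by exact_mod_cast hn
  have n1 : (n : ℝ) - 1 ≠ 0 := by linarith
  have n2 : (n : ℝ) - 2 ≠ 0 := by linarith
  have hE := h.factor_ne y
  have e : gradSq G w y = gradInner G w w y := rfl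
  rw [schouten, schouten, h.ricci_eq hy, h.scal_eq hy, h.eq, e]
  field_simp
  ring

/-- The components of a smooth, totally symmetric, trace-free tensor field on an open set. -/
structure SymmTraceFreeOn (G : Fin n → Fin n → Model n → ℝ)
    (S : Fin n → Fin n → Fin n → Model n → ℝ) (U : Set (Model n)) : Prop where
  smooth : ∀ i j k, ContDiffOn ℝ ∞ (S i j k) U
  symm_left : ∀ i j k y, S i j k y = S j i k y
  symm_right : ∀ i j k y, S i j k y = S i k j y
  trace : ∀ y ∈ U, ∀ k, ∑ a, ∑ b, gInv G a b y * S a b k y = 0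

lemma contrS_eq_sum (hS : SymmTraceFreeOn G S U) (f : Model n → ℝ) (i j : Fin n) :
    contrS G S f i j y = ∑ m, gradUp G f m y * S m i j y :=
  Finset.sum_congr rfl fun m _ => by rw [hS.symm_right i j m, hS.symm_left i m j, mul_comm]

lemma ConformalOn.structEqHigh (h : ConformalOn G G' E w U) (hn : 3 ≤ n) (hy : y ∈ U)
    (hS : SymmTraceFreeOn G S U) (ht : ContDiffOn ℝ ∞ t U) (H : StructEqHigh G S t y) :
    StructEqHigh G' (fun a b c z => E z * S a b c z) (fun z => t z - 3 * w z) y := by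
  have hU := h.base.isOpen
  have hE := h.factor_ne y
  have hp := pd_sub_smul hU hy ht h.exponent_smooth
  refine ⟨fun i j => ?_, fun l i j k => ?_, ?_⟩
  · rw [h.hess_eq hy, hess_sub_smul hU hy ht h.exponent_smooth, H.hess_t, h.schouten_eq hn hy,
      h.contrSS2_eq hy, h.normSqS_eq hy, hp, hp, h.eq]
    have e1 : gradSq G' (fun z => t z - 3 * w z) y =
        (E y)⁻¹ * (gradSq G t y - 6 * gradInner G w t y + 9 * gradSq G w y) := by
      rw [← gradSq_sub_smul h.base hp]
      exact h.gradInner_eq hy _ _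
    have e2 : gradInner G w (fun z => t z - 3 * w z) y =
        gradInner G w t y - 3 * gradSq G w y := by
      simp only [gradInner, gradSq, hp, mul_sub, Finset.sum_sub_distrib, Finset.mul_sum]
      congr 1
      exact Finset.sum_congr rfl fun a _ => by ring
    rw [e1, e2]
    field_simp
    ring
  · rw [h.nabla3_eq hy S fun a b c => differentiableAt_of_contDiffOn hU (hS.smooth a b c) hy,
      H.nabla_S]
    simp only [h.gInv_eq hy, h.eq, proj3_conformal hE, h.contrSS1_eq hy, h.contrSS2_eq hy,
      h.contrS_eq hy, contrS_sub_smul hp, hp]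
    have e := proj3_conformal_variation (g := fun a b => G a b y) (h := fun a b => gInv G a b y)
      (T := fun a b c => S a b c y) (w := fun a => pd a w y) (X := fun a => gradUp G w a y)
      (fun i j => h.base.symm i j y) (fun i j => gInv_symm h.base i j y)
      (sum_gInv_mul h.base hy) (fun i => rfl) (fun i j k => hS.symm_left i j k y)
      (fun i j k => hS.symm_right i j k y) (hS.trace y hy) l i j k
    -- The new argument of the projector is E times the old one plus a remainder linear in dw. The
    -- coefficients −9, −3, 9 are −3 times the coefficients 3, 1, −3 of the terms containing dt.
    have e2 : (fun i j k : Fin n => E y * contrSS1 G S i l j k y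
        + 3 * (E y * S i j l y) * (pd k t y - 3 * pd k w y)
        + E y * S i j k y * (pd l t y - 3 * pd l w y)
        + (4 / ((n : ℝ) - 2) * contrSS2 G S j k y
          - 3 * (contrS G S t j k y - 3 * contrS G S w j k y)) * (E y * G i l y)) =
        fun i j k => E y * ((contrSS1 G S i l j k y + 3 * S i j l y * pd k t y
          + S i j k y * pd l t y
          + (4 / ((n : ℝ) - 2) * contrSS2 G S j k y - 3 * contrS G S t j k y) * G i l y)
          + (-9 * (S i j l y * pd k w y) - 3 * (S i j k y * pd l w y)
            + 9 * ((∑ m, gradUp G w m y * S m j k y) * G i l y))) := by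
      funext i j k
      rw [← contrS_eq_sum hS]
      ring
    have e3 := proj3_add (g := fun a b => G a b y) (h := fun a b => gInv G a b y)
      (fun i j k => contrSS1 G S i l j k y + 3 * S i j l y * pd k t y + S i j k y * pd l t y
        + (4 / ((n : ℝ) - 2) * contrSS2 G S j k y - 3 * contrS G S t j k y) * G i l y)
      (fun i j k => -9 * (S i j l y * pd k w y) - 3 * (S i j k y * pd l w y)
        + 9 * ((∑ m, gradUp G w m y * S m j k y) * G i l y)) i j k
    rw [e2, proj3_smul, e3, e]
    ring
  · have e : (fun i j k l : Fin n => ∑ a, ∑ b, (gInv G' a b y * (E y * S a i k y) * (E y * S b j l y)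
        - gInv G' a b y * (E y * S a i l y) * (E y * S b j k y))) =
        fun i j k l => E y * ∑ a, ∑ b, (gInv G a b y * S a i k y * S b j l y
        - gInv G a b y * S a i l y * S b j k y) := by
      funext i j k l
      simp only [Finset.mul_sum, h.gInv_eq hy]
      exact Finset.sum_congr rfl fun a _ => Finset.sum_congr rfl fun b _ => by field_simp
    have e2 : (fun a b => gInv G' a b y) = fun a b => (E y)⁻¹ * gInv G a b y :=
      funext fun a => funext fun b => h.gInv_eq hy a b
    rw [e, e2]
    exact isTraceFreePart4_conformal hE H.weyl_S

end DimensionAtLeastThree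

/-! ### Divergences of rank-two tensors, the Ricci identity and the Bochner identity. -/

section Divergence

variable {n : ℕ} {U : Set (Model n)} {G G' : Fin n → Fin n → Model n → ℝ} {E w : Model n → ℝ}
  {S : Fin n → Fin n → Fin n → Model n → ℝ} {t : Model n → ℝ} {y : Model n}

/-- The divergence `∇ᵃ Qₐₖ`. -/
noncomputable def divergence (G Q : Fin n → Fin n → Model n → ℝ) (k : Fin n) (y : Model n) : ℝ :=
  ∑ a, ∑ b, gInv G a b y * nabla2 G Q b a k y

/-- The trace `gᵃᵇ Qₐᵦ`. -/
noncomputable def trace2 (G Q : Fin n → Fin n → Model n → ℝ) (y : Model n) : ℝ :=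
  ∑ a, ∑ b, gInv G a b y * Q a b y

lemma nabla2_congr (hU : IsOpen U) (hy : y ∈ U) {P Q : Fin n → Fin n → Model n → ℝ}
    (hPQ : ∀ i j, ∀ z ∈ U, P i j z = Q i j z) (l i j : Fin n) :
    nabla2 G P l i j y = nabla2 G Q l i j y := by
  simp only [nabla2, pd_congr hU (hPQ i j) hy, hPQ _ _ y hy]

lemma nabla2_add {P Q : Fin n → Fin n → Model n → ℝ}
    (hP : ∀ i j, DifferentiableAt ℝ (P i j) y) (hQ : ∀ i j, DifferentiableAt ℝ (Q i j) y)
    (l i j : Fin n) :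
    nabla2 G (fun i j z => P i j z + Q i j z) l i j y = nabla2 G P l i j y + nabla2 G Q l i j y := by
  simp only [nabla2, pd_add (hP _ _) (hQ _ _), mul_add, Finset.sum_add_distrib]
  ring

lemma nabla2_const_mul {Q : Fin n → Fin n → Model n → ℝ}
    (hQ : ∀ i j, DifferentiableAt ℝ (Q i j) y) (c : ℝ) (l i j : Fin n) :
    nabla2 G (fun i j z => c * Q i j z) l i j y = c * nabla2 G Q l i j y := by
  simp only [nabla2, pd_const_mul (hQ _ _), mul_sub, Finset.mul_sum]
  congr 1
  exact Finset.sum_congr rfl fun m _ => by ring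

lemma divergence_congr (hU : IsOpen U) (hy : y ∈ U) {P Q : Fin n → Fin n → Model n → ℝ}
    (hPQ : ∀ i j, ∀ z ∈ U, P i j z = Q i j z) (k : Fin n) :
    divergence G P k y = divergence G Q k y := by
  simp only [divergence, nabla2_congr hU hy hPQ]

lemma divergence_add {P Q : Fin n → Fin n → Model n → ℝ}
    (hP : ∀ i j, DifferentiableAt ℝ (P i j) y) (hQ : ∀ i j, DifferentiableAt ℝ (Q i j) y)
    (k : Fin n) :
    divergence G (fun i j z => P i j z + Q i j z) k y = divergence G P k y + divergence G Q k y := by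
  simp only [divergence, nabla2_add hP hQ, mul_add, Finset.sum_add_distrib]

lemma divergence_const_mul {Q : Fin n → Fin n → Model n → ℝ}
    (hQ : ∀ i j, DifferentiableAt ℝ (Q i j) y) (c : ℝ) (k : Fin n) :
    divergence G (fun i j z => c * Q i j z) k y = c * divergence G Q k y := by
  simp only [divergence, nabla2_const_mul hQ, Finset.mul_sum, mul_left_comm _ c]

/-- Contraction with the metric commutes with covariant differentiation. -/
lemma pd_trace2 (hG : SmoothMetricOn G U) (hy : y ∈ U) {Q : Fin n → Fin n → Model n → ℝ}
    (hQ : ∀ i j, DifferentiableAt ℝ (Q i j) y) (k : Fin n) :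
    pd k (trace2 G Q) y = ∑ a, ∑ b, gInv G a b y * nabla2 G Q k a b y := by
  have dh := fun a b => differentiableAt_of_contDiffOn hG.isOpen (contDiffOn_gInv hG a b) hy
  have e : trace2 G Q = fun z => ∑ a, ∑ b, gInv G a b z * Q a b z := rfl
  rw [e, pd_sum fun a _ => DifferentiableAt.fun_sum fun b _ => (dh a b).fun_mul (hQ a b)]
  simp only [pd_sum fun b _ => (dh _ b).fun_mul (hQ _ b), pd_mul (dh _ _) (hQ _ _), nabla2,
    pd_gInv hG hy, mul_sub, neg_mul, Finset.sum_add_distrib, Finset.sum_sub_distrib,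
    Finset.sum_neg_distrib, add_mul, neg_add, mul_add, Finset.sum_mul, Finset.mul_sum]
  have e1 : ∑ a, ∑ b, ∑ m, christoffel G a k m y * gInv G m b y * Q a b y =
      ∑ a, ∑ b, ∑ m, gInv G a b y * (christoffel G m k a y * Q m b y) := by
    rw [Finset.sum_congr rfl fun a _ => Finset.sum_comm, Finset.sum_comm,
      Finset.sum_congr rfl fun a _ => Finset.sum_comm]
    exact Finset.sum_congr rfl fun a _ => Finset.sum_congr rfl fun b _ =>
      Finset.sum_congr rfl fun m _ => by ring
  have e2 : ∑ a, ∑ b, ∑ m, christoffel G b k m y * gInv G a m y * Q a b y =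
      ∑ a, ∑ b, ∑ m, gInv G a b y * (christoffel G m k b y * Q a m y) := by
    refine Finset.sum_congr rfl fun a _ => ?_
    rw [Finset.sum_comm]
    exact Finset.sum_congr rfl fun b _ => Finset.sum_congr rfl fun m _ => by ring
  rw [e1, e2]
  ring

lemma laplacian_eq_trace2 (f : Model n → ℝ) : laplacian G f = trace2 G (hess G f) := rfl

/-- This is an equality of functions, not only of values at a point, so that `pd_trace2` can
differentiate it. -/
lemma gradInner_eq_trace2 (hG : SmoothMetricOn G U) (f h : Model n → ℝ) :
    gradInner G f h = trace2 G (fun i j z => pd i f z * pd j h z) := by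
  funext z
  simp only [gradInner, gradUp, trace2, Finset.sum_mul]
  rw [Finset.sum_comm]
  refine Finset.sum_congr rfl fun a _ => Finset.sum_congr rfl fun b _ => ?_
  rw [gInv_symm hG]
  ring

lemma nabla2_pd_mul_pd (hU : IsOpen U) (hy : y ∈ U) {f h : Model n → ℝ}
    (hf : ContDiffOn ℝ ∞ f U) (hh : ContDiffOn ℝ ∞ h U) (l i j : Fin n) :
    nabla2 G (fun i j z => pd i f z * pd j h z) l i j y =
      hess G f l i y * pd j h y + pd i f y * hess G h l j y := by
  have df := differentiableAt_of_contDiffOn hU (contDiffOn_pd hU hf i) hy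
  have dh := differentiableAt_of_contDiffOn hU (contDiffOn_pd hU hh j) hy
  simp only [nabla2, pd_mul df dh, hess, Finset.sum_add_distrib, sub_mul, mul_sub, Finset.sum_mul,
    Finset.mul_sum]
  have e1 : ∑ m, pd i f y * (christoffel G m l j y * pd m h y) =
      ∑ m, christoffel G m l j y * (pd i f y * pd m h y) :=
    Finset.sum_congr rfl fun m _ => by ring
  rw [e1]
  simp only [mul_assoc]
  ring

lemma divergence_pd_mul_pd (hG : SmoothMetricOn G U) (hy : y ∈ U) {f h : Model n → ℝ}
    (hf : ContDiffOn ℝ ∞ f U) (hh : ContDiffOn ℝ ∞ h U) (k : Fin n) :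
    divergence G (fun i j z => pd i f z * pd j h z) k y =
      laplacian G f y * pd k h y + ∑ a, gradUp G f a y * hess G h k a y := by
  simp only [divergence, nabla2_pd_mul_pd hG.isOpen hy hf hh, mul_add, Finset.sum_add_distrib,
    laplacian, gradUp, Finset.sum_mul]
  congr 1
  · refine Finset.sum_congr rfl fun a _ => Finset.sum_congr rfl fun b _ => ?_
    rw [hess_symm hG hy hf]
    ring
  · rw [Finset.sum_comm]
    refine Finset.sum_congr rfl fun a _ => Finset.sum_congr rfl fun b _ => ?_
    rw [gInv_symm hG, hess_symm hG hy hh]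
    ring

lemma pd_gradInner (hG : SmoothMetricOn G U) (hy : y ∈ U) {f h : Model n → ℝ}
    (hf : ContDiffOn ℝ ∞ f U) (hh : ContDiffOn ℝ ∞ h U) (k : Fin n) :
    pd k (gradInner G f h) y =
      ∑ a, gradUp G h a y * hess G f k a y + ∑ a, gradUp G f a y * hess G h k a y := by
  have df := fun i => differentiableAt_of_contDiffOn hG.isOpen (contDiffOn_pd hG.isOpen hf i) hy
  have dh := fun i => differentiableAt_of_contDiffOn hG.isOpen (contDiffOn_pd hG.isOpen hh i) hy
  rw [gradInner_eq_trace2 hG, pd_trace2 hG hy fun i j => (df i).fun_mul (dh j)]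
  simp only [nabla2_pd_mul_pd hG.isOpen hy hf hh, mul_add, Finset.sum_add_distrib, gradUp,
    Finset.sum_mul]
  congr 1
  · exact Finset.sum_congr rfl fun a _ => Finset.sum_congr rfl fun b _ => by ring
  · rw [Finset.sum_comm]
    refine Finset.sum_congr rfl fun a _ => Finset.sum_congr rfl fun b _ => ?_
    rw [gInv_symm hG]
    ring

lemma nabla2_mul_metric (hG : SmoothMetricOn G U) (hy : y ∈ U) {f : Model n → ℝ}
    (hf : DifferentiableAt ℝ f y) (l i j : Fin n) :
    nabla2 G (fun i j z => f z * G i j z) l i j y = pd l f y * G i j y := by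
  have dg := differentiableAt_of_contDiffOn hG.isOpen (hG.smooth i j) hy
  rw [nabla2, pd_mul hf dg, pd_metric hG hy, Finset.mul_sum, add_sub_assoc, ← Finset.sum_sub_distrib,
    Finset.sum_eq_zero fun m _ => by ring, add_zero]

lemma divergence_mul_metric (hG : SmoothMetricOn G U) (hy : y ∈ U) {f : Model n → ℝ}
    (hf : DifferentiableAt ℝ f y) (k : Fin n) :
    divergence G (fun i j z => f z * G i j z) k y = pd k f y := by
  have : ∀ b, ∑ a, gInv G a b y * (pd b f y * G a k y) = pd b f y * if b = k then 1 else 0 := by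
    intro b
    rw [← sum_gInv_mul hG hy, Finset.mul_sum]
    exact Finset.sum_congr rfl fun a _ => by rw [gInv_symm hG]; ring
  simp only [divergence, nabla2_mul_metric hG hy hf]
  rw [Finset.sum_comm]
  simp [this]

/-- The Ricci identity for the differential of a function. -/
lemma nabla2_hess_sub (hG : SmoothMetricOn G U) (hy : y ∈ U) {f : Model n → ℝ}
    (hf : ContDiffOn ℝ ∞ f U) (b a k : Fin n) :
    nabla2 G (hess G f) b a k y - nabla2 G (hess G f) k a b y =
      -∑ m, curvature G m a b k y * pd m f y := by
  have hU := hG.isOpen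
  have d1 := fun i => differentiableAt_of_contDiffOn hU (contDiffOn_pd hU hf i) hy
  have d2 := fun i j => differentiableAt_of_contDiffOn hU
    (contDiffOn_pd hU (contDiffOn_pd hU hf i) j) hy
  have dc := fun a b c => differentiableAt_of_contDiffOn hU (contDiffOn_christoffel hG a b c) hy
  have cs := christoffel_symm hG
  have e1 : ∀ b a k, pd b (hess G f a k) y = pd b (pd a (pd k f)) y
      - ∑ m, (pd b (christoffel G m a k) y * pd m f y
        + christoffel G m a k y * pd b (pd m f) y) := by
    intro b a k
    have e : hess G f a k = fun z => pd a (pd k f) z - ∑ m, christoffel G m a k z * pd m f z := rfl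
    rw [e, pd_sub (d2 _ _) (DifferentiableAt.fun_sum fun m _ => (dc _ _ _).fun_mul (d1 _)),
      pd_sum fun m _ => (dc _ _ _).fun_mul (d1 _)]
    simp only [pd_mul (dc _ _ _) (d1 _)]
  -- Third partial derivatives are symmetric, so only Christoffel terms survive in the difference.
  have e2 : pd b (pd a (pd k f)) y = pd k (pd a (pd b f)) y := by
    rw [pd_congr hU (fun z hz => pd_comm hU hf hz a k) hy b,
      pd_comm hU (contDiffOn_pd hU hf a) hy, pd_congr hU (fun z hz => pd_comm hU hf hz b a) hy k]
  have cf : ∀ k i j, christoffel G k i j = christoffel G k j i := fun k i j => funext (cs k i j)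
  have e4 : ∀ b a k : Fin n, ∑ m, christoffel G m b a y * hess G f m k y =
      ∑ m, christoffel G m b a y * pd k (pd m f) y
      - ∑ m, (∑ p, christoffel G m k p y * christoffel G p b a y) * pd m f y := by
    intro b a k
    simp only [hess, mul_sub, Finset.sum_sub_distrib, Finset.mul_sum, Finset.sum_mul]
    rw [Finset.sum_comm (f := fun m p => christoffel G m b a y * (christoffel G p m k y * pd p f y))]
    congr 1
    · exact Finset.sum_congr rfl fun m _ => by rw [pd_comm hU hf hy]
    · exact Finset.sum_congr rfl fun m _ => Finset.sum_congr rfl fun p _ => by rw [cs m k p]; ring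
  have e5 : ∑ m, christoffel G m k b y * hess G f a m y =
      ∑ m, christoffel G m b k y * hess G f a m y :=
    Finset.sum_congr rfl fun m _ => by rw [cs m k b]
  simp only [nabla2, e1, Finset.sum_add_distrib, e5, e4, e2]
  simp only [curvature, add_mul, sub_mul, Finset.sum_add_distrib, Finset.sum_sub_distrib]
  simp only [cf _ a k, cf _ a b]
  ring

/-- The Bochner identity `∇ᵃ∇ₐ∇ₖ f = ∇ₖ Δf + Ric(grad f)ₖ`. -/
lemma divergence_hess (hG : SmoothMetricOn G U) (hy : y ∈ U) {f : Model n → ℝ}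
    (hf : ContDiffOn ℝ ∞ f U) (k : Fin n) :
    divergence G (hess G f) k y =
      pd k (laplacian G f) y + ∑ a, ricci G k a y * gradUp G f a y := by
  have dh := fun i j => differentiableAt_of_contDiffOn hG.isOpen (contDiffOn_hess hG hf i j) hy
  have e0 : ∀ a b, nabla2 G (hess G f) b a k y = nabla2 G (hess G f) k a b y
      + -∑ m, curvature G m a b k y * pd m f y := by
    intro a b
    rw [← nabla2_hess_sub hG hy hf]
    ring
  rw [laplacian_eq_trace2, pd_trace2 hG hy dh]
  simp only [divergence, e0, mul_add, Finset.sum_add_distrib]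
  congr 1
  have e1 : ∑ a, ∑ b, gInv G a b y * -∑ m, curvature G m a b k y * pd m f y =
      ∑ b, ∑ m, -(∑ a, curvature G m a b k y * gInv G a b y) * pd m f y := by
    rw [Finset.sum_comm]
    refine Finset.sum_congr rfl fun b _ => ?_
    simp only [Finset.mul_sum, ← Finset.sum_neg_distrib, Finset.sum_mul]
    rw [Finset.sum_comm]
    exact Finset.sum_congr rfl fun m _ => Finset.sum_congr rfl fun a _ => by ring
  rw [e1]
  -- Skewness moves the contraction from the lower index pair to the pair whose trace defines Ric,
  -- and its sign turns the minus into a plus.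
  simp only [fun b m => sum_curvature_mul_gInv hG hy m b b k, neg_neg, ricci, gradUp,
    Finset.sum_mul, Finset.mul_sum]
  rw [Finset.sum_congr rfl fun b _ => Finset.sum_comm, Finset.sum_comm]
  refine Finset.sum_congr rfl fun a _ => ?_
  rw [Finset.sum_comm]
  exact Finset.sum_congr rfl fun b _ => Finset.sum_congr rfl fun m _ => by ring

lemma contDiffOn_contrS (hG : SmoothMetricOn G U) (hS : SymmTraceFreeOn G S U)
    {f : Model n → ℝ} (hf : ContDiffOn ℝ ∞ f U) (i j : Fin n) :
    ContDiffOn ℝ ∞ (contrS G S f i j) U :=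
  ContDiffOn.sum fun a _ => (hS.smooth i j a).mul (contDiffOn_gradUp hG hf a)

lemma nabla2_contrS (hG : SmoothMetricOn G U) (hS : SymmTraceFreeOn G S U) (hy : y ∈ U)
    {f : Model n → ℝ} (hf : ContDiffOn ℝ ∞ f U) (l i j : Fin n) :
    nabla2 G (contrS G S f) l i j y = ∑ m, nabla3 G S l i j m y * gradUp G f m y
      + ∑ m, S i j m y * ∑ a, gInv G m a y * hess G f l a y := by
  have ds := fun m => differentiableAt_of_contDiffOn hG.isOpen (hS.smooth i j m) hy
  have dg := fun m => differentiableAt_of_contDiffOn hG.isOpen (contDiffOn_gradUp hG hf m) hy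
  have e : contrS G S f i j = fun z => ∑ m, S i j m z * gradUp G f m z := rfl
  simp only [nabla2, e, pd_sum fun m _ => (ds m).fun_mul (dg m), pd_mul (ds _) (dg _),
    pd_gradUp hG hy hf, nabla3, sub_mul, mul_sub, Finset.sum_add_distrib, Finset.sum_sub_distrib,
    Finset.sum_mul, add_mul]
  have e1 : ∀ i j l : Fin n, ∑ m, christoffel G m l i y * contrS G S f m j y =
      ∑ x, ∑ m, christoffel G m l i y * S m j x y * gradUp G f x y := by
    intro i j l
    simp only [contrS, Finset.mul_sum]
    rw [Finset.sum_comm]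
    simp only [mul_assoc]
  have e2 : ∀ i j l : Fin n, ∑ m, christoffel G m l j y * contrS G S f i m y =
      ∑ x, ∑ m, christoffel G m l j y * S i m x y * gradUp G f x y := by
    intro i j l
    simp only [contrS, Finset.mul_sum]
    rw [Finset.sum_comm]
    simp only [mul_assoc]
  have e3 : ∑ m, S i j m y * ∑ p, christoffel G m l p y * gradUp G f p y =
      ∑ x, ∑ m, christoffel G m l x y * S i j m y * gradUp G f x y := by
    simp only [Finset.mul_sum]
    rw [Finset.sum_comm]
    exact Finset.sum_congr rfl fun a _ => Finset.sum_congr rfl fun b _ => by ring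
  rw [e1, e2, e3]
  ring

/-- The contraction `Sₖᵃᵇ Qₐᵦ`. -/
noncomputable def contrSQ (G : Fin n → Fin n → Model n → ℝ)
    (S : Fin n → Fin n → Fin n → Model n → ℝ) (Q : Fin n → Fin n → Model n → ℝ) (k : Fin n)
    (y : Model n) : ℝ :=
  ∑ a, ∑ b, S k a b y * up2 G Q a b y

lemma nabla3_symm_left (hS : SymmTraceFreeOn G S U) (l i j k : Fin n) (y : Model n) :
    nabla3 G S l i j k y = nabla3 G S l j i k y := by
  have : S i j k = S j i k := funext (hS.symm_left i j k)
  simp only [nabla3, this]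
  congr 1
  refine Finset.sum_congr rfl fun m _ => ?_
  rw [hS.symm_left m j k, hS.symm_left i m k, hS.symm_left i j m]
  ring

lemma nabla3_symm_right (hS : SymmTraceFreeOn G S U) (l i j k : Fin n) (y : Model n) :
    nabla3 G S l i j k y = nabla3 G S l i k j y := by
  have : S i j k = S i k j := funext (hS.symm_right i j k)
  simp only [nabla3, this]
  congr 1
  refine Finset.sum_congr rfl fun m _ => ?_
  rw [hS.symm_right m j k, hS.symm_right i m k, hS.symm_right i j m]
  ring

/-- The divergence of S is expressed through Ξ, whose conformal behaviour is known. The function `t`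
enters only through Ξ and may differ from `f`; later `f` is the conformal exponent. -/
lemma divergence_contrS (hG : SmoothMetricOn G U) (hS : SymmTraceFreeOn G S U) (hy : y ∈ U)
    {f : Model n → ℝ} (hf : ContDiffOn ℝ ∞ f U) (k : Fin n) :
    divergence G (contrS G S f) k y =
      ∑ m, (xi G S t k m y - 2 / 3 * contrS G S t k m y) * gradUp G f m y
      + contrSQ G S (hess G f) k y := by
  simp only [divergence, nabla2_contrS hG hS hy hf, mul_add, Finset.sum_add_distrib]
  congr 1
  · simp only [xi, add_sub_cancel_right, Finset.mul_sum, Finset.sum_mul]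
    rw [Finset.sum_congr rfl fun a _ => Finset.sum_comm, Finset.sum_comm]
    simp only [mul_assoc]
  · simp only [contrSQ, up2, Finset.mul_sum]
    have e : ∀ a b m c, gInv G a b y * (S a k m y * (gInv G m c y * hess G f b c y)) =
        S k a m y * (gInv G a b y * gInv G m c y * hess G f b c y) := by
      intro a b m c
      rw [hS.symm_left a k m]
      ring
    simp only [e]
    exact Finset.sum_congr rfl fun a _ => Finset.sum_comm

end Divergence

/-! ### Pointwise identities for symmetric trace-free tensors in dimension two. -/

section AlgebraInDimensionTwo

variable {g h : Fin 2 → Fin 2 → ℝ}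

/-- Cramer's rule with the determinant multiplied out, so that trace conditions become polynomial in
the components of the metric. -/
lemma inverse_two (hg : ∀ i j, g i j = g j i)
    (hgh : ∀ i j, ∑ a, h i a * g a j = if i = j then 1 else 0) :
    h 0 0 * (g 0 0 * g 1 1 - g 0 1 ^ 2) = g 1 1 ∧ h 0 1 * (g 0 0 * g 1 1 - g 0 1 ^ 2) = -g 0 1 ∧
    h 1 0 * (g 0 0 * g 1 1 - g 0 1 ^ 2) = -g 0 1 ∧ h 1 1 * (g 0 0 * g 1 1 - g 0 1 ^ 2) = g 0 0 := by
  have h00 := hgh 0 0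
  have h01 := hgh 0 1
  have h10 := hgh 1 0
  have h11 := hgh 1 1
  simp only [Fin.sum_univ_two, hg 1 0, if_true, zero_ne_one, one_ne_zero, if_false]
    at h00 h01 h10 h11
  refine ⟨?_, ?_, ?_, ?_⟩
  · linear_combination g 1 1 * h00 - g 0 1 * h01
  · linear_combination g 0 0 * h01 - g 0 1 * h00
  · linear_combination g 1 1 * h10 - g 0 1 * h11
  · linear_combination g 0 0 * h11 - g 0 1 * h10

lemma traceFree_two (hg : ∀ i j, g i j = g j i)
    (hgh : ∀ i j, ∑ a, h i a * g a j = if i = j then 1 else 0) {F : Fin 2 → Fin 2 → ℝ}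
    (hF : ∀ i j, F i j = F j i) (htr : ∑ a, ∑ b, h a b * F a b = 0) :
    g 1 1 * F 0 0 - 2 * g 0 1 * F 0 1 + g 0 0 * F 1 1 = 0 := by
  obtain ⟨h1, h2, h3, h4⟩ := inverse_two hg hgh
  simp only [Fin.sum_univ_two, hF 1 0] at htr
  linear_combination (g 0 0 * g 1 1 - g 0 1 ^ 2) * htr - F 0 0 * h1 - F 0 1 * h2 - F 0 1 * h3
    - F 1 1 * h4

/-- For a metric, the left side is symmetric and trace-free in i, j, k. Its symmetrisation over all
four indices vanishes, and its contraction over l and i has coefficient 3 − 1 + 2 − 4 = 0. In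
dimension two these two parts determine such a tensor. The proof checks components. -/
lemma traceFree_identity_three {T : Fin 2 → Fin 2 → Fin 2 → ℝ} {w X : Fin 2 → ℝ}
    (hg : ∀ i j, g i j = g j i)
    (h1 : ∀ i j k, T i j k = T j i k) (h2 : ∀ i j k, T i j k = T i k j)
    (htr : ∀ k, g 1 1 * T 0 0 k - 2 * g 0 1 * T 0 1 k + g 0 0 * T 1 1 k = 0)
    (hw : ∀ i, w i = ∑ a, g i a * X a) (l i j k : Fin 2) :
    3 * (T i j k * w l) - (w i * T l j k + w j * T i l k + w k * T i j l)
      + (g i j * ∑ m, X m * T m k l + g j k * ∑ m, X m * T m i l + g i k * ∑ m, X m * T m j l)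
      - (g l i * ∑ m, X m * T m j k + g l j * ∑ m, X m * T m i k
        + g l k * ∑ m, X m * T m i j) = 0 := by
  have r0 := htr 0
  have r1 := htr 1
  simp only [hw, Fin.sum_univ_two]
  have s1 : T 0 1 0 = T 0 0 1 := h2 _ _ _
  have s2 : T 1 0 0 = T 0 0 1 := by rw [h1, h2]
  have s3 : T 1 0 1 = T 0 1 1 := h1 _ _ _
  have s4 : T 1 1 0 = T 0 1 1 := by rw [h2, h1]
  have s5 := hg 1 0
  rw [s1, s4] at r0
  fin_cases l <;> fin_cases i <;> fin_cases j <;> fin_cases k <;>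
    simp only [Fin.zero_eta, Fin.mk_one, s1, s2, s3, s4, s5] <;> grind

/-- The rank-two analogue: in dimension two the product of a covector with a symmetric trace-free
tensor is determined by its totally symmetric trace-free part and one contraction. The left side is
the change of ∇Q under a conformal change. -/
lemma traceFree_identity_two {Q : Fin 2 → Fin 2 → ℝ} {w X : Fin 2 → ℝ}
    (hg : ∀ i j, g i j = g j i) (h1 : ∀ i j, Q i j = Q j i)
    (htr : g 1 1 * Q 0 0 - 2 * g 0 1 * Q 0 1 + g 0 0 * Q 1 1 = 0)
    (hw : ∀ i, w i = ∑ a, g i a * X a) (k i j : Fin 2) :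
    -2 * w k * Q i j - w i * Q k j - w j * Q i k
      + g k i * ∑ m, X m * Q m j + g k j * ∑ m, X m * Q i m =
    -(4 / 3) * (w i * Q j k + w j * Q i k + w k * Q i j)
      + 2 / 3 * (g i j * ∑ m, X m * Q m k + g j k * ∑ m, X m * Q m i
        + g i k * ∑ m, X m * Q m j) := by
  simp only [hw, Fin.sum_univ_two]
  have s1 := h1 1 0
  have s5 := hg 1 0
  fin_cases k <;> fin_cases i <;> fin_cases j <;>
    simp only [Fin.zero_eta, Fin.mk_one, s1, s5] <;> grind

/-- In dimension two, `Tᵢᵃᵇ Tⱼₐᵦ` is pure trace. -/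
lemma contraction_pureTrace_two {T : Fin 2 → Fin 2 → Fin 2 → ℝ}
    (hg : ∀ i j, g i j = g j i)
    (hgh : ∀ i j, ∑ a, h i a * g a j = if i = j then 1 else 0)
    (h1 : ∀ i j k, T i j k = T j i k) (h2 : ∀ i j k, T i j k = T i k j)
    (htr : ∀ k, g 1 1 * T 0 0 k - 2 * g 0 1 * T 0 1 k + g 0 0 * T 1 1 k = 0) (hg0 : g 0 0 ≠ 0) (i j : Fin 2) :
    ∑ a, ∑ b, (∑ c, ∑ d, h a c * h b d * T i c d) * T j a b =
      1 / 2 * (∑ p, ∑ q, h p q * ∑ a, ∑ b, (∑ c, ∑ d, h a c * h b d * T p c d) * T q a b) * g i j := by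
  obtain ⟨k1, k2, k3, k4⟩ := inverse_two hg hgh
  have hh : h 0 0 * g 0 0 + h 0 1 * g 0 1 = 1 := by
    simpa [Fin.sum_univ_two, hg 1 0] using hgh 0 0
  have hD : g 0 0 * g 1 1 - g 0 1 ^ 2 ≠ 0 := by
    intro h0
    rw [h0, mul_zero] at k1 k2 k4
    rw [← k4, neg_eq_zero.1 k2.symm] at hh
    simp at hh
  have s1 : T 0 1 0 = T 0 0 1 := h2 _ _ _
  have s2 : T 1 0 0 = T 0 0 1 := by rw [h1, h2]
  have s3 : T 1 0 1 = T 0 1 1 := h1 _ _ _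
  have s4 : T 1 1 0 = T 0 1 1 := by rw [h2, h1]
  have s5 := hg 1 0
  -- The two trace conditions leave only `T 0 0 0` and `T 0 0 1` free.
  have r0 : T 0 1 1 = (2 * g 0 1 * T 0 0 1 - g 1 1 * T 0 0 0) / g 0 0 := by
    have := htr 0
    rw [s1, s4] at this
    rw [eq_div_iff hg0]
    linear_combination this
  have r1 : T 1 1 1 = (2 * g 0 1 * T 0 1 1 - g 1 1 * T 0 0 1) / g 0 0 := by
    rw [eq_div_iff hg0]
    linear_combination htr 1
  rw [← eq_div_iff hD] at k1 k2 k3 k4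
  -- Trading `g 1 1` for the determinant leaves `g 0 0` and D as the only denominators, both known
  -- to be nonzero.
  have hc : g 1 1 = ((g 0 0 * g 1 1 - g 0 1 ^ 2) + g 0 1 ^ 2) / g 0 0 := by
    rw [eq_div_iff hg0]
    ring
  generalize g 0 0 * g 1 1 - g 0 1 ^ 2 = D at *
  simp only [Fin.sum_univ_two, k1, k2, k3, k4]
  fin_cases i <;> fin_cases j <;>
    simp only [Fin.zero_eta, Fin.mk_one, s1, s2, s3, s4, s5, r1, r0, hc] <;>
    field_simp <;> ring

end AlgebraInDimensionTwo

/-! ### Traces and divergences of symmetric trace-free tensors under conformal change. -/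

section ContractionsOfTraceFreeTensors

variable {n : ℕ} {U : Set (Model n)} {G G' : Fin n → Fin n → Model n → ℝ} {E w : Model n → ℝ}
  {S : Fin n → Fin n → Fin n → Model n → ℝ} {t : Model n → ℝ} {y : Model n}

lemma sum_gInv_mul_metric (hG : SmoothMetricOn G U) (hy : y ∈ U) :
    ∑ a, ∑ b, gInv G a b y * G a b y = n := by
  have : ∀ a, ∑ b, gInv G a b y * G a b y = 1 := fun a => by
    simpa [hG.symm a] using sum_gInv_mul hG hy a a
  simp [this]

lemma ConformalOn.laplacian_eq (h : ConformalOn G G' E w U) (hy : y ∈ U) (f : Model n → ℝ) :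
    laplacian G' f y = (E y)⁻¹ * (laplacian G f y + (n - 2) * gradInner G w f y) := by
  have e1 : ∀ a b, gInv G' a b y * hess G' f a b y = (E y)⁻¹ * (gInv G a b y * hess G f a b y
      - gInv G a b y * (pd a w y * pd b f y) - gInv G a b y * (pd a f y * pd b w y)
      + gradInner G w f y * (gInv G a b y * G a b y)) := by
    intro a b
    rw [h.gInv_eq hy, h.hess_eq hy]
    ring
  have e2 : ∀ f k : Model n → ℝ,
      ∑ a, ∑ b, gInv G a b y * (pd a f y * pd b k y) = gradInner G f k y := by
    intro f k
    rw [gradInner_eq_trace2 h.base]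
    rfl
  simp only [laplacian, e1, ← Finset.mul_sum, Finset.sum_add_distrib, Finset.sum_sub_distrib,
    e2, sum_gInv_mul_metric h.base hy, gradInner_symm h.base f w]
  ring

lemma contrS_symm (hS : SymmTraceFreeOn G S U) (f : Model n → ℝ) (i j : Fin n) (y : Model n) :
    contrS G S f i j y = contrS G S f j i y :=
  Finset.sum_congr rfl fun a _ => by rw [hS.symm_left i j a]

lemma trace_contrS (hS : SymmTraceFreeOn G S U) (hy : y ∈ U) (f : Model n → ℝ) :
    ∑ a, ∑ b, gInv G a b y * contrS G S f a b y = 0 := by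
  simp only [contrS, Finset.mul_sum]
  rw [Finset.sum_congr rfl fun a _ => Finset.sum_comm, Finset.sum_comm]
  simp only [← mul_assoc, ← Finset.sum_mul, hS.trace y hy, zero_mul, Finset.sum_const_zero]

lemma xi_symm (hS : SymmTraceFreeOn G S U) (i j : Fin n) (y : Model n) :
    xi G S t i j y = xi G S t j i y := by
  simp only [xi, contrS_symm hS t i j y, nabla3_symm_right hS _ _ i j y]

/-- The three correction terms have traces nV, V and V, which is why the projector divides by n + 2.
-/
lemma trace_proj3 {g h : Fin n → Fin n → ℝ} (hg : ∀ i j, g i j = g j i)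
    (hh : ∀ i j, h i j = h j i) (hgh : ∀ i j, ∑ a, h i a * g a j = if i = j then 1 else 0)
    (T : Fin n → Fin n → Fin n → ℝ) (k : Fin n) :
    ∑ a, ∑ b, h a b * proj3 g h T a b k = 0 := by
  set V := trace12 h (sym3 T) with hV
  have e1 : ∀ a, ∑ b, h a b * (g b k * V a) = V a * if a = k then 1 else 0 := by
    intro a
    rw [← hgh, Finset.mul_sum]
    exact Finset.sum_congr rfl fun b _ => by ring
  have e2 : ∀ b, ∑ a, h a b * (g a k * V b) = V b * if b = k then 1 else 0 := by
    intro b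
    rw [← hgh, Finset.mul_sum]
    exact Finset.sum_congr rfl fun a _ => by rw [hh a b]; ring
  have e3 : ∑ a, ∑ b, h a b * g a b = n := by
    have : ∀ a, ∑ b, h a b * g a b = 1 := fun a => by simpa [hg a] using hgh a a
    simp [this]
  have e4 : ∀ a b, h a b * proj3 g h T a b k = h a b * sym3 T a b k
      - 1 / ((n : ℝ) + 2) * (V k * (h a b * g a b) + h a b * (g b k * V a)
        + h a b * (g a k * V b)) := by
    intro a b
    rw [proj3, ← hV]
    ring
  simp only [e4, Finset.sum_sub_distrib, ← Finset.mul_sum, Finset.sum_add_distrib, e1, e3]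
  rw [Finset.sum_comm (f := fun a b => h a b * (g a k * V b))]
  simp only [e2, mul_ite, mul_one, mul_zero, Finset.sum_ite_eq', Finset.mem_univ, if_true]
  rw [← trace12, ← hV]
  have : (n : ℝ) + 2 ≠ 0 := by positivity
  field_simp
  ring

/-- By total symmetry the trace of Ξ can be taken inside ∇S. The trace condition on ∇S is supplied
later by the structural equation, whose right side is a projection. -/
lemma trace_xi (hS : SymmTraceFreeOn G S U) (hy : y ∈ U)
    (hN : ∀ l k, ∑ a, ∑ b, gInv G a b y * nabla3 G S l a b k y = 0) :
    ∑ a, ∑ b, gInv G a b y * xi G S t a b y = 0 := by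
  have e : ∀ i j, gInv G i j y * xi G S t i j y =
      ∑ a, ∑ b, gInv G a b y * (gInv G i j y * nabla3 G S b i j a y)
      + 2 / 3 * (gInv G i j y * contrS G S t i j y) := by
    intro i j
    simp only [xi, mul_add, Finset.mul_sum]
    congr 1
    · refine Finset.sum_congr rfl fun a _ => Finset.sum_congr rfl fun b _ => ?_
      rw [nabla3_symm_left hS b a i j, nabla3_symm_right hS b i a j]
      ring
    · ring
  simp only [e, Finset.sum_add_distrib, ← Finset.mul_sum, trace_contrS hS hy, mul_zero, add_zero]
  have e2 : ∑ i, ∑ j, ∑ a, ∑ b, gInv G a b y * (gInv G i j y * nabla3 G S b i j a y) =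
      ∑ a, ∑ b, gInv G a b y * ∑ i, ∑ j, gInv G i j y * nabla3 G S b i j a y := by
    simp only [Finset.mul_sum]
    rw [Finset.sum_congr rfl fun i _ => Finset.sum_comm, Finset.sum_comm]
    refine Finset.sum_congr rfl fun a _ => ?_
    rw [Finset.sum_congr rfl fun i _ => Finset.sum_comm, Finset.sum_comm]
  rw [e2]
  simp only [hN, mul_zero, Finset.sum_const_zero]

/-- The conformal change of the divergence of `S`. -/
lemma ConformalOn.div_nabla3_eq (h : ConformalOn G G' E w U) (hS : SymmTraceFreeOn G S U)
    (hy : y ∈ U) (i j : Fin n) :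
    ∑ a, ∑ b, gInv G' a b y * nabla3 G' (fun a b c z => E z * S a b c z) b a i j y =
      ∑ a, ∑ b, gInv G a b y * nabla3 G S b a i j y + n * contrS G S w i j y := by
  have hE := h.factor_ne y
  have hX : ∀ i j : Fin n, ∑ m, gradUp G w m y * S m i j y = contrS G S w i j y := fun i j =>
    (contrS_eq_sum hS w i j).symm
  have hX2 : ∀ a i j : Fin n, ∑ m, gradUp G w m y * S a m j y = contrS G S w a j y := by
    intro a i j
    rw [← hX]
    exact Finset.sum_congr rfl fun m _ => by rw [hS.symm_left]
  have hX3 : ∀ a i : Fin n, ∑ m, gradUp G w m y * S a i m y = contrS G S w a i y := fun a i =>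
    Finset.sum_congr rfl fun m _ => mul_comm _ _
  have e : ∀ a b, gInv G' a b y * nabla3 G' (fun a b c z => E z * S a b c z) b a i j y =
      gInv G a b y * nabla3 G S b a i j y
      - gInv G a b y * (pd b w y * S a i j y) - gInv G a b y * (pd a w y * S b i j y)
      - pd i w y * (gInv G a b y * S a b j y) - pd j w y * (gInv G a b y * S a b i y)
      + contrS G S w i j y * (gInv G a b y * G a b y)
      + gInv G a b y * (G b i y * contrS G S w a j y)
      + gInv G a b y * (G b j y * contrS G S w a i y) := by
    intro a b
    rw [h.gInv_eq hy, h.nabla3_eq hy S fun a b c =>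
      differentiableAt_of_contDiffOn h.base.isOpen (hS.smooth a b c) hy, hX, hX2 _ i, hX3,
      h.base.symm b a, hS.symm_right a i b]
    field_simp
  have f1 : ∀ P : Fin n → ℝ, ∑ a, ∑ b, gInv G a b y * (pd b w y * P a) =
      ∑ a, gradUp G w a y * P a := by
    intro P
    simp only [gradUp, Finset.sum_mul, mul_assoc]
  have f2 : ∀ P : Fin n → ℝ, ∑ a, ∑ b, gInv G a b y * (pd a w y * P b) =
      ∑ a, gradUp G w a y * P a := by
    intro P
    rw [← f1, Finset.sum_comm]
    exact Finset.sum_congr rfl fun a _ => Finset.sum_congr rfl fun b _ => by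
      rw [gInv_symm h.base]
  have f3 : ∀ (P : Fin n → ℝ) (i : Fin n), ∑ a, ∑ b, gInv G a b y * (G b i y * P a) = P i := by
    intro P i
    simp only [← mul_assoc, ← Finset.sum_mul, sum_gInv_mul h.base hy]
    simp
  simp only [e, Finset.sum_add_distrib, Finset.sum_sub_distrib, ← Finset.mul_sum, f1, f2,
    f3 (fun a => contrS G S w a j y) i, f3 (fun a => contrS G S w a i y) j, hX, hS.trace y hy,
    sum_gInv_mul_metric h.base hy]
  rw [contrS_symm hS w j i]
  ring

/-- In dimension two the divergence of symmetric trace-free tensors is conformally covariant. -/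
lemma ConformalOn.divergence_eq (h : ConformalOn G G' E w U) (hy : y ∈ U)
    {Q : Fin n → Fin n → Model n → ℝ} (hQ : ∀ i j, Q i j y = Q j i y)
    (htr : ∑ a, ∑ b, gInv G a b y * Q a b y = 0) (k : Fin n) :
    divergence G' Q k y =
      (E y)⁻¹ * (divergence G Q k y + (n - 2) * ∑ m, gradUp G w m y * Q m k y) := by
  have hs : ∀ a : Fin n, ∑ m, gradUp G w m y * Q a m y = ∑ m, gradUp G w m y * Q m a y := fun a =>
    Finset.sum_congr rfl fun m _ => by rw [hQ]
  have e : ∀ a b, gInv G' a b y * nabla2 G' Q b a k y = (E y)⁻¹ * (gInv G a b y * nabla2 G Q b a k y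
      - 2 * (gInv G a b y * (pd b w y * Q a k y)) - gInv G a b y * (pd a w y * Q b k y)
      - pd k w y * (gInv G a b y * Q a b y)
      + (∑ m, gradUp G w m y * Q m k y) * (gInv G a b y * G a b y)
      + gInv G a b y * (G b k y * ∑ m, gradUp G w m y * Q m a y)) := by
    intro a b
    rw [h.gInv_eq hy, h.nabla2_eq hy, hs, h.base.symm b a]
    ring
  have f1 : ∀ P : Fin n → ℝ, ∑ a, ∑ b, gInv G a b y * (pd b w y * P a) =
      ∑ a, gradUp G w a y * P a := by
    intro P
    simp only [gradUp, Finset.sum_mul, mul_assoc]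
  have f2 : ∀ P : Fin n → ℝ, ∑ a, ∑ b, gInv G a b y * (pd a w y * P b) =
      ∑ a, gradUp G w a y * P a := by
    intro P
    rw [← f1, Finset.sum_comm]
    exact Finset.sum_congr rfl fun a _ => Finset.sum_congr rfl fun b _ => by
      rw [gInv_symm h.base]
  have f3 : ∀ (P : Fin n → ℝ) (i : Fin n), ∑ a, ∑ b, gInv G a b y * (G b i y * P a) = P i := by
    intro P i
    simp only [← mul_assoc, ← Finset.sum_mul, sum_gInv_mul h.base hy]
    simp
  simp only [divergence, e, Finset.sum_add_distrib, Finset.sum_sub_distrib, ← Finset.mul_sum, f1,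
    f2, f3 (fun a => ∑ m, gradUp G w m y * Q m a y) k, htr, sum_gInv_mul_metric h.base hy]
  ring

lemma contrSQ_congr {P Q : Fin n → Fin n → Model n → ℝ} (hPQ : ∀ i j, P i j y = Q i j y)
    (k : Fin n) : contrSQ G S P k y = contrSQ G S Q k y := by
  simp only [contrSQ, up2, hPQ]

lemma contrSQ_add (P Q : Fin n → Fin n → Model n → ℝ) (k : Fin n) :
    contrSQ G S (fun i j z => P i j z + Q i j z) k y = contrSQ G S P k y + contrSQ G S Q k y := by
  simp only [contrSQ, up2, mul_add, Finset.sum_add_distrib]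

lemma contrSQ_mul (c : Model n → ℝ) (Q : Fin n → Fin n → Model n → ℝ) (k : Fin n) :
    contrSQ G S (fun i j z => c z * Q i j z) k y = c y * contrSQ G S Q k y := by
  simp only [contrSQ, up2_mul, Finset.mul_sum, mul_left_comm _ (c y)]

lemma contrSQ_metric (hG : SmoothMetricOn G U) (hS : SymmTraceFreeOn G S U) (hy : y ∈ U)
    (k : Fin n) : contrSQ G S G k y = 0 := by
  have e : ∀ a b, up2 G G a b y = gInv G a b y := by
    intro a b
    have : ∀ c, ∑ d, gInv G a c y * gInv G b d y * G c d y =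
        gInv G a c y * if b = c then 1 else 0 := by
      intro c
      rw [← sum_gInv_mul hG hy, Finset.mul_sum]
      exact Finset.sum_congr rfl fun d _ => by rw [hG.symm c d]; ring
    simp [up2, this]
  rw [← hS.trace y hy k, contrSQ]
  refine Finset.sum_congr rfl fun a _ => Finset.sum_congr rfl fun b _ => ?_
  rw [e, hS.symm_left k a b, hS.symm_right a k b, mul_comm]

lemma contrSQ_pd_mul_pd (f h : Model n → ℝ) (k : Fin n) :
    contrSQ G S (fun i j z => pd i f z * pd j h z) k y =
      ∑ a, contrS G S h k a y * gradUp G f a y := by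
  have e : ∀ a b, up2 G (fun i j z => pd i f z * pd j h z) a b y =
      gradUp G f a y * gradUp G h b y := by
    intro a b
    simp only [up2, gradUp, Finset.sum_mul_sum]
    exact Finset.sum_congr rfl fun c _ => Finset.sum_congr rfl fun d _ => by ring
  simp only [contrSQ, e, contrS, Finset.sum_mul]
  exact Finset.sum_congr rfl fun c _ => Finset.sum_congr rfl fun d _ => by ring

lemma sum_contrS_mul_comm (hS : SymmTraceFreeOn G S U) (f h : Model n → ℝ) (k : Fin n) :
    ∑ a, contrS G S h k a y * gradUp G f a y = ∑ a, contrS G S f k a y * gradUp G h a y := by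
  simp only [contrS, Finset.sum_mul]
  rw [Finset.sum_comm]
  refine Finset.sum_congr rfl fun c _ => Finset.sum_congr rfl fun d _ => ?_
  rw [hS.symm_right]
  ring

lemma contrSQ_contrS (hS : SymmTraceFreeOn G S U) (f : Model n → ℝ) (k : Fin n) :
    contrSQ G S (contrS G S f) k y = ∑ m, gradUp G f m y * contrSS2 G S m k y := by
  have e : ∀ a b, up2 G (contrS G S f) a b y = ∑ m, gradUp G f m y * up2 G (S m) a b y := by
    intro a b
    simp only [up2, contrS_eq_sum hS, Finset.mul_sum]
    rw [Finset.sum_congr rfl fun c _ => Finset.sum_comm, Finset.sum_comm]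
    exact Finset.sum_congr rfl fun m _ => Finset.sum_congr rfl fun c _ =>
      Finset.sum_congr rfl fun d _ => by ring
  simp only [contrSQ, contrSS2, e, Finset.mul_sum]
  rw [Finset.sum_congr rfl fun c _ => Finset.sum_comm, Finset.sum_comm]
  exact Finset.sum_congr rfl fun m _ => Finset.sum_congr rfl fun c _ =>
    Finset.sum_congr rfl fun d _ => by ring

end ContractionsOfTraceFreeTensors

/-! ### Curvature and quadratic contractions in dimension two. -/

section DimensionTwo

variable {U : Set (Model 2)} {G G' : Fin 2 → Fin 2 → Model 2 → ℝ} {E w : Model 2 → ℝ}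
  {S : Fin 2 → Fin 2 → Fin 2 → Model 2 → ℝ} {t : Model 2 → ℝ} {y : Model 2}

/-- A surface has one independent curvature component: the curvature is skew in its form indices
and, relative to the metric, in its endomorphism indices. -/
lemma ricci_two (hG : SmoothMetricOn G U) (hy : y ∈ U) (i j : Fin 2) :
    ricci G i j y = 1 / 2 * scal G y * G i j y := by
  have k00 := sum_curvature_mul_gInv hG hy 0 0 0 1
  have k01 := sum_curvature_mul_gInv hG hy 0 1 0 1
  have k11 := sum_curvature_mul_gInv hG hy 1 1 0 1
  have c10 : ∀ l k, curvature G l k 1 0 y = -curvature G l k 0 1 y := fun l k =>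
    curvature_antisymm l k 1 0 y
  have c00 : ∀ l k i, curvature G l k i i y = 0 := fun l k i => by
    have := curvature_antisymm (G := G) l k i i y
    linarith
  have i0 := fun j => sum_gInv_mul hG hy 0 j
  have i1 := fun j => sum_gInv_mul hG hy 1 j
  have g10 := hG.symm 1 0 y
  have h10 := gInv_symm hG 1 0 y
  have i00 := i0 0
  have i01 := i0 1
  have i10 := i1 0
  have i11 := i1 1
  simp only [Fin.sum_univ_two, if_true, zero_ne_one, one_ne_zero, if_false, g10, h10]
    at k00 k01 k11 i00 i01 i10 i11
  simp only [scal, ricci, Fin.sum_univ_two, c10, c00, h10]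
  fin_cases i <;> fin_cases j <;>
    simp only [Fin.zero_eta, Fin.mk_one, g10, c10, c00] <;> grind

lemma contrSS2_two (hG : SmoothMetricOn G U) (hS : SymmTraceFreeOn G S U) (hy : y ∈ U)
    (h0 : G 0 0 y ≠ 0) (i j : Fin 2) :
    contrSS2 G S i j y = 1 / 2 * normSqS G S y * G i j y :=
  contraction_pureTrace_two (g := fun a b => G a b y) (h := fun a b => gInv G a b y)
    (T := fun a b c => S a b c y) (fun i j => hG.symm i j y) (sum_gInv_mul hG hy)
    (fun i j k => hS.symm_left i j k y) (fun i j k => hS.symm_right i j k y)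
    (fun k => traceFree_two (F := fun a b => S a b k y) (fun i j => hG.symm i j y)
      (sum_gInv_mul hG hy) (fun i j => hS.symm_left i j k y) (hS.trace y hy k)) h0 i j

/-- The conformal variation of the right-hand side of the equation for `∇S`, `n = 2`. -/
lemma proj3_conformal_variation_two {g h : Fin 2 → Fin 2 → ℝ} {T : Fin 2 → Fin 2 → Fin 2 → ℝ}
    {w X : Fin 2 → ℝ} (hg : ∀ i j, g i j = g j i) (hh : ∀ i j, h i j = h j i)
    (hgh : ∀ i j, ∑ a, h i a * g a j = if i = j then 1 else 0)
    (hX : ∀ i, X i = ∑ a, h i a * w a) (hw : ∀ i, w i = ∑ a, g i a * X a)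
    (h1 : ∀ i j k, T i j k = T j i k) (h2 : ∀ i j k, T i j k = T i k j)
    (htr : ∀ k, ∑ a, ∑ b, h a b * T a b k = 0) (l i j k : Fin 2) :
    proj3 g h (fun i j k => 2 * (T i j k * w l) - 6 * (w i * T j k l)) i j k =
    -(w l * T i j k) - (w i * T l j k + w j * T i l k + w k * T i j l)
      + (g l i * ∑ m, X m * T m j k + g l j * ∑ m, X m * T i m k
        + g l k * ∑ m, X m * T i j m) := by
  set V : Fin 2 → Fin 2 → ℝ := fun j k => ∑ m, X m * T m j k with hV
  have hV1 : ∀ i k, ∑ m, X m * T i m k = V i k := fun i k =>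
    Finset.sum_congr rfl fun m _ => by rw [h1 i m k]
  have hV2 : ∀ i j, ∑ m, X m * T i j m = V i j := fun i j =>
    Finset.sum_congr rfl fun m _ => by rw [h2 i j m, h1 i m j]
  have hVd : ∀ j k, ∑ m, X m * T m j k = V j k := fun _ _ => rfl
  have e := traceFree_identity_three hg h1 h2
    (fun k => traceFree_two hg hgh (fun i j => h1 i j k) (htr k)) hw l i j k
  simp only [hVd] at e
  have es : ∀ i j k, sym3 (fun i j k => 2 * (T i j k * w l) - 6 * (w i * T j k l)) i j k =
      2 * w l * T i j k - 2 * (w i * T j k l + w j * T i k l + w k * T i j l) := by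
    intro i j k
    simp only [sym3]
    have p1 : T i k j = T i j k := h2 _ _ _
    have p2 : T j k i = T i j k := by rw [h2 j k i, h1 j i k]
    have p3 : T k i j = T i j k := by rw [h1 k i j, p1]
    have p4 : T k j i = T i j k := by rw [h1 k j i, p2]
    rw [p1, p2, p3, p4, h1 j i k, h1 k j l, h1 k i l, h1 j i l]
    ring
  have t1 : ∀ k, ∑ a, ∑ b, h a b * (w a * T b k l) = V k l := by
    intro k
    rw [← hVd, Finset.sum_comm]
    refine Finset.sum_congr rfl fun b _ => ?_
    rw [hX, Finset.sum_mul]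
    exact Finset.sum_congr rfl fun a _ => by rw [hh a b]; ring
  have t2 : ∀ k, ∑ a, ∑ b, h a b * (w b * T a k l) = V k l := by
    intro k
    rw [← hVd]
    refine Finset.sum_congr rfl fun a _ => ?_
    rw [hX, Finset.sum_mul]
    exact Finset.sum_congr rfl fun b _ => by ring
  -- With n + 2 = 4 the correction adds exactly the terms g·V. What then separates the two sides is
  -- `traceFree_identity_three`.
  have et : ∀ k, trace12 h (sym3 fun i j k => 2 * (T i j k * w l) - 6 * (w i * T j k l)) k =
      -4 * V k l := by
    intro k
    have : ∀ a b, h a b * (2 * w l * T a b k - 2 * (w a * T b k l + w b * T a k l + w k * T a b l)) =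
        2 * w l * (h a b * T a b k) - 2 * (h a b * (w a * T b k l))
        - 2 * (h a b * (w b * T a k l)) - 2 * w k * (h a b * T a b l) := fun a b => by ring
    simp only [trace12, es, this, Finset.sum_sub_distrib, ← Finset.mul_sum, htr, t1, t2]
    ring
  simp only [proj3, es, et, hV1, hV2]
  have p1 : T j k l = T l j k := by rw [h2 j k l, h1 j l k]
  rw [p1, h2 i k l]
  push_cast
  linear_combination e

end DimensionTwo

/-! ### The equations for ∇S, ∇Ξ and the Hessian when n = 2. -/

section StructuralEquationsInDimensionTwo

variable {U : Set (Model 2)} {G G' : Fin 2 → Fin 2 → Model 2 → ℝ} {E w : Model 2 → ℝ}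
  {S : Fin 2 → Fin 2 → Fin 2 → Model 2 → ℝ} {t : Model 2 → ℝ} {y : Model 2}

/-- The divergence of S gains n·S(grad w), while (2/3)S(grad t) loses 2·S(grad w); these cancel
precisely for n = 2. -/
lemma ConformalOn.xi_eq (h : ConformalOn G G' E w U) (hS : SymmTraceFreeOn G S U)
    (ht : ContDiffOn ℝ ∞ t U) (hy : y ∈ U) (i j : Fin 2) :
    xi G' (fun a b c z => E z * S a b c z) (fun z => t z - 3 * w z) i j y = xi G S t i j y := by
  rw [xi, xi, h.div_nabla3_eq hS hy, h.contrS_eq hy,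
    contrS_sub_smul (pd_sub_smul h.base.isOpen hy ht h.exponent_smooth)]
  push_cast
  ring

lemma ConformalOn.beta_eq (h : ConformalOn G G' E w U) (hS : SymmTraceFreeOn G S U)
    (ht : ContDiffOn ℝ ∞ t U) (hy : y ∈ U) (k : Fin 2) :
    beta G' (fun a b c z => E z * S a b c z) (fun z => t z - 3 * w z) k y =
      (E y)⁻¹ * beta G S t k y := by
  have hE := h.factor_ne y
  have e : ∀ a b, up2 G' (xi G' (fun a b c z => E z * S a b c z) (fun z => t z - 3 * w z)) a b y =
      (E y)⁻¹ * (E y)⁻¹ * up2 G (xi G S t) a b y := by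
    intro a b
    rw [h.up2_eq hy]
    simp only [up2, h.xi_eq hS ht hy]
  simp only [beta, e, Finset.mul_sum]
  exact Finset.sum_congr rfl fun a _ => Finset.sum_congr rfl fun b _ => by field_simp

lemma ConformalOn.nabla_S_two (h : ConformalOn G G' E w U) (hS : SymmTraceFreeOn G S U)
    (ht : ContDiffOn ℝ ∞ t U) (hy : y ∈ U) (H : StructEqTwo G S t y) (l i j k : Fin 2) :
    nabla3 G' (fun a b c z => E z * S a b c z) l i j k y =
      proj3 (fun a b => G' a b y) (fun a b => gInv G' a b y)
        (fun i j k => -(2 / 3) * (E y * S i j k y) * pd l (fun z => t z - 3 * w z) y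
          + 2 * pd i (fun z => t z - 3 * w z) y * (E y * S j k l y)
          + xi G' (fun a b c z => E z * S a b c z) (fun z => t z - 3 * w z) i j y * G' k l y)
        i j k := by
  have hU := h.base.isOpen
  have hE := h.factor_ne y
  have hp := pd_sub_smul hU hy ht h.exponent_smooth
  rw [h.nabla3_eq hy S fun a b c => differentiableAt_of_contDiffOn hU (hS.smooth a b c) hy,
    H.nabla_S]
  simp only [h.xi_eq hS ht hy, h.gInv_eq hy, h.eq, proj3_conformal hE, hp]
  have e := proj3_conformal_variation_two (g := fun a b => G a b y)
    (h := fun a b => gInv G a b y)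
    (T := fun a b c => S a b c y) (w := fun a => pd a w y) (X := fun a => gradUp G w a y)
    (fun i j => h.base.symm i j y) (fun i j => gInv_symm h.base i j y)
    (sum_gInv_mul h.base hy) (fun i => rfl) (fun i => (sum_mul_gradUp h.base hy w i).symm)
    (fun i j k => hS.symm_left i j k y)
    (fun i j k => hS.symm_right i j k y) (hS.trace y hy) l i j k
  -- The remainder has coefficients 2 = (−2/3)(−3) and −6 = 2(−3), the form treated by
  -- `proj3_conformal_variation_two`.
  have e2 : (fun i j k : Fin 2 => -(2 / 3) * (E y * S i j k y) * (pd l t y - 3 * pd l w y)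
      + 2 * (pd i t y - 3 * pd i w y) * (E y * S j k l y) + xi G S t i j y * (E y * G k l y)) =
      fun i j k => E y * ((-(2 / 3) * S i j k y * pd l t y + 2 * pd i t y * S j k l y
        + xi G S t i j y * G k l y)
        + (2 * (S i j k y * pd l w y) - 6 * (pd i w y * S j k l y))) := by
    funext i j k
    ring
  have e3 := proj3_add (g := fun a b => G a b y) (h := fun a b => gInv G a b y)
    (fun i j k => -(2 / 3) * S i j k y * pd l t y + 2 * pd i t y * S j k l y
      + xi G S t i j y * G k l y)
    (fun i j k => 2 * (S i j k y * pd l w y) - 6 * (pd i w y * S j k l y)) i j k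
  rw [e2, proj3_smul, e3, e]
  ring

lemma trace_xi_of_structEqTwo (hG : SmoothMetricOn G U) (hS : SymmTraceFreeOn G S U) (hy : y ∈ U)
    (H : StructEqTwo G S t y) : ∑ a, ∑ b, gInv G a b y * xi G S t a b y = 0 := by
  refine trace_xi hS hy fun l k => ?_
  simp only [H.nabla_S]
  exact trace_proj3 (fun i j => hG.symm i j y) (fun i j => gInv_symm hG i j y)
    (sum_gInv_mul hG hy) _ k

lemma ConformalOn.nabla_xi_two (h : ConformalOn G G' E w U) (hS : SymmTraceFreeOn G S U)
    (ht : ContDiffOn ℝ ∞ t U) (hy : y ∈ U) (H : StructEqTwo G S t y) (k i j : Fin 2) :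
    nabla2 G' (xi G' (fun a b c z => E z * S a b c z) (fun z => t z - 3 * w z)) k i j y =
    1 / 3 * (E y * S i j k y) * normSqS G' (fun a b c z => E z * S a b c z) y
    + 4 / 3 * proj3 (fun a b => G' a b y) (fun a b => gInv G' a b y)
      (fun i j k => xi G' (fun a b c z => E z * S a b c z) (fun z => t z - 3 * w z) j k y
        * pd i (fun z => t z - 3 * w z) y) i j k
    + 4 / 3 * proj2 (fun a b => G' a b y) (fun a b => gInv G' a b y)
      (fun i j => G' j k y *
        beta G' (fun a b c z => E z * S a b c z) (fun z => t z - 3 * w z) i y) i j := by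
  have hU := h.base.isOpen
  have hE := h.factor_ne y
  have hp := pd_sub_smul hU hy ht h.exponent_smooth
  -- Ξ is invariant on the whole open set, so its derivative changes only through the connection.
  rw [nabla2_congr hU hy (fun i j z hz => h.xi_eq hS ht hz i j), h.nabla2_eq hy, H.nabla_xi]
  simp only [h.xi_eq hS ht hy, h.normSqS_eq hy, h.beta_eq hS ht hy, h.gInv_eq hy, h.eq,
    proj3_conformal hE, proj2_conformal hE, hp]
  have e1 : (fun i j : Fin 2 => E y * G j k y * ((E y)⁻¹ * beta G S t i y)) =
      fun i j => G j k y * beta G S t i y := by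
    funext i j
    field_simp
  have e2 : (fun i j k : Fin 2 => xi G S t j k y * (pd i t y - 3 * pd i w y)) =
      fun i j k => xi G S t j k y * pd i t y + (-3) * (pd i w y * xi G S t j k y) := by
    funext i j k
    ring
  have e3 := proj3_add (g := fun a b => G a b y) (h := fun a b => gInv G a b y)
    (fun i j k => xi G S t j k y * pd i t y)
    (fun i j k => (-3) * (pd i w y * xi G S t j k y)) i j k
  have xs := fun i j => xi_symm (G := G) (t := t) hS i j y
  have xt := trace_xi_of_structEqTwo h.base hS hy H
  -- The change of ∇Ξ must equal (4/3)(−3) times the projection of dw⊗Ξ, computed in `e5`; this is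
  -- the identity with coefficients −4/3 and 2/3.
  have e4 := traceFree_identity_two (g := fun a b => G a b y) (Q := fun a b => xi G S t a b y)
    (w := fun a => pd a w y) (X := fun a => gradUp G w a y) (fun i j => h.base.symm i j y) xs
    (traceFree_two (fun i j => h.base.symm i j y) (sum_gInv_mul h.base hy) xs xt)
    (fun i => (sum_mul_gradUp h.base hy w i).symm) k i j
  have e5 : proj3 (fun a b => G a b y) (fun a b => gInv G a b y)
      (fun i j k => pd i w y * xi G S t j k y) i j k =
      1 / 3 * (pd i w y * xi G S t j k y + pd j w y * xi G S t i k y + pd k w y * xi G S t i j y)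
      - 1 / 6 * (G i j y * ∑ m, gradUp G w m y * xi G S t m k y
        + G j k y * ∑ m, gradUp G w m y * xi G S t m i y
        + G i k y * ∑ m, gradUp G w m y * xi G S t m j y) := by
    have es : ∀ i j k : Fin 2, sym3 (fun i j k => pd i w y * xi G S t j k y) i j k =
        1 / 3 * (pd i w y * xi G S t j k y + pd j w y * xi G S t i k y
          + pd k w y * xi G S t i j y) := by
      intro i j k
      simp only [sym3]
      rw [xs k j, xs k i, xs j i]
      ring
    have f1 : ∀ k, ∑ a, ∑ b, gInv G a b y * (pd b w y * xi G S t a k y) =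
        ∑ m, gradUp G w m y * xi G S t m k y := by
      intro k
      simp only [gradUp, Finset.sum_mul, mul_assoc]
    have f2 : ∀ k, ∑ a, ∑ b, gInv G a b y * (pd a w y * xi G S t b k y) =
        ∑ m, gradUp G w m y * xi G S t m k y := by
      intro k
      rw [← f1, Finset.sum_comm]
      exact Finset.sum_congr rfl fun a _ => Finset.sum_congr rfl fun b _ => by
        rw [gInv_symm h.base]
    have et : ∀ k, trace12 (fun a b => gInv G a b y)
        (sym3 fun i j k => pd i w y * xi G S t j k y) k =
        2 / 3 * ∑ m, gradUp G w m y * xi G S t m k y := by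
      intro k
      have : ∀ a b, gInv G a b y * (1 / 3 * (pd a w y * xi G S t b k y + pd b w y * xi G S t a k y
          + pd k w y * xi G S t a b y)) =
          1 / 3 * (gInv G a b y * (pd a w y * xi G S t b k y))
          + 1 / 3 * (gInv G a b y * (pd b w y * xi G S t a k y))
          + 1 / 3 * pd k w y * (gInv G a b y * xi G S t a b y) := fun a b => by ring
      simp only [trace12, es, this, Finset.sum_add_distrib, ← Finset.mul_sum, f1, f2, xt]
      ring
    simp only [proj3, es, et]
    push_cast
    ring
  rw [e1, e2, e3, proj3_smul, e5]
  have hE1 : 1 / 3 * (E y * S i j k y) * ((E y)⁻¹ * normSqS G S y) =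
      1 / 3 * S i j k y * normSqS G S y := by
    field_simp
  rw [hE1]
  linear_combination e4

/-- Substituting the definition of τ makes the trace-free part of the Hessian equation a tautology,
so only its trace has content. -/
lemma hess_two_iff (hG : SmoothMetricOn G U) (hy : y ∈ U) :
    (∀ i j, hess G t i j y =
      3 / 2 * (tau G S t i j y + 2 / 3 * contrS G S t i j y
        + 8 / 9 * proj2 (fun a b => G a b y) (fun a b => gInv G a b y)
            (fun i j => pd i t y * pd j t y) i j
        - 1 / 3 * xi G S t i j y)
      + 1 / 2 * G i j y * (1 / 3 * normSqS G S y + 3 / 2 * scal G y)) ↔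
    laplacian G t y = 1 / 3 * normSqS G S y + 3 / 2 * scal G y := by
  have e : gradSq G t y = ∑ a, ∑ b, gInv G a b y * (pd a t y * pd b t y) :=
    congrFun (gradInner_eq_trace2 hG t t) y
  have ep : ∀ i j : Fin 2, proj2 (fun a b => G a b y) (fun a b => gInv G a b y)
      (fun i j => pd i t y * pd j t y) i j =
      pd i t y * pd j t y - 1 / 2 * G i j y * gradSq G t y := by
    intro i j
    have : ∀ a b : Fin 2, (pd a t y * pd b t y + pd b t y * pd a t y) / 2 =
      pd a t y * pd b t y := fun a b => by ring
    simp only [proj2, this, ← e]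
    push_cast
    ring
  have key : ∀ i j, 3 / 2 * (tau G S t i j y + 2 / 3 * contrS G S t i j y
        + 8 / 9 * proj2 (fun a b => G a b y) (fun a b => gInv G a b y)
            (fun i j => pd i t y * pd j t y) i j
        - 1 / 3 * xi G S t i j y)
      + 1 / 2 * G i j y * (1 / 3 * normSqS G S y + 3 / 2 * scal G y) =
      hess G t i j y + 1 / 2 * G i j y * (1 / 3 * normSqS G S y + 3 / 2 * scal G y
        - laplacian G t y) := by
    intro i j
    rw [ep, tau]
    push_cast
    ring
  simp only [key]
  constructor
  · intro H
    have h0 : ∀ i j, G i j y * (1 / 3 * normSqS G S y + 3 / 2 * scal G y - laplacian G t y) = 0 :=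
      fun i j => by linarith [H i j]
    have h1 := sum_gInv_mul_metric hG hy
    have h2 : (∑ a, ∑ b, gInv G a b y * G a b y)
        * (1 / 3 * normSqS G S y + 3 / 2 * scal G y - laplacian G t y) = 0 := by
      simp only [Finset.sum_mul, mul_assoc, h0, mul_zero, Finset.sum_const_zero]
    rw [h1] at h2
    push_cast at h2
    linarith
  · intro H i j
    rw [H]
    ring

end StructuralEquationsInDimensionTwo

/-! ### Smoothness, symmetry and trace of the derived tensors. -/

section Smoothness

variable {n : ℕ} {U : Set (Model n)} {G G' : Fin n → Fin n → Model n → ℝ} {E w : Model n → ℝ}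
  {S : Fin n → Fin n → Fin n → Model n → ℝ} {t : Model n → ℝ} {y : Model n}

lemma contDiffOn_scal (hG : SmoothMetricOn G U) : ContDiffOn ℝ ∞ (scal G) U := by
  have hc := fun a b c => contDiffOn_christoffel hG a b c
  have hd := fun a b c k => contDiffOn_pd hG.isOpen (hc a b c) k
  refine ContDiffOn.sum fun a _ => ContDiffOn.sum fun b _ => (contDiffOn_gInv hG a b).mul
    (ContDiffOn.sum fun c _ => ((hd _ _ _ _).sub (hd _ _ _ _)).add (ContDiffOn.sum fun m _ =>
      ((hc _ _ _).mul (hc _ _ _)).sub ((hc _ _ _).mul (hc _ _ _))))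

lemma contDiffOn_xi (hG : SmoothMetricOn G U) (hS : SymmTraceFreeOn G S U)
    (ht : ContDiffOn ℝ ∞ t U) (i j : Fin n) : ContDiffOn ℝ ∞ (xi G S t i j) U := by
  have hc := fun a b c => contDiffOn_christoffel hG a b c
  refine (ContDiffOn.sum fun a _ => ContDiffOn.sum fun b _ => (contDiffOn_gInv hG a b).mul
    ((contDiffOn_pd hG.isOpen (hS.smooth _ _ _) _).sub (ContDiffOn.sum fun m _ =>
      (((hc _ _ _).mul (hS.smooth _ _ _)).add ((hc _ _ _).mul (hS.smooth _ _ _))).add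
        ((hc _ _ _).mul (hS.smooth _ _ _))))).add
    (contDiffOn_const.mul (contDiffOn_contrS hG hS ht i j))

lemma contDiffOn_tau (hG : SmoothMetricOn G U) (hS : SymmTraceFreeOn G S U)
    (ht : ContDiffOn ℝ ∞ t U) (i j : Fin n) : ContDiffOn ℝ ∞ (tau G S t i j) U :=
  (((contDiffOn_const.mul ((contDiffOn_hess hG ht i j).sub
      ((contDiffOn_const.mul (contDiffOn_laplacian hG ht)).mul (hG.smooth i j)))).sub
    (contDiffOn_const.mul (contDiffOn_contrS hG hS ht i j))).add
    (contDiffOn_const.mul (contDiffOn_xi hG hS ht i j))).sub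
    (contDiffOn_const.mul (((contDiffOn_pd hG.isOpen ht i).mul (contDiffOn_pd hG.isOpen ht j)).sub
      ((contDiffOn_const.mul (contDiffOn_gradInner hG ht ht)).mul (hG.smooth i j))))

lemma tau_symm (hG : SmoothMetricOn G U) (hS : SymmTraceFreeOn G S U) (hy : y ∈ U)
    (ht : ContDiffOn ℝ ∞ t U) (i j : Fin n) : tau G S t i j y = tau G S t j i y := by
  rw [tau, tau, hess_symm hG hy ht, hG.symm i j, contrS_symm hS, xi_symm hS i j]
  ring

lemma trace_tau (hn : n ≠ 0) (hG : SmoothMetricOn G U) (hS : SymmTraceFreeOn G S U) (hy : y ∈ U)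
    (hxi : ∑ a, ∑ b, gInv G a b y * xi G S t a b y = 0) :
    ∑ a, ∑ b, gInv G a b y * tau G S t a b y = 0 := by
  have e1 : ∑ a, ∑ b, gInv G a b y * (pd a t y * pd b t y) = gradSq G t y :=
    (congrFun (gradInner_eq_trace2 hG t t) y).symm
  have e2 : ∑ a, ∑ b, gInv G a b y * hess G t a b y = laplacian G t y := rfl
  have e : ∀ a b, gInv G a b y * tau G S t a b y =
      2 / 3 * (gInv G a b y * hess G t a b y)
      - 2 / 3 * (1 / n) * laplacian G t y * (gInv G a b y * G a b y)
      - 2 / 3 * (gInv G a b y * contrS G S t a b y) + 1 / 3 * (gInv G a b y * xi G S t a b y)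
      - 8 / 9 * (gInv G a b y * (pd a t y * pd b t y))
      + 8 / 9 * (1 / n) * gradSq G t y * (gInv G a b y * G a b y) := by
    intro a b
    rw [tau]
    ring
  simp only [e, Finset.sum_add_distrib, Finset.sum_sub_distrib, ← Finset.mul_sum, e1, e2, hxi,
    trace_contrS hS hy, sum_gInv_mul_metric hG hy]
  have : (n : ℝ) ≠ 0 := by exact_mod_cast hn
  field_simp
  ring

lemma ConformalOn.symmTraceFreeOn (h : ConformalOn G G' E w U) (hS : SymmTraceFreeOn G S U) :
    SymmTraceFreeOn G' (fun a b c z => E z * S a b c z) U where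
  smooth i j k := h.factor_smooth.mul (hS.smooth i j k)
  symm_left i j k y := by rw [hS.symm_left]
  symm_right i j k y := by rw [hS.symm_right]
  trace y hy k := by
    have hE := h.factor_ne y
    rw [← hS.trace y hy k]
    refine Finset.sum_congr rfl fun a _ => Finset.sum_congr rfl fun b _ => ?_
    rw [h.gInv_eq hy]
    field_simp

lemma ConformalOn.contrSQ_eq (h : ConformalOn G G' E w U) (hy : y ∈ U)
    (Q : Fin n → Fin n → Model n → ℝ) (k : Fin n) :
    contrSQ G' (fun a b c z => E z * S a b c z) Q k y = (E y)⁻¹ * contrSQ G S Q k y := by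
  have hE := h.factor_ne y
  simp only [contrSQ, h.up2_eq hy, Finset.mul_sum]
  exact Finset.sum_congr rfl fun a _ => Finset.sum_congr rfl fun b _ => by field_simp

end Smoothness

/-! ### The conformal variation of τ and its contractions. -/

section DivergenceOfTau

variable {U : Set (Model 2)} {G G' : Fin 2 → Fin 2 → Model 2 → ℝ} {E w : Model 2 → ℝ}
  {S : Fin 2 → Fin 2 → Fin 2 → Model 2 → ℝ} {t : Model 2 → ℝ} {y : Model 2}

/-- The conformal variation of `τ`. -/
noncomputable def tauVariation (G : Fin 2 → Fin 2 → Model 2 → ℝ)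
    (S : Fin 2 → Fin 2 → Fin 2 → Model 2 → ℝ) (t w : Model 2 → ℝ) (i j : Fin 2) (z : Model 2) : ℝ :=
  (-2 * hess G w i j z
    + (laplacian G w z + (-2 * gradInner G w t z + 2 * gradInner G w w z)) * G i j z)
  + (2 * (pd i w z * pd j t z) + 2 * (pd i t z * pd j w z))
  + (-4 * (pd i w z * pd j w z) + 2 * contrS G S w i j z)

lemma ConformalOn.tau_eq (h : ConformalOn G G' E w U) (hS : SymmTraceFreeOn G S U)
    (ht : ContDiffOn ℝ ∞ t U) (hy : y ∈ U) (i j : Fin 2) :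
    tau G' (fun a b c z => E z * S a b c z) (fun z => t z - 3 * w z) i j y =
      tau G S t i j y + tauVariation G S t w i j y := by
  have hU := h.base.isOpen
  have hE := h.factor_ne y
  have hp := pd_sub_smul hU hy ht h.exponent_smooth
  have e1 : gradSq G' (fun z => t z - 3 * w z) y =
      (E y)⁻¹ * (gradSq G t y - 6 * gradInner G w t y + 9 * gradInner G w w y) := by
    have := gradSq_sub_smul h.base hp
    rw [gradSq, gradSq, ← gradInner, ← gradInner] at this
    rw [gradSq, ← gradInner, h.gradInner_eq hy, gradSq, ← gradInner, this]
    rfl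
  have e2 : gradInner G w (fun z => t z - 3 * w z) y =
      gradInner G w t y - 3 * gradInner G w w y := by
    simp only [gradInner, hp, mul_sub, Finset.sum_sub_distrib, Finset.mul_sum]
    congr 1
    exact Finset.sum_congr rfl fun a _ => by ring
  have e3 : laplacian G (fun z => t z - 3 * w z) y = laplacian G t y - 3 * laplacian G w y := by
    simp only [laplacian, hess_sub_smul hU hy ht h.exponent_smooth, mul_sub,
      Finset.sum_sub_distrib, Finset.mul_sum]
    congr 1
    exact Finset.sum_congr rfl fun a _ => Finset.sum_congr rfl fun b _ => by ring
  rw [tau, tau, tauVariation, h.hess_eq hy, h.laplacian_eq hy,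
    hess_sub_smul hU hy ht h.exponent_smooth, h.contrS_eq hy, contrS_sub_smul hp,
    h.xi_eq hS ht hy, e1, e2, e3, hp, hp, h.eq]
  push_cast
  field_simp
  ring

/-- The Bochner identity handles the third derivatives of w, with Ric = ½Rg. The contractions of
Hessians with gradients cancel between the products of differentials and the multiple of the metric.
Differentiability is included because adding divergences requires it. -/
lemma divergence_tauVariation (hG : SmoothMetricOn G U) (hS : SymmTraceFreeOn G S U)
    (ht : ContDiffOn ℝ ∞ t U) (hw : ContDiffOn ℝ ∞ w U) (hy : y ∈ U) (k : Fin 2) :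
    (∀ i j, DifferentiableAt ℝ (tauVariation G S t w i j) y) ∧
    divergence G (tauVariation G S t w) k y =
      -pd k (laplacian G w) y - scal G y * pd k w y
      + 2 * (laplacian G w y * pd k t y + laplacian G t y * pd k w y)
      - 4 * laplacian G w y * pd k w y
      + 2 * ∑ m, (xi G S t k m y - 2 / 3 * contrS G S t k m y) * gradUp G w m y
      + 2 * contrSQ G S (hess G w) k y := by
  have hU := hG.isOpen
  have d : ∀ {f : Model 2 → ℝ}, ContDiffOn ℝ ∞ f U → DifferentiableAt ℝ f y := fun hf =>
    differentiableAt_of_contDiffOn hU hf hy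
  have dp : ∀ f h : Model 2 → ℝ, ContDiffOn ℝ ∞ f U → ContDiffOn ℝ ∞ h U → ∀ i j,
      DifferentiableAt ℝ (fun z => pd i f z * pd j h z) y := fun f h hf hh i j =>
    (d (contDiffOn_pd hU hf i)).fun_mul (d (contDiffOn_pd hU hh j))
  have dh := fun i j => d (contDiffOn_hess hG hw i j)
  have dc := fun i j => d (contDiffOn_contrS hG hS hw i j)
  have df1 := d (contDiffOn_laplacian hG hw)
  have df2 := d (contDiffOn_gradInner hG hw ht)
  have df3 := d (contDiffOn_gradInner hG hw hw)
  have df : DifferentiableAt ℝ (fun z => laplacian G w z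
      + (-2 * gradInner G w t z + 2 * gradInner G w w z)) y :=
    df1.fun_add ((df2.const_mul _).fun_add (df3.const_mul _))
  have dg := fun i j => d (hG.smooth i j)
  have d1 : ∀ i j, DifferentiableAt ℝ (fun z => -2 * hess G w i j z) y := fun i j =>
    (dh i j).const_mul _
  have d2 : ∀ i j, DifferentiableAt ℝ (fun z => (laplacian G w z
      + (-2 * gradInner G w t z + 2 * gradInner G w w z)) * G i j z) y := fun i j =>
    df.fun_mul (dg i j)
  have d3 : ∀ i j, DifferentiableAt ℝ (fun z => 2 * (pd i w z * pd j t z)) y := fun i j =>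
    (dp w t hw ht i j).const_mul _
  have d4 : ∀ i j, DifferentiableAt ℝ (fun z => 2 * (pd i t z * pd j w z)) y := fun i j =>
    (dp t w ht hw i j).const_mul _
  have d5 : ∀ i j, DifferentiableAt ℝ (fun z => -4 * (pd i w z * pd j w z)) y := fun i j =>
    (dp w w hw hw i j).const_mul _
  have d6 : ∀ i j, DifferentiableAt ℝ (fun z => 2 * contrS G S w i j z) y := fun i j =>
    (dc i j).const_mul _
  have d12 := fun i j => (d1 i j).fun_add (d2 i j)
  have d34 := fun i j => (d3 i j).fun_add (d4 i j)
  have d56 := fun i j => (d5 i j).fun_add (d6 i j)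
  have d14 := fun i j => (d12 i j).fun_add (d34 i j)
  refine ⟨fun i j => (d14 i j).fun_add (d56 i j), ?_⟩
  have er : ∑ a, ricci G k a y * gradUp G w a y = 1 / 2 * scal G y * pd k w y := by
    simp only [ricci_two hG hy, mul_assoc, ← Finset.mul_sum, sum_mul_gradUp hG hy]
  have e : tauVariation G S t w = fun i j z => (-2 * hess G w i j z
    + (laplacian G w z + (-2 * gradInner G w t z + 2 * gradInner G w w z)) * G i j z)
    + (2 * (pd i w z * pd j t z) + 2 * (pd i t z * pd j w z))
    + (-4 * (pd i w z * pd j w z) + 2 * contrS G S w i j z) := rfl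
  rw [e, divergence_add d14 d56, divergence_add d12 d34, divergence_add d1 d2,
    divergence_add d3 d4, divergence_add d5 d6, divergence_const_mul dh,
    divergence_const_mul (dp w t hw ht), divergence_const_mul (dp t w ht hw),
    divergence_const_mul (dp w w hw hw), divergence_const_mul dc, divergence_mul_metric hG hy df,
    divergence_hess hG hy hw, divergence_pd_mul_pd hG hy hw ht, divergence_pd_mul_pd hG hy ht hw,
    divergence_pd_mul_pd hG hy hw hw, divergence_contrS (t := t) hG hS hy hw,
    pd_add df1 ((df2.const_mul _).fun_add (df3.const_mul _)),
    pd_add (df2.const_mul _) (df3.const_mul _), pd_const_mul df2, pd_const_mul df3,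
    pd_gradInner hG hy hw ht, pd_gradInner hG hy hw hw, er]
  ring

/-- The multiple of the metric drops out since S is trace-free. The term |S|²dw comes from 2S(grad
w), because SᵢᵃᵇSⱼₐᵦ is pure trace. -/
lemma contrSQ_tauVariation (hG : SmoothMetricOn G U) (hS : SymmTraceFreeOn G S U) (hy : y ∈ U)
    (h0 : G 0 0 y ≠ 0) (k : Fin 2) :
    contrSQ G S (tauVariation G S t w) k y = -2 * contrSQ G S (hess G w) k y
      + 4 * ∑ a, contrS G S t k a y * gradUp G w a y
      - 4 * ∑ a, contrS G S w k a y * gradUp G w a y + normSqS G S y * pd k w y := by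
  have e : tauVariation G S t w = fun i j z => (-2 * hess G w i j z
    + (laplacian G w z + (-2 * gradInner G w t z + 2 * gradInner G w w z)) * G i j z)
    + (2 * (pd i w z * pd j t z) + 2 * (pd i t z * pd j w z))
    + (-4 * (pd i w z * pd j w z) + 2 * contrS G S w i j z) := rfl
  have hm := contrSQ_mul (G := G) (S := S) (y := y)
  have e2 : ∑ m, gradUp G w m y * contrSS2 G S m k y = 1 / 2 * normSqS G S y * pd k w y := by
    rw [← sum_gradUp_mul hG hy w k, Finset.mul_sum]
    exact Finset.sum_congr rfl fun m _ => by rw [contrSS2_two hG hS hy h0]; ring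
  rw [e, contrSQ_add, contrSQ_add, contrSQ_add, contrSQ_add, contrSQ_add,
    hm (fun _ => -2) (hess G w), hm (fun z => laplacian G w z
      + (-2 * gradInner G w t z + 2 * gradInner G w w z)) G,
    hm (fun _ => 2) (fun i j z => pd i w z * pd j t z),
    hm (fun _ => 2) (fun i j z => pd i t z * pd j w z),
    hm (fun _ => -4) (fun i j z => pd i w z * pd j w z),
    hm (fun _ => 2) (contrS G S w), contrSQ_metric hG hS hy, contrSQ_pd_mul_pd,
    contrSQ_pd_mul_pd, contrSQ_pd_mul_pd, contrSQ_contrS hS, e2, sum_contrS_mul_comm hS t w]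
  ring

end DivergenceOfTau

/-! ### The divergence equation and the full system for n = 2. -/

section StructEqTwo

variable {U : Set (Model 2)} {G G' : Fin 2 → Fin 2 → Model 2 → ℝ} {E w : Model 2 → ℝ}
  {S : Fin 2 → Fin 2 → Fin 2 → Model 2 → ℝ} {t : Model 2 → ℝ} {y : Model 2}

/-- Every term has weight E⁻¹, because the divergence of a symmetric trace-free tensor is
conformally covariant in dimension two. After division by E the claim is linear in the contractions
`L1`–`L8`, and their coefficients match. -/
lemma ConformalOn.div_tau_two (h : ConformalOn G G' E w U) (hS : SymmTraceFreeOn G S U)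
    (ht : ContDiffOn ℝ ∞ t U) (hy : y ∈ U) (h0 : G 0 0 y ≠ 0) (H : StructEqTwo G S t y)
    (k : Fin 2) :
    divergence G' (tau G' (fun a b c z => E z * S a b c z) (fun z => t z - 3 * w z)) k y =
    -contrSQ G' (fun a b c z => E z * S a b c z)
      (tau G' (fun a b c z => E z * S a b c z) (fun z => t z - 3 * w z)) k y
    + beta G' (fun a b c z => E z * S a b c z) (fun z => t z - 3 * w z) k y
    - 2 / 3 * ∑ a, xi G' (fun a b c z => E z * S a b c z) (fun z => t z - 3 * w z) k a y
      * gradUp G' (fun z => t z - 3 * w z) a y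
    - 4 / 9 * ∑ a, contrS G' (fun a b c z => E z * S a b c z) (fun z => t z - 3 * w z) k a y
      * gradUp G' (fun z => t z - 3 * w z) a y
    - 5 / 9 * normSqS G' (fun a b c z => E z * S a b c z) y * pd k (fun z => t z - 3 * w z) y
    + 1 / 2 * pd k (scal G') y - scal G' y * pd k (fun z => t z - 3 * w z) y := by
  have hU := h.base.isOpen
  have hE := h.factor_ne y
  have hw := h.exponent_smooth
  have hp := pd_sub_smul hU hy ht hw
  have ht' : ContDiffOn ℝ ∞ (fun z => t z - 3 * w z) U := ht.sub (contDiffOn_const.mul hw)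
  have hS' := h.symmTraceFreeOn hS
  have d : ∀ {f : Model 2 → ℝ}, ContDiffOn ℝ ∞ f U → DifferentiableAt ℝ f y := fun hf =>
    differentiableAt_of_contDiffOn hU hf hy
  have hgE : ∀ a b, gInv G a b y = E y * gInv G' a b y := by
    intro a b
    rw [h.gInv_eq hy]
    field_simp
  have xt := trace_xi_of_structEqTwo h.base hS hy H
  have xt' : ∑ a, ∑ b, gInv G' a b y *
      xi G' (fun a b c z => E z * S a b c z) (fun z => t z - 3 * w z) a b y = 0 := by
    simp only [h.gInv_eq hy, h.xi_eq hS ht hy, mul_assoc, ← Finset.mul_sum, xt, mul_zero]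
  have tt' : ∑ a, ∑ b, gInv G a b y *
      tau G' (fun a b c z => E z * S a b c z) (fun z => t z - 3 * w z) a b y = 0 := by
    simp only [hgE, mul_assoc, ← Finset.mul_sum, trace_tau two_ne_zero h.target hS' hy xt',
      mul_zero]
  obtain ⟨dv, ev⟩ := divergence_tauVariation h.base hS ht hw hy k
  have L1 : divergence G' (tau G' (fun a b c z => E z * S a b c z) (fun z => t z - 3 * w z)) k y =
      (E y)⁻¹ * (divergence G (tau G S t) k y + divergence G (tauVariation G S t w) k y) := by
    rw [h.divergence_eq hy (fun i j => tau_symm h.target hS' hy ht' i j) tt',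
      divergence_congr hU hy (Q := fun i j z => tau G S t i j z + tauVariation G S t w i j z)
        (fun i j z hz => h.tau_eq hS ht hz i j),
      divergence_add (fun i j => d (contDiffOn_tau h.base hS ht i j)) dv]
    push_cast
    ring
  have L2 : contrSQ G' (fun a b c z => E z * S a b c z)
      (tau G' (fun a b c z => E z * S a b c z) (fun z => t z - 3 * w z)) k y =
      (E y)⁻¹ * (contrSQ G S (tau G S t) k y + contrSQ G S (tauVariation G S t w) k y) := by
    rw [h.contrSQ_eq hy, contrSQ_congr (Q := fun i j z => tau G S t i j z + tauVariation G S t w i j z)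
      (fun i j => h.tau_eq hS ht hy i j), contrSQ_add]
  have L3 : divergence G (tau G S t) k y = -contrSQ G S (tau G S t) k y + beta G S t k y
      - 2 / 3 * ∑ a, xi G S t k a y * gradUp G t a y
      - 4 / 9 * ∑ a, contrS G S t k a y * gradUp G t a y
      - 5 / 9 * normSqS G S y * pd k t y + 1 / 2 * pd k (scal G) y - scal G y * pd k t y :=
    H.div_tau k
  -- The variation of div τ contains 2Δt·dw, for which there is no counterpart on the right; the
  -- trace equation turns it into |S|² and R terms.
  have L4 : laplacian G t y = 1 / 3 * normSqS G S y + 3 / 2 * scal G y :=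
    (hess_two_iff h.base hy).1 H.hess_t
  have hs : ∀ z ∈ U, scal G' z = (E z)⁻¹ * (scal G z - 2 * laplacian G w z) := by
    intro z hz
    rw [h.scal_eq hz]
    push_cast
    ring
  have L5 : pd k (scal G') y = (E y)⁻¹ * (pd k (scal G) y - 2 * pd k (laplacian G w) y
      - 2 * pd k w y * (scal G y - 2 * laplacian G w y)) := by
    -- Multiplying by E avoids differentiating E⁻¹.
    have e : ∀ z ∈ U, E z * scal G' z = scal G z - 2 * laplacian G w z := by
      intro z hz
      have := h.factor_ne z
      rw [hs z hz]
      field_simp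
    have dl := d (contDiffOn_laplacian h.base hw)
    have e2 := pd_congr hU e hy k
    rw [pd_mul (d h.factor_smooth) (d (contDiffOn_scal h.target)), h.pd_factor y hy,
      pd_sub (d (contDiffOn_scal h.base)) (dl.const_mul 2), pd_const_mul dl] at e2
    have e3 := e y hy
    rw [← e3, eq_inv_mul_iff_mul_eq₀ hE]
    linear_combination e2
  have L6 : ∑ a, xi G' (fun a b c z => E z * S a b c z) (fun z => t z - 3 * w z) k a y
      * gradUp G' (fun z => t z - 3 * w z) a y =
      (E y)⁻¹ * (∑ a, xi G S t k a y * gradUp G t a y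
        - 3 * ∑ a, xi G S t k a y * gradUp G w a y) := by
    simp only [h.xi_eq hS ht hy, h.gradUp_eq hy, gradUp_sub_smul hp, Finset.mul_sum,
      ← Finset.sum_sub_distrib]
    exact Finset.sum_congr rfl fun a _ => by ring
  have L7 : ∑ a, contrS G' (fun a b c z => E z * S a b c z) (fun z => t z - 3 * w z) k a y
      * gradUp G' (fun z => t z - 3 * w z) a y =
      (E y)⁻¹ * (∑ a, contrS G S t k a y * gradUp G t a y
        - 6 * ∑ a, contrS G S t k a y * gradUp G w a y
        + 9 * ∑ a, contrS G S w k a y * gradUp G w a y) := by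
    have e6 : 6 * ∑ a, contrS G S t k a y * gradUp G w a y =
        3 * ∑ a, contrS G S t k a y * gradUp G w a y
        + 3 * ∑ a, contrS G S w k a y * gradUp G t a y := by
      rw [sum_contrS_mul_comm hS t w]
      ring
    rw [e6]
    simp only [h.contrS_eq hy, contrS_sub_smul hp, h.gradUp_eq hy, gradUp_sub_smul hp,
      Finset.mul_sum, ← Finset.sum_sub_distrib, ← Finset.sum_add_distrib]
    exact Finset.sum_congr rfl fun a _ => by ring
  have L8 : ∑ m, (xi G S t k m y - 2 / 3 * contrS G S t k m y) * gradUp G w m y =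
      ∑ a, xi G S t k a y * gradUp G w a y
      - 2 / 3 * ∑ a, contrS G S t k a y * gradUp G w a y := by
    rw [Finset.mul_sum, ← Finset.sum_sub_distrib]
    exact Finset.sum_congr rfl fun a _ => by ring
  rw [L1, L2, L3, ev, contrSQ_tauVariation h.base hS hy h0, L4, L5, L6, L7, L8,
    h.beta_eq hS ht hy, h.normSqS_eq hy, hs y hy, hp]
  ring

theorem ConformalOn.structEqTwo (h : ConformalOn G G' E w U) (hS : SymmTraceFreeOn G S U)
    (ht : ContDiffOn ℝ ∞ t U) (hy : y ∈ U) (h0 : G 0 0 y ≠ 0) (H : StructEqTwo G S t y) :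
    StructEqTwo G' (fun a b c z => E z * S a b c z) (fun z => t z - 3 * w z) y where
  nabla_S := h.nabla_S_two hS ht hy H
  nabla_xi := h.nabla_xi_two hS ht hy H
  div_tau := h.div_tau_two hS ht hy h0 H
  hess_t := by
    have hE := h.factor_ne y
    have hU := h.base.isOpen
    have hp := pd_sub_smul hU hy ht h.exponent_smooth
    refine (hess_two_iff h.target hy).2 ?_
    have e3 : laplacian G (fun z => t z - 3 * w z) y = laplacian G t y - 3 * laplacian G w y := by
      simp only [laplacian, hess_sub_smul hU hy ht h.exponent_smooth, mul_sub,
        Finset.sum_sub_distrib, Finset.mul_sum]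
      congr 1
      exact Finset.sum_congr rfl fun a _ => Finset.sum_congr rfl fun b _ => by ring
    -- For n = 2 the Laplacian only scales, and −3Δw from t' equals (3/2)(−2Δw) from the scalar
    -- curvature.
    rw [h.laplacian_eq hy, h.normSqS_eq hy, h.scal_eq hy, e3,
      (hess_two_iff h.base hy).1 H.hess_t]
    push_cast
    ring

end StructEqTwo

/-! ### Components of metrics and functions in charts. -/

section Charts

variable {n : ℕ} {M : Type*} [TopologicalSpace M] [ChartedSpace (Model n) M]
  {e : OpenPartialHomeomorph M (Model n)} {y : Model n}

lemma mdifferentiable_of_mem_maximalAtlas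
    (he : e ∈ IsManifold.maximalAtlas 𝓘(ℝ, Model n) ∞ M) :
    e.MDifferentiable 𝓘(ℝ, Model n) 𝓘(ℝ, Model n) :=
  ⟨(contMDiffOn_of_mem_maximalAtlas he).mdifferentiableOn (by simp),
    (contMDiffOn_symm_of_mem_maximalAtlas he).mdifferentiableOn (by simp)⟩

lemma contDiffOn_comp_chart_symm (he : e ∈ IsManifold.maximalAtlas 𝓘(ℝ, Model n) ∞ M)
    {f : M → ℝ} (hf : SmoothFun n f) : ContDiffOn ℝ ∞ (f ∘ e.symm) e.target :=
  (hf.comp_contMDiffOn (contMDiffOn_symm_of_mem_maximalAtlas he)).contDiffOn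

lemma pd_comp_chart_symm (he : e ∈ IsManifold.maximalAtlas 𝓘(ℝ, Model n) ∞ M) (hy : y ∈ e.target)
    {f : M → ℝ} (hf : SmoothFun n f) (k : Fin n) :
    pd k (f ∘ e.symm) y = differential n f (e.symm y) (coordVec e k y) := by
  have h1 : MDifferentiableAt 𝓘(ℝ, Model n) 𝓘(ℝ, ℝ) f (e.symm y) :=
    (hf _).mdifferentiableAt (by simp)
  have h2 := (mdifferentiable_of_mem_maximalAtlas he).mdifferentiableAt_symm hy
  have h3 := mfderiv_comp_apply y h1 h2 (EuclideanSpace.single k (1 : ℝ) : Model n)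
  rw [mfderiv_eq_fderiv] at h3
  exact h3

lemma sum_smul_coordVec (c : Fin n → ℝ) :
    ∑ a, c a • coordVec e a y = mfderiv 𝓘(ℝ, Model n) 𝓘(ℝ, Model n) e.symm y
      (WithLp.toLp 2 c : Model n) := by
  have hc : (WithLp.toLp 2 c : Model n) = ∑ a, c a • EuclideanSpace.single a (1 : ℝ) := by
    ext b
    simp [Finset.sum_apply, Pi.single_apply]
  rw [hc]
  exact ((map_sum (mfderiv 𝓘(ℝ, Model n) 𝓘(ℝ, Model n) e.symm y)
    (fun a => (c a • EuclideanSpace.single a (1 : ℝ) : Model n)) Finset.univ).trans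
    (Finset.sum_congr rfl fun a _ =>
      map_smul (mfderiv 𝓘(ℝ, Model n) 𝓘(ℝ, Model n) e.symm y) (c a) _)).symm

/-- Coordinate fields are independent because the derivative of the inverse chart is injective. -/
lemma sum_smul_coordVec_eq_zero (he : e ∈ IsManifold.maximalAtlas 𝓘(ℝ, Model n) ∞ M)
    (hy : y ∈ e.target) {c : Fin n → ℝ} (hc : ∑ a, c a • coordVec e a y = 0) : c = 0 := by
  rw [sum_smul_coordVec] at hc
  have inj := (mdifferentiable_of_mem_maximalAtlas he).symm.mfderiv_injective
    (x := y) (by simpa using hy)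
  have h0 : (WithLp.toLp 2 c : Model n) = 0 := inj (hc.trans (map_zero _).symm)
  funext a
  exact congrArg (fun v : Model n => v a) h0

lemma coordVec_ne_zero (he : e ∈ IsManifold.maximalAtlas 𝓘(ℝ, Model n) ∞ M)
    (hy : y ∈ e.target) (i : Fin n) : coordVec e i y ≠ 0 := by
  intro h
  have := sum_smul_coordVec_eq_zero he hy (c := Pi.single i 1) (by
    rw [Finset.sum_eq_single i (fun b _ hb => by simp [hb]) (by simp)]
    simp [h])
  simpa using congrFun this i

variable [IsManifold 𝓘(ℝ, Model n) ∞ M]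

/-- A coordinate field is the image of a constant section under the tangent map of the inverse
chart. -/
lemma contMDiffOn_coordVec (he : e ∈ IsManifold.maximalAtlas 𝓘(ℝ, Model n) ∞ M) (i : Fin n) :
    ContMDiffOn 𝓘(ℝ, Model n) (𝓘(ℝ, Model n).prod 𝓘(ℝ, Model n)) ∞
      (fun y => Bundle.TotalSpace.mk' (Model n) (E := fun x : M => Tan n x) (e.symm y)
        (coordVec e i y)) e.target := by
  have h1 := (contMDiffOn_symm_of_mem_maximalAtlas he).contMDiffOn_tangentMapWithin
    (m := ∞) (by simp) e.open_target.uniqueMDiffOn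
  have h2 : ContMDiffOn 𝓘(ℝ, Model n) 𝓘(ℝ, Model n).tangent ∞
      (fun y => (⟨y, (EuclideanSpace.single i (1 : ℝ) : Model n)⟩ :
        TangentBundle 𝓘(ℝ, Model n) (Model n))) e.target :=
    contMDiffOn_vectorSpace_iff_contDiffOn.2 contDiffOn_const
  refine (h1.comp h2 fun y hy => hy).congr fun y hy => ?_
  simp only [Function.comp_apply, tangentMapWithin, coordVec, Bundle.TotalSpace.mk']
  rw [mfderivWithin_of_isOpen e.open_target hy]

lemma smoothMetricOn_metricComp (g : Metric n M)
    (he : e ∈ IsManifold.maximalAtlas 𝓘(ℝ, Model n) ∞ M) :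
    SmoothMetricOn (metricComp g e) e.target where
  isOpen := e.open_target
  symm i j y := g.symm _ _ _
  smooth i j := by
    rw [← contMDiffOn_iff_contDiffOn]
    have h : ContMDiffOn 𝓘(ℝ, Model n) (𝓘(ℝ, Model n).prod 𝓘(ℝ, ℝ)) ∞
        (fun y => Bundle.TotalSpace.mk' ℝ (E := Bundle.Trivial M ℝ) (e.symm y)
          (g.inner (e.symm y) (coordVec e i y) (coordVec e j y))) e.target := by
      apply ContMDiffOn.clm_bundle_apply₂ (F₁ := Model n) (F₂ := Model n)
      · exact g.contMDiff.comp_contMDiffOn (contMDiffOn_symm_of_mem_maximalAtlas he)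
      · exact contMDiffOn_coordVec he i
      · exact contMDiffOn_coordVec he j
    intro y hy
    have := h y hy
    simp only [Bundle.contMDiffWithinAt_totalSpace] at this
    exact this.2
  isUnit_det y hy := by
    rw [isUnit_iff_ne_zero]
    intro h0
    -- A kernel vector of the Gram matrix would give a nonzero tangent vector of length zero.
    obtain ⟨c, hc, hc0⟩ := Matrix.exists_mulVec_eq_zero_iff.2 h0
    refine hc (sum_smul_coordVec_eq_zero he hy (c := c) ?_)
    by_contra hv
    refine (g.pos (e.symm y) _ hv).ne' ?_
    have h1 : ∀ a, ∑ b, g.inner (e.symm y) (coordVec e a y) (coordVec e b y) * c b = 0 := fun a =>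
      congrFun hc0 a
    simp only [map_sum, map_smul, sum_apply, smul_apply, smul_eq_mul]
    refine Finset.sum_eq_zero fun a _ => ?_
    rw [← mul_zero (c a), ← h1 a]
    congr 1
    exact Finset.sum_congr rfl fun b _ => by rw [g.symm, mul_comm]

lemma metricComp_self_ne_zero (g : Metric n M)
    (he : e ∈ IsManifold.maximalAtlas 𝓘(ℝ, Model n) ∞ M) (hy : y ∈ e.target) (i : Fin n) :
    metricComp g e i i y ≠ 0 :=
  (g.pos _ _ (coordVec_ne_zero he hy i)).ne'

end Charts

/-! ### Transfer of the abundant structure to the rescaled metric. -/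

section Rescaling

variable {n : ℕ} {M : Type*} [TopologicalSpace M] [ChartedSpace (Model n) M]
  [IsManifold 𝓘(ℝ, Model n) ∞ M] {e : OpenPartialHomeomorph M (Model n)}
  {g g' : Metric n M} {Ω f : M → ℝ}

lemma raiseLower_eq (h : IsRescaling Ω g g') (S : Tensor3 n M) (x : M) (u v w : Tan n x) :
    raiseLower g g' S x u v w = Ω x ^ 2 * S x u v w := by
  rw [raiseLower_apply, h.eq, inner_sharp]

lemma tensorComp_raiseLower (h : IsRescaling Ω g g') (S : Tensor3 n M)
    (e : OpenPartialHomeomorph M (Model n)) :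
    tensorComp (raiseLower g g' S) e =
      fun i j k y => Ω (e.symm y) ^ 2 * tensorComp S e i j k y := by
  funext i j k y
  exact raiseLower_eq h S _ _ _ _

/-- Only the differential of `f` is prescribed, so any difference of potentials serves as exponent,
on a disconnected manifold too. -/
lemma IsRescaling.conformalOn (h : IsRescaling Ω g g') (hf : SmoothFun n f)
    (hd : ∀ x, differential n f x = differential n (fun z => Real.log |Ω z|) x)
    (he : e ∈ IsManifold.maximalAtlas 𝓘(ℝ, Model n) ∞ M) :
    ConformalOn (metricComp g e) (metricComp g' e) (fun y => Ω (e.symm y) ^ 2) (f ∘ e.symm)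
      e.target where
  base := smoothMetricOn_metricComp g he
  factor_smooth := (contDiffOn_comp_chart_symm he h.smooth).pow 2
  factor_ne y := pow_ne_zero 2 (h.ne_zero _)
  exponent_smooth := contDiffOn_comp_chart_symm he hf
  pd_factor y hy k := by
    have hΩ := differentiableAt_of_contDiffOn e.open_target
      (contDiffOn_comp_chart_symm he h.smooth) hy
    have h1 : pd k (f ∘ e.symm) y = pd k (fun z => Real.log ((Ω ∘ e.symm) z)) y := by
      rw [pd_comp_chart_symm he hy hf, hd,
        ← pd_comp_chart_symm he hy (smoothFun_log_abs h.smooth h.ne_zero)]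
      congr 1
      funext z
      simp [Real.log_abs]
    have hne : (Ω ∘ e.symm) y ≠ 0 := h.ne_zero _
    have h2 : pd k (fun z => Real.log ((Ω ∘ e.symm) z)) y =
        ((Ω ∘ e.symm) y)⁻¹ * pd k (Ω ∘ e.symm) y := by
      simp only [pd]
      rw [fderiv.log hΩ hne]
      rfl
    have h3 : (fun y => Ω (e.symm y) ^ 2) = fun y => (Ω ∘ e.symm) y * (Ω ∘ e.symm) y := by
      funext z
      simp [sq]
    have h4 : Ω (e.symm y) = (Ω ∘ e.symm) y := rfl
    rw [h3, pd_mul hΩ hΩ, h1, h2]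
    simp only [h4]
    field_simp
    ring
  eq i j y := h.eq _ _ _

lemma IsRescaling.isConformallyFlat (h : IsRescaling Ω g g') (hg : IsConformallyFlat g) :
    IsConformallyFlat g' := by
  obtain ⟨Λ, k, hk, hflat⟩ := hg
  -- The same flat metric serves, with factor Λ/Ω.
  refine ⟨fun x => Λ x * (Ω x)⁻¹, k, ⟨hk.smooth.mul (h.smooth.inv₀ h.ne_zero),
    fun x => mul_ne_zero (hk.ne_zero x) (inv_ne_zero (h.ne_zero x)), fun x v w => ?_⟩, hflat⟩
  have := h.ne_zero x
  rw [hk.eq, h.eq]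
  field_simp

lemma IsAbundantStructure.symmTraceFreeOn {S : Tensor3 n M} {t : M → ℝ}
    (hS : IsAbundantStructure g S t) (he : e ∈ IsManifold.maximalAtlas 𝓘(ℝ, Model n) ∞ M) :
    SymmTraceFreeOn (metricComp g e) (tensorComp S e) e.target where
  smooth := hS.smooth_S e he
  symm_left _ _ _ _ := hS.symm_left _ _ _ _
  symm_right _ _ _ _ := hS.symm_right _ _ _ _
  trace := hS.traceFree e he

theorem IsAbundantStructure.rescale {S : Tensor3 n M} {t : M → ℝ}
    (hS : IsAbundantStructure g S t) (h : IsRescaling Ω g g') (hf : SmoothFun n f)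
    (hd : ∀ x, differential n f x = differential n (fun z => Real.log |Ω z|) x) :
    IsAbundantStructure g' (raiseLower g g' S) (fun x => t x - 3 * f x) where
  two_le_dim := hS.two_le_dim
  conformallyFlat := h.isConformallyFlat hS.conformallyFlat
  smooth_S e he i j k := by
    rw [tensorComp_raiseLower h]
    exact ((contDiffOn_comp_chart_symm he h.smooth).pow 2).mul (hS.smooth_S e he i j k)
  smooth_t := hS.smooth_t.sub (contMDiff_const.mul hf)
  symm_left x u v w := by rw [raiseLower_eq h, raiseLower_eq h, hS.symm_left]
  symm_right x u v w := by rw [raiseLower_eq h, raiseLower_eq h, hS.symm_right]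
  traceFree e he := by
    rw [tensorComp_raiseLower h]
    exact ((h.conformalOn hf hd he).symmTraceFreeOn (hS.symmTraceFreeOn he)).trace
  eq_high hn e he y hy := by
    rw [tensorComp_raiseLower h]
    exact (h.conformalOn hf hd he).structEqHigh hn hy (hS.symmTraceFreeOn he)
      (contDiffOn_comp_chart_symm he hS.smooth_t) (hS.eq_high hn e he y hy)
  eq_two hn e he y hy := by
    subst hn
    rw [tensorComp_raiseLower h]
    exact (h.conformalOn hf hd he).structEqTwo (hS.symmTraceFreeOn he)
      (contDiffOn_comp_chart_symm he hS.smooth_t) hy (metricComp_self_ne_zero g he hy 0)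
      (hS.eq_two rfl e he y hy)

end Rescaling

end WeylAbundant

theorem mainTheorem6 {n : ℕ} {M : Type*} [TopologicalSpace M]
    [ChartedSpace (WeylAbundant.Model n) M]
    [IsManifold 𝓘(ℝ, WeylAbundant.Model n) ∞ M]
    (Φ : WeylAbundant.WeylianMetric n M) (hΦ : Φ.IsExact)
    (p p' : WeylAbundant.WeylPair n M) (hp : p.Represents Φ) (hp' : p'.Represents Φ)
    (φ φ' : M → ℝ) (hφ : WeylAbundant.IsPotential φ p.form)
    (hφ' : WeylAbundant.IsPotential φ' p'.form)
    (S : WeylAbundant.Tensor3 n M) (t : M → ℝ)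
    (hS : WeylAbundant.IsAbundantStructure p.metric S t) :
    WeylAbundant.IsAbundantStructure p'.metric
      (WeylAbundant.raiseLower p.metric p'.metric S)
      (fun x => t x - 3 * (φ x - φ' x)) := by
  obtain ⟨Ω, hΩ, hform⟩ : p.Rel p' := Quotient.exact (hp.trans hp'.symm)
  -- The exponent is φ − φ'; the relation between the one-forms says that its differential is d
  -- ln|Ω|.
  refine hS.rescale hΩ (hφ.smooth.sub hφ'.smooth) fun x => ?_
  have h1 := (hφ.smooth x).mdifferentiableAt (by simp)
  have h2 := (hφ'.smooth x).mdifferentiableAt (by simp)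
  have h3 := hform x
  rw [hφ.eq, hφ'.eq] at h3
  change mvfderiv _ (φ - φ') x = _
  rw [mvfderiv_sub h1 h2]
  change WeylAbundant.differential n φ x - WeylAbundant.differential n φ' x = _
  rw [h3]
  abel
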